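/- Let $V\ge 0$ be a measurable potential on $(0,\infty)$ with $\int_0^\infty V(x)(1+x^2)\,dx<\infty$. For $L>0$ let $H_L=-\frac{d^2}{dx^2}$ and $H_L'=-\frac{d^2}{dx^2}+V$ on $L^2((0,L))$ with Dirichlet boundary conditions at $0$ and $L$, let $\lambda_1^L\le\lambda_2^L\le\cdots$ and $\mu_1^L\le\mu_2^L\le\cdots$ be their eigenvalues counted with multiplicity, and let $E_L^N=\sum_{n=1}^N\lambda_n^L$ and $E_L'^N=\sum_{n=1}^N\mu_n^L$ be the ground-state energies of the corresponding $N$-particle non-interacting Fermi gases. Let $H=-\frac{d^2}{dx^2}$ and $H'=-\frac{d^2}{dx^2}+V$ be the operators on $L^2((0,\infty))$ with Dirichlet condition at $0$. For $k>0$ the scattering phase shift is $\delta(k)=\lim_{x\to\infty}(\theta_k(x)-kx)$, where the Prüfer angle $\theta_k$ is the locally absolutely continuous solution on $[0,\infty)$ of $\theta_k'=k-\frac1k V\sin^2\theta_k$, $\theta_k(0)=0$. The spectral shift function $\xi$ of the pair $(H,H')$ is the function, unique up to null sets, with $\xi=0$ on $(-\infty,0)$, $\int\frac{|\xi(x)|}{1+x^2}\,dx<\infty$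 and $$\operatorname{Tr}\big((H'+s)^{-1}-(H+s)^{-1}\big)=-\int_0^\infty\frac{\xi(x)}{(x+s)^2}\,dx\qquad\text{for all } s>0 .$$ Then $\delta(k)$ exists for every $k>0$, $\xi$ exists and has a representative that is continuous on $(0,\infty)$ (which is used below), $x\mapsto\delta(\sqrt x)$ is integrable on bounded intervals $(0,M)$, and for every Fermi energy $E>0$, with $\zeta(E)=\frac1{\pi^2}\delta^2(\sqrt E)$, $$E_L'^N-E_L^N=-\frac1\pi\int_0^{(N\pi/L)^2}\delta(\sqrt x)\,dx+\frac{\sqrt E}{L}\Big(-\delta(\sqrt E)+\frac1\pi\delta^2(\sqrt E)\Big)+o\Big(\frac1L\Big)$$ and $$E_L'^N-E_L^N=\int_0^E\xi(x)\,dx+\int_E^{(N\pi/L)^2}\xi(x)\,dx+\frac{\sqrt E\,\pi}{L}\big(\xi(E)+\zeta(E)\big)+o\Big(\frac1L\Big)$$ as $N\to\infty$, $L\to\infty$ with $\frac NL\to\frac{\sqrt E}{\pi}$. -/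

import Mathlib

open MeasureTheory Set Filter Topology Asymptotics

/-- The complex Hilbert space `L²(I)`, with respect to Lebesgue measure. -/
abbrev L2On (I : Set ℝ) : Type := Lp ℂ 2 ((volume : Measure ℝ).restrict I)

/-- `u` represents an element of the domain of the Dirichlet operator `-d²/dx² + V` on the open
interval `I`, and `g` is the image of that element: `u` and its derivative `v` are (locally, up to
the finite end points) absolutely continuous, `u` vanishes at the finite end points of `I`, and
`-v' + V u = g` almost everywhere on `I`. -/
structure IsDirichletPair (V : ℝ → ℝ) (I : Set ℝ) (u v g : ℝ → ℂ) : Prop where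
  ac_fst : ∀ a ∈ closure I, ∀ b ∈ closure I, AbsolutelyContinuousOnInterval u a b
  ac_snd : ∀ a ∈ closure I, ∀ b ∈ closure I, AbsolutelyContinuousOnInterval v a b
  boundary : ∀ x ∈ frontier I, u x = 0
  deriv_fst : ∀ x ∈ I, HasDerivAt u (v x) x
  deriv_snd : ∀ᵐ x ∂(volume : Measure ℝ).restrict I, HasDerivAt v ((V x : ℂ) * u x - g x) x

/-- The graph `{(f, -f'' + V f)}` of the Dirichlet Schrödinger operator on the open interval `I`. -/
noncomputable def dirichletGraph (V : ℝ → ℝ) (I : Set ℝ) : Submodule ℂ (L2On I × L2On I) where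
  carrier := {p | ∃ u v : ℝ → ℂ,
    IsDirichletPair V I u v p.2 ∧ p.1 =ᵐ[(volume : Measure ℝ).restrict I] u}
  zero_mem' := by
    refine ⟨fun _ => 0, fun _ => 0, ⟨?_, ?_, fun _ _ => rfl, ?_, ?_⟩, Lp.coeFn_zero _ _ _⟩
    · intro a _ b _
      exact ((LipschitzWith.const (0 : ℂ)).lipschitzOnWith
        (s := uIcc a b)).absolutelyContinuousOnInterval
    · intro a _ b _
      exact ((LipschitzWith.const (0 : ℂ)).lipschitzOnWith
        (s := uIcc a b)).absolutelyContinuousOnInterval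
    · intro x _
      exact hasDerivAt_const x 0
    · filter_upwards [Lp.coeFn_zero ℂ 2 ((volume : Measure ℝ).restrict I)] with x hx
      simp only [Prod.snd_zero, hx]
      simpa using hasDerivAt_const x (0 : ℂ)
  add_mem' := by
    rintro p q ⟨u, v, h, hp⟩ ⟨u', v', h', hq⟩
    refine ⟨u + u', v + v', ⟨?_, ?_, ?_, ?_, ?_⟩, ?_⟩
    · exact fun a ha b hb => (h.ac_fst a ha b hb).add (h'.ac_fst a ha b hb)
    · exact fun a ha b hb => (h.ac_snd a ha b hb).add (h'.ac_snd a ha b hb)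
    · intro x hx
      simp [h.boundary x hx, h'.boundary x hx]
    · exact fun x hx => (h.deriv_fst x hx).add (h'.deriv_fst x hx)
    · filter_upwards [Lp.coeFn_add p.2 q.2, h.deriv_snd, h'.deriv_snd] with x hx h1 h2
      refine (h1.add h2).congr_deriv ?_
      simp only [Prod.snd_add, hx, Pi.add_apply]
      ring
    · filter_upwards [Lp.coeFn_add p.1 q.1, hp, hq] with x hx h1 h2
      simp only [Prod.fst_add, hx, Pi.add_apply, h1, h2]
  smul_mem' := by
    rintro c p ⟨u, v, h, hp⟩
    refine ⟨c • u, c • v, ⟨?_, ?_, ?_, ?_, ?_⟩, ?_⟩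
    · exact fun a ha b hb => (h.ac_fst a ha b hb).const_smul c
    · exact fun a ha b hb => (h.ac_snd a ha b hb).const_smul c
    · intro x hx
      simp [h.boundary x hx]
    · exact fun x hx => (h.deriv_fst x hx).const_smul c
    · filter_upwards [Lp.coeFn_smul c p.2, h.deriv_snd] with x hx h1
      refine (h1.const_smul c).congr_deriv ?_
      simp only [Prod.smul_snd, hx, Pi.smul_apply, smul_eq_mul]
      ring
    · filter_upwards [Lp.coeFn_smul c p.1, hp] with x hx h1
      simp only [Prod.smul_fst, hx, Pi.smul_apply, h1]

/-- The Schrödinger operator `-d²/dx² + V` on `L²(I)` with Dirichlet boundary conditions at the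
finite end points of the open interval `I`, as an unbounded operator. -/
noncomputable def dirichletSchrodinger (V : ℝ → ℝ) (I : Set ℝ) : L2On I →ₗ.[ℂ] L2On I :=
  (dirichletGraph V I).toLinearPMap

/-- The image `-f'' + V f` is determined by `f`, so that `dirichletGraph` really is the graph of
`dirichletSchrodinger`. -/
theorem dirichletSchrodinger_graph (V : ℝ → ℝ) {I : Set ℝ} (hI : IsOpen I) :
    (dirichletSchrodinger V I).graph = dirichletGraph V I := by
  refine Submodule.toLinearPMap_graph_eq _ ?_
  rintro ⟨f, g⟩ ⟨u, v, h, hu⟩ hf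
  simp only at hf hu h ⊢
  subst hf
  have hu0 : EqOn u (fun _ => (0 : ℂ)) I := by
    refine Measure.eqOn_open_of_ae_eq (μ := (volume : Measure ℝ)) ?_ hI
      (fun x hx => (h.deriv_fst x hx).continuousAt.continuousWithinAt) continuousOn_const
    filter_upwards [hu, Lp.coeFn_zero ℂ 2 ((volume : Measure ℝ).restrict I)] with x h1 h2
    rw [← h1, h2]; rfl
  have hv0 : ∀ x ∈ I, v x = 0 := fun x hx =>
    (h.deriv_fst x hx).unique ((hasDerivAt_const x (0 : ℂ)).congr_of_eventuallyEq
      (hu0.eventuallyEq_of_mem (hI.mem_nhds hx)))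
  refine (Lp.eq_zero_iff_ae_eq_zero).2 ?_
  filter_upwards [h.deriv_snd, ae_restrict_mem hI.measurableSet] with x h1 hx
  have h2 : HasDerivAt v 0 x := (hasDerivAt_const x (0 : ℂ)).congr_of_eventuallyEq
    ((show EqOn v (fun _ => (0 : ℂ)) I from hv0).eventuallyEq_of_mem (hI.mem_nhds hx))
  have h3 := h1.unique h2
  rw [hu0 hx] at h3
  simpa using h3

section Operators

variable {H : Type} [NormedAddCommGroup H] [InnerProductSpace ℂ H]

/-- The eigenspace `{f ∈ dom A | A f = t f}` of an unbounded operator at a real number `t`. -/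
def opEigenspace (A : H →ₗ.[ℂ] H) (t : ℝ) : Submodule ℂ H :=
  A.graph.comap (LinearMap.prod LinearMap.id ((t : ℂ) • LinearMap.id))

/-- The `n`-th smallest eigenvalue (`n = 1, 2, …`), counting multiplicities: the least `t` for which
the eigenvectors with eigenvalues `≤ t` span a space of dimension at least `n`. -/
noncomputable def nthEigenvalue (A : H →ₗ.[ℂ] H) (n : ℕ) : ℝ :=
  sInf {t : ℝ | (n : Cardinal) ≤ Module.rank ℂ (⨆ s : Iic t, opEigenspace A (s : ℝ) : Submodule ℂ H)}

/-- Ground-state energy of `N` non-interacting fermions with one-particle operator `A`: the sum of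
the `N` smallest eigenvalues of `A`. -/
noncomputable def groundStateEnergy (A : H →ₗ.[ℂ] H) (N : ℕ) : ℝ :=
  ∑ n ∈ Finset.Icc 1 N, nthEigenvalue A n

/-- The bounded operator `R` is the resolvent `(A - z)⁻¹`. -/
def IsResolventAt (A : H →ₗ.[ℂ] H) (z : ℂ) (R : H →L[ℂ] H) : Prop :=
  (∀ f : H, ∃ h : R f ∈ A.domain, A ⟨R f, h⟩ - z • R f = f) ∧
    ∀ f : A.domain, R (A f - z • (f : H)) = f

/-- `T` is of trace class with trace `t`: the diagonal sum of `T` in every orthonormal basis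
converges (unconditionally) to `t`. -/
def HasTraceEq (T : H →L[ℂ] H) (t : ℂ) : Prop :=
  ∀ (ι : Type) (b : HilbertBasis ι ℂ H), HasSum (fun i => inner ℂ (b i) (T (b i))) t

/-- `ξ` is (a representative of) the spectral shift function of the pair `A`, `A'` of non-negative
self-adjoint operators: it vanishes below the spectra, `∫ |ξ(x)| / (1 + x²) dx < ∞`, and Krein's
trace formula `Tr (φ(A') - φ(A)) = ∫ φ'(x) ξ(x) dx` holds for the resolvent functions
`φ(x) = 1 / (x + s)`, `s > 0`. These conditions determine `ξ` up to a null set. -/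
structure IsSpectralShift (A A' : H →ₗ.[ℂ] H) (ξ : ℝ → ℝ) : Prop where
  eq_zero : ∀ x < 0, ξ x = 0
  integrable : Integrable (fun x : ℝ => ξ x / (1 + x ^ 2))
  trace_formula : ∀ s : ℝ, 0 < s → ∃ R R' : H →L[ℂ] H,
    IsResolventAt A (-(s : ℂ)) R ∧ IsResolventAt A' (-(s : ℂ)) R' ∧
      HasTraceEq (R' - R) ((-∫ x in Ioi (0 : ℝ), ξ x / (x + s) ^ 2 : ℝ) : ℂ)

end Operators

/-- `θ` is the Prüfer angle on the half-line at `k > 0`: the (locally absolutely continuous)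
solution of `θ' = k - (1/k) V sin² θ`, `θ(0) = 0`. -/
structure IsPruferAngle (V : ℝ → ℝ) (k : ℝ) (θ : ℝ → ℝ) : Prop where
  zero : θ 0 = 0
  ac : ∀ b : ℝ, 0 < b → AbsolutelyContinuousOnInterval θ 0 b
  ode : ∀ᵐ x ∂(volume : Measure ℝ).restrict (Ioi 0),
    HasDerivAt θ (k - 1 / k * (V x * Real.sin (θ x) ^ 2)) x

/-- `δ(k)`, `k > 0`, is the scattering phase shift of `-d²/dx²` and `-d²/dx² + V` on the half-line
with Dirichlet condition at the origin: `δ(k) = lim_{x → ∞} (θ_k(x) - k x)`. -/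
def IsPhaseShift (V : ℝ → ℝ) (δ : ℝ → ℝ) : Prop :=
  ∀ k : ℝ, 0 < k → ∃ θ : ℝ → ℝ, IsPruferAngle V k θ ∧
    Tendsto (fun x => θ x - k * x) atTop (𝓝 (δ k))

/-- The difference `E'_L^N - E_L^N` of the ground-state energies on `(0, L)`. -/
noncomputable def energyDifference (V : ℝ → ℝ) (N : ℕ) (L : ℝ) : ℝ :=
  groundStateEnergy (dirichletSchrodinger V (Ioo 0 L)) N -
    groundStateEnergy (dirichletSchrodinger (fun _ => 0) (Ioo 0 L)) N

/-- The limit `N → ∞`, `L → ∞`, `N / L → √E / π`, as a filter on the pairs `(N, L)`. -/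
noncomputable def thermodynamicLimit (E : ℝ) : Filter (ℕ × ℝ) :=
  (atTop ×ˢ atTop) ⊓ comap (fun p : ℕ × ℝ => (p.1 : ℝ) / p.2) (𝓝 (√E / Real.pi))

/-- `F` is absolutely continuous on the interval with end points `a`, `b`, with almost everywhere
derivative `f`. -/
structure HasACDeriv {E : Type*} [NormedAddCommGroup E] [NormedSpace ℝ E] (F f : ℝ → E)
    (a b : ℝ) : Prop where
  ac : AbsolutelyContinuousOnInterval F a b
  hasDerivAt : ∀ᵐ x, x ∈ uIcc a b → HasDerivAt F (f x) x

theorem AbsolutelyContinuousOnInterval.of_dist_le {X Y : Type*} [PseudoMetricSpace X]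
    [PseudoMetricSpace Y] {F : ℝ → X} {G : ℝ → Y} {a b : ℝ} (C : ℝ)
    (hG : AbsolutelyContinuousOnInterval G a b)
    (h : ∀ x ∈ uIcc a b, ∀ y ∈ uIcc a b, dist (F x) (F y) ≤ C * dist (G x) (G y)) :
    AbsolutelyContinuousOnInterval F a b := by
  have h2 : Tendsto (fun E : ℕ × (ℕ → ℝ × ℝ) ↦
      C * ∑ i ∈ Finset.range E.1, dist (G (E.2 i).1) (G (E.2 i).2))
      (AbsolutelyContinuousOnInterval.totalLengthFilter ⊓
        𝓟 (AbsolutelyContinuousOnInterval.disjWithin a b)) (𝓝 0) := by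
    simpa using Tendsto.const_mul C hG
  refine squeeze_zero' (Eventually.of_forall fun t => Finset.sum_nonneg fun i _ => dist_nonneg)
    ?_ h2
  refine eventually_inf_principal.2 (Eventually.of_forall fun E hE => ?_)
  rw [Finset.mul_sum]
  exact Finset.sum_le_sum fun i hi => h _ (hE.1 i hi).1 _ (hE.1 i hi).2

namespace HasACDeriv

variable {E : Type*} [NormedAddCommGroup E] [NormedSpace ℝ E] {F G f g : ℝ → E} {a b c : ℝ}

theorem mono {c d : ℝ} (h : HasACDeriv F f a b) (hs : uIcc c d ⊆ uIcc a b) :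
    HasACDeriv F f c d :=
  ⟨h.ac.mono hs, h.hasDerivAt.mono fun _ hx hx' => hx (hs hx')⟩

theorem congr_deriv (h : HasACDeriv F f a b) (hfg : ∀ᵐ x, x ∈ uIcc a b → f x = g x) :
    HasACDeriv F g a b :=
  ⟨h.ac, by filter_upwards [h.hasDerivAt, hfg] with x h1 h2 hx using h2 hx ▸ h1 hx⟩

theorem continuousOn (h : HasACDeriv F f a b) : ContinuousOn F (uIcc a b) := h.ac.continuousOn

theorem add (hF : HasACDeriv F f a b) (hG : HasACDeriv G g a b) :
    HasACDeriv (fun x => F x + G x) (fun x => f x + g x) a b :=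
  ⟨hF.ac.add hG.ac, by
    filter_upwards [hF.hasDerivAt, hG.hasDerivAt] with x h1 h2 hx using (h1 hx).add (h2 hx)⟩

theorem sub (hF : HasACDeriv F f a b) (hG : HasACDeriv G g a b) :
    HasACDeriv (fun x => F x - G x) (fun x => f x - g x) a b :=
  ⟨hF.ac.sub hG.ac, by
    filter_upwards [hF.hasDerivAt, hG.hasDerivAt] with x h1 h2 hx using (h1 hx).sub (h2 hx)⟩

theorem mul {𝕜 : Type*} [NormedField 𝕜] [NormedAlgebra ℝ 𝕜] {A p B q : ℝ → 𝕜}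
    (hA : HasACDeriv A p a b) (hB : HasACDeriv B q a b) :
    HasACDeriv (fun x => A x * B x) (fun x => p x * B x + A x * q x) a b :=
  ⟨hA.ac.smul hB.ac, by
    filter_upwards [hA.hasDerivAt, hB.hasDerivAt] with x h1 h2 hx using (h1 hx).mul (h2 hx)⟩

/-- A continuous linear image of an absolutely continuous function. -/
theorem clm {E' : Type*} [NormedAddCommGroup E'] [NormedSpace ℝ E'] (L : E →L[ℝ] E')
    (hF : HasACDeriv F f a b) : HasACDeriv (fun x => L (F x)) (fun x => L (f x)) a b :=
  ⟨hF.ac.of_dist_le ‖L‖ fun x _ y _ => by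
      rw [dist_eq_norm, dist_eq_norm, ← map_sub]; exact L.le_opNorm _, by
    filter_upwards [hF.hasDerivAt] with x h1 hx using L.hasFDerivAt.comp_hasDerivAt x (h1 hx)⟩

theorem ofReal {F f : ℝ → ℝ} (hF : HasACDeriv F f a b) :
    HasACDeriv (fun x => (F x : ℂ)) (fun x => (f x : ℂ)) a b := hF.clm Complex.ofRealCLM

theorem re {F f : ℝ → ℂ} (hF : HasACDeriv F f a b) :
    HasACDeriv (fun x => (F x).re) (fun x => (f x).re) a b := hF.clm Complex.reCLM

theorem im {F f : ℝ → ℂ} (hF : HasACDeriv F f a b) :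
    HasACDeriv (fun x => (F x).im) (fun x => (f x).im) a b := hF.clm Complex.imCLM

theorem conj {F f : ℝ → ℂ} (hF : HasACDeriv F f a b) :
    HasACDeriv (fun x => (starRingEnd ℂ) (F x)) (fun x => (starRingEnd ℂ) (f x)) a b :=
  hF.clm (Complex.conjCLE : ℂ →L[ℝ] ℂ)

/-- Continuously differentiable functions. -/
theorem of_hasDerivAt (h : ∀ x ∈ uIcc a b, HasDerivAt F (f x) x) (hf : ContinuousOn f (uIcc a b)) :
    HasACDeriv F f a b := by
  obtain ⟨C, hC⟩ := isCompact_uIcc.exists_bound_of_continuousOn hf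
  refine ⟨LipschitzOnWith.absolutelyContinuousOnInterval (K := C.toNNReal)
    (Convex.lipschitzOnWith_of_nnnorm_hasDerivWithin_le (𝕜 := ℝ) (convex_uIcc a b)
    (fun x hx => (h x hx).hasDerivWithinAt) fun x hx => ?_), Eventually.of_forall h⟩
  rw [← NNReal.coe_le_coe, coe_nnnorm]
  exact (hC x hx).trans (Real.le_coe_toNNReal C)

theorem const (c : E) : HasACDeriv (fun _ => c) (fun _ => 0) a b :=
  of_hasDerivAt (fun _ _ => hasDerivAt_const _ _) continuousOn_const

theorem id : HasACDeriv (fun x => x) (fun _ => (1 : ℝ)) a b :=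
  of_hasDerivAt (fun x _ => hasDerivAt_id x) continuousOn_const

/-- Chain rule for an outer function which is continuously differentiable on a convex set. -/
theorem scomp {F f : ℝ → ℝ} {H H' : ℝ → E} {c d : ℝ} (hF : HasACDeriv F f a b)
    (hs : ∀ x ∈ uIcc a b, F x ∈ Icc c d) (hH : ∀ y ∈ Icc c d, HasDerivAt H (H' y) y)
    (hH' : ContinuousOn H' (Icc c d)) :
    HasACDeriv (fun x => H (F x)) (fun x => f x • H' (F x)) a b := by
  obtain ⟨C, hC⟩ := isCompact_Icc.exists_bound_of_continuousOn hH'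
  refine ⟨hF.ac.of_dist_le C fun x hx y hy => ?_, ?_⟩
  · rw [dist_eq_norm, dist_eq_norm]
    exact (convex_Icc c d).norm_image_sub_le_of_norm_hasDerivWithin_le
      (fun z hz => (hH z hz).hasDerivWithinAt) (fun z hz => hC z hz) (hs y hy) (hs x hx)
  · filter_upwards [hF.hasDerivAt] with x h1 hx
    exact (hH (F x) (hs x hx)).scomp x (h1 hx)

theorem scomp' {F f : ℝ → ℝ} {H H' : ℝ → E} (hF : HasACDeriv F f a b)
    (hH : ∀ y, HasDerivAt H (H' y) y) (hH' : Continuous H') :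
    HasACDeriv (fun x => H (F x)) (fun x => f x • H' (F x)) a b := by
  obtain ⟨C, hC⟩ := isCompact_uIcc.exists_bound_of_continuousOn hF.continuousOn
  exact hF.scomp (c := -C) (d := C) (fun x hx => abs_le.1 (hC x hx)) (fun y _ => hH y)
    hH'.continuousOn

theorem inv {F f : ℝ → ℝ} (hF : HasACDeriv F f a b) (hpos : ∀ x ∈ uIcc a b, 0 < F x) :
    HasACDeriv (fun x => (F x)⁻¹) (fun x => -(f x) / F x ^ 2) a b := by
  obtain ⟨m, hm, hm'⟩ := isCompact_uIcc.exists_isMinOn (nonempty_uIcc (a := a) (b := b))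
    hF.continuousOn
  obtain ⟨C, hC⟩ := isCompact_uIcc.exists_bound_of_continuousOn hF.continuousOn
  have h0 := hpos m hm
  refine (hF.scomp (c := F m) (d := C) (H := fun y => y⁻¹) (H' := fun y => -(y ^ 2)⁻¹)
    (fun x hx => ⟨hm' hx, (abs_le.1 (hC x hx)).2⟩)
    (fun y hy => hasDerivAt_inv (h0.trans_le hy.1).ne') ?_).congr_deriv ?_
  · refine (ContinuousOn.inv₀ (by fun_prop) fun y hy => ?_).neg
    exact pow_ne_zero 2 (h0.trans_le hy.1).ne'
  · exact Eventually.of_forall fun x _ => by simp [div_eq_mul_inv]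

theorem exp {F f : ℝ → ℝ} (hF : HasACDeriv F f a b) :
    HasACDeriv (fun x => Real.exp (F x)) (fun x => f x * Real.exp (F x)) a b :=
  hF.scomp' (fun y => Real.hasDerivAt_exp y) Real.continuous_exp

theorem congr (hF : HasACDeriv F f a b) (h : ∀ x ∈ uIcc a b, F x = G x) :
    HasACDeriv G f a b := by
  refine ⟨hF.ac.of_dist_le 1 fun x hx y hy => by rw [h x hx, h y hy, one_mul], ?_⟩
  have h1 : ∀ᵐ x : ℝ, x ≠ a ∧ x ≠ b := by
    have h1 : ∀ y : ℝ, ∀ᵐ x : ℝ, x ≠ y := fun y => by simp [ae_iff, measure_singleton]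
    filter_upwards [h1 a, h1 b] with x h2 h3 using ⟨h2, h3⟩
  filter_upwards [hF.hasDerivAt, h1] with x hx h2 hx'
  refine (hx hx').congr_of_eventuallyEq ?_
  have : uIoo a b ∈ 𝓝 x := by
    refine isOpen_Ioo.mem_nhds ?_
    rcases le_total a b with hab | hab
    · rw [uIcc_of_le hab] at hx'
      rw [min_eq_left hab, max_eq_right hab]
      exact ⟨lt_of_le_of_ne hx'.1 (Ne.symm h2.1), lt_of_le_of_ne hx'.2 h2.2⟩
    · rw [uIcc_of_ge hab] at hx'
      rw [min_eq_right hab, max_eq_left hab]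
      exact ⟨lt_of_le_of_ne hx'.1 (Ne.symm h2.2), lt_of_le_of_ne hx'.2 h2.1⟩
  filter_upwards [this] with y hy using (h y (Ioo_subset_Icc_self hy)).symm

section Complete
variable [CompleteSpace E]

theorem integral (hf : IntervalIntegrable f volume a b) (hc : c ∈ uIcc a b) :
    HasACDeriv (fun x => ∫ t in c..x, f t) f a b := by
  refine ⟨(hf.norm.absolutelyContinuousOnInterval_intervalIntegral hc).of_dist_le 1
    fun x hx y hy => ?_, hf.ae_hasDerivAt_integral.mono fun x h hx => h hx c hc⟩
  have i1 : ∀ z ∈ uIcc a b, IntervalIntegrable f volume c z := fun z hz =>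
    hf.mono_set (uIcc_subset_uIcc hc hz)
  rw [dist_eq_norm, dist_eq_norm, one_mul,
    intervalIntegral.integral_interval_sub_left (i1 x hx) (i1 y hy),
    intervalIntegral.integral_interval_sub_left (i1 x hx).norm (i1 y hy).norm]
  exact intervalIntegral.norm_integral_le_abs_integral_norm

/-- The fundamental theorem of calculus. -/
theorem integral_eq_sub (hF : HasACDeriv F f a b) (hf : IntervalIntegrable f volume a b) :
    ∫ x in a..b, f x = F b - F a := by
  have h1 := hF.sub (integral hf left_mem_uIcc)
  obtain ⟨C, hC⟩ := h1.ac.const_of_ae_hasDerivAt_zero (h1.hasDerivAt.mono fun x h hx => by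
    simpa using h hx)
  have ha := hC a left_mem_uIcc
  have hb := hC b right_mem_uIcc
  simp only [intervalIntegral.integral_same, sub_zero] at ha hb
  rw [ha, ← hb]; abel

end Complete

theorem intervalIntegrable {F f : ℝ → ℝ} (hF : HasACDeriv F f a b) :
    IntervalIntegrable f volume a b := by
  refine hF.ac.intervalIntegrable_deriv.congr_ae ?_
  rw [EventuallyEq, ae_restrict_iff' measurableSet_uIoc]
  filter_upwards [hF.hasDerivAt] with x hx hx' using (hx (uIoc_subset_uIcc hx')).deriv

theorem intervalIntegrable_complex {F f : ℝ → ℂ} (hF : HasACDeriv F f a b) :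
    IntervalIntegrable f volume a b := by
  have h1 := hF.re.intervalIntegrable
  have h2 := hF.im.intervalIntegrable
  have h3 : f = fun x => ((f x).re : ℂ) + ((f x).im : ℂ) * Complex.I := by
    ext x; exact (Complex.re_add_im _).symm
  have h4 : ∀ {r : ℝ → ℝ}, IntervalIntegrable r volume a b →
      IntervalIntegrable (fun x => (r x : ℂ)) volume a b := fun h => ⟨h.1.ofReal, h.2.ofReal⟩
  rw [h3]
  exact (h4 h1).add ((h4 h2).mul_const _)

theorem le_of_nonneg {F f : ℝ → ℝ} (hab : a ≤ b) (hF : HasACDeriv F f a b)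
    (hf : ∀ᵐ x, x ∈ Icc a b → 0 ≤ f x) : F a ≤ F b := by
  have h1 := hF.integral_eq_sub hF.intervalIntegrable
  have h2 : 0 ≤ ∫ x in a..b, f x := by
    refine intervalIntegral.integral_nonneg_of_ae_restrict hab ?_
    rw [EventuallyLE, ae_restrict_iff' measurableSet_Icc]
    exact hf
  linarith

/-- Gronwall's inequality with an integrable coefficient. -/
theorem eq_zero_of_deriv_le {F f p : ℝ → ℝ} (hab : a ≤ b) (hF : HasACDeriv F f a b)
    (hp : IntervalIntegrable p volume a b) (h0 : F a = 0) (hnn : 0 ≤ F b)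
    (hf : ∀ᵐ x, x ∈ Icc a b → f x ≤ p x * F x) : F b = 0 := by
  have hP := HasACDeriv.integral hp (left_mem_uIcc)
  have h1 := ((HasACDeriv.const (E := ℝ) 0).sub hP).exp.mul ((HasACDeriv.const (E := ℝ) 0).sub hF)
  have h2 := h1.le_of_nonneg hab (by
    filter_upwards [hf] with x hx hx'
    have h3 := hx hx'
    have h4 := Real.exp_pos (0 - ∫ t in a..x, p t)
    nlinarith)
  simp only [h0, zero_sub, sub_zero] at h2
  have h4 := Real.exp_pos (- ∫ t in a..b, p t)
  nlinarith

end HasACDeriv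

/-- Picard iterates for the system `u' = v`, `v' = q u`. -/
noncomputable def linIter (q : ℝ → ℂ) (y : ℂ × ℂ) : ℕ → ℝ → ℂ × ℂ
  | 0 => fun _ => y
  | n + 1 => fun x => ∫ t in (0 : ℝ)..x, ((linIter q y n t).2, q t * (linIter q y n t).1)

/-- The solution of `u' = v`, `v' = q u` with `(u 0, v 0) = y`. -/
noncomputable def linSol (q : ℝ → ℂ) (y : ℂ × ℂ) (x : ℝ) : ℂ × ℂ := ∑' n, linIter q y n x

/-- `(u, v)` solves `u' = v`, `v' = q u` on `[0, b]`. -/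
structure IsLinSol (q u v : ℝ → ℂ) (b : ℝ) : Prop where
  fst : HasACDeriv u v 0 b
  snd : HasACDeriv v (fun x => q x * u x) 0 b

/-- The primitive of `1 + ‖q‖`. -/
noncomputable def linMajorant (q : ℝ → ℂ) (x : ℝ) : ℝ := ∫ t in (0 : ℝ)..x, (1 + ‖q t‖)

section
variable {q : ℝ → ℂ} {y : ℂ × ℂ} {b : ℝ}

theorem intervalIntegrable_one_add_norm (hq : IntervalIntegrable q volume 0 b) :
    IntervalIntegrable (fun t => 1 + ‖q t‖) volume 0 b :=
  intervalIntegrable_const.add hq.norm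

theorem linMajorant_mono (hq : IntervalIntegrable q volume 0 b) {x : ℝ}
    (hx : x ∈ Icc 0 b) : 0 ≤ linMajorant q x ∧ linMajorant q x ≤ linMajorant q b := by
  refine ⟨intervalIntegral.integral_nonneg hx.1 fun t _ => by positivity, ?_⟩
  refine intervalIntegral.integral_mono_interval le_rfl hx.1 hx.2 ?_
    (intervalIntegrable_one_add_norm hq)
  exact Eventually.of_forall fun t => by simp only [Pi.zero_apply]; positivity

theorem norm_linField_le (q : ℂ) (w : ℂ × ℂ) : ‖((w.2, q * w.1) : ℂ × ℂ)‖ ≤ (1 + ‖q‖) * ‖w‖ := by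
  have h1 := norm_fst_le w
  have h2 := norm_snd_le w
  have h3 := norm_nonneg q
  have h4 := norm_nonneg w
  refine max_le (by simp only; nlinarith) ?_
  simp only [norm_mul]
  nlinarith

theorem intervalIntegrable_linField (hq : IntervalIntegrable q volume 0 b) {w : ℝ → ℂ × ℂ}
    (hw : ContinuousOn w (uIcc 0 b)) :
    IntervalIntegrable (fun t => ((w t).2, q t * (w t).1)) volume 0 b := by
  have h1 : IntervalIntegrable (fun t => (w t).2) volume 0 b :=
    (continuous_snd.comp_continuousOn hw).intervalIntegrable
  have h2 : IntervalIntegrable (fun t => q t * (w t).1) volume 0 b :=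
    hq.mul_continuousOn (continuous_fst.comp_continuousOn hw)
  exact ⟨h1.1.prodMk h2.1, h1.2.prodMk h2.2⟩

theorem linIter_continuousOn (hq : IntervalIntegrable q volume 0 b) (n : ℕ) :
    ContinuousOn (linIter q y n) (uIcc 0 b) := by
  induction n with
  | zero => exact continuousOn_const
  | succ n ih => exact (HasACDeriv.integral (intervalIntegrable_linField hq ih)
      left_mem_uIcc).continuousOn

theorem norm_linIter_le (hb : 0 ≤ b) (hq : IntervalIntegrable q volume 0 b) (n : ℕ) :
    ∀ x ∈ Icc 0 b, ‖linIter q y n x‖ ≤ ‖y‖ * (linMajorant q x ^ n / n.factorial) := by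
  induction n with
  | zero => intro x _; simp [linIter]
  | succ n ih =>
    intro x hx
    have hq' : IntervalIntegrable q volume 0 x := hq.mono_set (by
      rw [uIcc_of_le hx.1, uIcc_of_le hb]; exact Icc_subset_Icc le_rfl hx.2)
    have hS : HasACDeriv (linMajorant q) (fun t => 1 + ‖q t‖) 0 x :=
      HasACDeriv.integral (intervalIntegrable_one_add_norm hq') left_mem_uIcc
    have hS2 := hS.scomp' (H := fun s => s ^ (n + 1) / (n + 1).factorial)
      (H' := fun s => s ^ n / n.factorial) (fun s => by
        refine ((hasDerivAt_pow (n + 1) s).div_const _).congr_deriv ?_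
        rw [Nat.factorial_succ]; push_cast
        have : (n.factorial : ℝ) ≠ 0 := by positivity
        field_simp) (by fun_prop)
    have hint := hS2.integral_eq_sub hS2.intervalIntegrable
    have hS0 : linMajorant q 0 = 0 := by simp [linMajorant]
    rw [hS0, zero_pow (by omega), zero_div, sub_zero] at hint
    rw [← hint, ← intervalIntegral.integral_const_mul]
    refine intervalIntegral.norm_integral_le_of_norm_le hx.1 ?_
      (hS2.intervalIntegrable.const_mul _)
    refine Eventually.of_forall fun t ht => (norm_linField_le _ _).trans ?_
    have h1 := ih t ⟨ht.1.le, ht.2.trans hx.2⟩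
    have h2 : 0 ≤ 1 + ‖q t‖ := by positivity
    calc (1 + ‖q t‖) * ‖linIter q y n t‖
        ≤ (1 + ‖q t‖) * (‖y‖ * (linMajorant q t ^ n / n.factorial)) := by gcongr
      _ = _ := by simp only [smul_eq_mul]; ring

theorem norm_linIter_le' (hb : 0 ≤ b) (hq : IntervalIntegrable q volume 0 b) (n : ℕ) {x : ℝ}
    (hx : x ∈ Icc 0 b) : ‖linIter q y n x‖ ≤ ‖y‖ * (linMajorant q b ^ n / n.factorial) := by
  obtain ⟨h1, h2⟩ := linMajorant_mono hq hx
  refine (norm_linIter_le hb hq n x hx).trans ?_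
  gcongr

theorem summable_linMajorant : Summable fun n : ℕ =>
    ‖y‖ * (linMajorant q b ^ n / n.factorial) :=
  (Real.summable_pow_div_factorial _).mul_left _

theorem linSol_continuousOn (hb : 0 ≤ b) (hq : IntervalIntegrable q volume 0 b) :
    ContinuousOn (linSol q y) (Icc 0 b) :=
  continuousOn_tsum (fun n => by simpa [uIcc_of_le hb] using linIter_continuousOn hq n)
    summable_linMajorant fun n _ hx => norm_linIter_le' hb hq n hx

theorem norm_linSol_le (hb : 0 ≤ b) (hq : IntervalIntegrable q volume 0 b) {x : ℝ}
    (hx : x ∈ Icc 0 b) : ‖linSol q y x‖ ≤ ‖y‖ * Real.exp (linMajorant q b) := by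
  refine tsum_of_norm_bounded ?_ fun n => norm_linIter_le' hb hq n hx
  refine HasSum.mul_left _ ?_
  rw [Real.exp_eq_exp_ℝ]
  exact NormedSpace.expSeries_div_hasSum_exp _

theorem linSol_eq (hb : 0 ≤ b) (hq : IntervalIntegrable q volume 0 b) {x : ℝ} (hx : x ∈ Icc 0 b) :
    linSol q y x = y + ∫ t in (0 : ℝ)..x, ((linSol q y t).2, q t * (linSol q y t).1) := by
  have hq' : IntervalIntegrable q volume 0 x := hq.mono_set (by
    rw [uIcc_of_le hx.1, uIcc_of_le hb]; exact Icc_subset_Icc le_rfl hx.2)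
  have hs : ∀ t ∈ Icc 0 x, HasSum (fun n => linIter q y n t) (linSol q y t) := fun t ht =>
    (Summable.of_norm_bounded summable_linMajorant
      fun n => norm_linIter_le' hx.1 hq' n ht).hasSum
  have h1 := intervalIntegral.hasSum_integral_of_dominated_convergence (μ := volume) (a := 0)
    (b := x) (F := fun n t => ((linIter q y n t).2, q t * (linIter q y n t).1))
    (f := fun t => ((linSol q y t).2, q t * (linSol q y t).1))
    (fun n t => (1 + ‖q t‖) * (‖y‖ * (linMajorant q x ^ n / n.factorial)))
    (fun n => (intervalIntegrable_linField hq' (linIter_continuousOn hq' n)).def'.1)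
    (fun n => Eventually.of_forall fun t ht => by
      rw [uIoc_of_le hx.1] at ht
      refine (norm_linField_le _ _).trans ?_
      gcongr
      exact norm_linIter_le' hx.1 hq' n ⟨ht.1.le, ht.2⟩)
    (Eventually.of_forall fun t _ => (summable_linMajorant (y := y)).mul_left _)
    (by
      simp_rw [tsum_mul_left]
      exact (intervalIntegrable_one_add_norm hq').mul_const _)
    (Eventually.of_forall fun t ht => by
      rw [uIoc_of_le hx.1] at ht
      have h2 := hs t ⟨ht.1.le, ht.2⟩
      have h3 : HasSum (fun n => (linIter q y n t).1) (linSol q y t).1 :=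
        h2.map (AddMonoidHom.fst ℂ ℂ) continuous_fst
      have h4 : HasSum (fun n => (linIter q y n t).2) (linSol q y t).2 :=
        h2.map (AddMonoidHom.snd ℂ ℂ) continuous_snd
      exact h4.prodMk (h3.mul_left _))
  have h2 := (hasSum_nat_add_iff' 1).2 (hs x ⟨hx.1, le_rfl⟩)
  have h3 := h1.unique h2
  rw [h3]
  simp [linIter]

theorem linSol_zero : linSol q y 0 = y := by
  have := linSol_eq (q := q) (y := y) le_rfl (b := 0) (by simp) (x := 0) (by simp)
  simpa using this

theorem linSol_isLinSol (hb : 0 ≤ b) (hq : IntervalIntegrable q volume 0 b) :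
    IsLinSol q (fun x => (linSol q y x).1) (fun x => (linSol q y x).2) b := by
  have h1 : HasACDeriv (fun x => y + ∫ t in (0 : ℝ)..x, ((linSol q y t).2, q t * (linSol q y t).1))
      (fun x => 0 + ((linSol q y x).2, q x * (linSol q y x).1)) 0 b :=
    (HasACDeriv.const y).add (HasACDeriv.integral (intervalIntegrable_linField hq
      (by simpa [uIcc_of_le hb] using linSol_continuousOn hb hq)) left_mem_uIcc)
  have h2 : HasACDeriv (linSol q y) (fun x => 0 + ((linSol q y x).2, q x * (linSol q y x).1)) 0 b :=
    h1.congr fun x hx => (linSol_eq hb hq (by simpa [uIcc_of_le hb] using hx)).symm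
  have h3 := h2.clm (ContinuousLinearMap.fst ℝ ℂ ℂ)
  have h4 := h2.clm (ContinuousLinearMap.snd ℝ ℂ ℂ)
  simp only [zero_add, ContinuousLinearMap.coe_fst', ContinuousLinearMap.coe_snd'] at h3 h4
  exact ⟨h3, h4⟩

namespace IsLinSol
variable {u v u' v' q' : ℝ → ℂ}

theorem mono (h : IsLinSol q u v b) {c : ℝ} (hc : 0 ≤ c) (hcb : c ≤ b) : IsLinSol q u v c := by
  have : uIcc 0 c ⊆ uIcc 0 b := by
    rw [uIcc_of_le hc, uIcc_of_le (hc.trans hcb)]; exact Icc_subset_Icc le_rfl hcb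
  exact ⟨h.fst.mono this, h.snd.mono this⟩

theorem hasDerivAt (h : IsLinSol q u v b) {x : ℝ} (hx : x ∈ Ioo 0 b) : HasDerivAt u (v x) x := by
  have hb : 0 ≤ b := (hx.1.trans hx.2).le
  have hc : ContinuousOn v (Icc 0 b) := by simpa [uIcc_of_le hb] using h.snd.continuousOn
  have hi : IntervalIntegrable v volume 0 b := h.snd.continuousOn.intervalIntegrable
  have h1 : ∀ y ∈ Icc 0 b, u y = u 0 + ∫ t in (0 : ℝ)..y, v t := by
    intro y hy
    have h2 := h.mono hy.1 hy.2
    rw [h2.fst.integral_eq_sub h2.snd.continuousOn.intervalIntegrable]; ring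
  have h3 : HasDerivAt (fun y => u 0 + ∫ t in (0 : ℝ)..y, v t) (v x) x := by
    refine HasDerivAt.const_add _ (intervalIntegral.integral_hasDerivAt_right ?_ ?_ ?_)
    · exact (h.mono hx.1.le hx.2.le).snd.continuousOn.intervalIntegrable
    · exact (hc.mono Ioo_subset_Icc_self).stronglyMeasurableAtFilter isOpen_Ioo x hx
    · exact hc.continuousAt (Icc_mem_nhds hx.1 hx.2)
  refine h3.congr_of_eventuallyEq ?_
  filter_upwards [Icc_mem_nhds hx.1 hx.2] with y hy using h1 y hy

theorem conj (h : IsLinSol q u v b) : IsLinSol (fun x => starRingEnd ℂ (q x))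
    (fun x => starRingEnd ℂ (u x)) (fun x => starRingEnd ℂ (v x)) b :=
  ⟨h.fst.conj, by simpa using h.snd.conj⟩

/-- The derivative of the Wronskian. -/
theorem wronskian (h : IsLinSol q u v b) (h' : IsLinSol q' u' v' b) :
    HasACDeriv (fun x => u x * v' x - v x * u' x) (fun x => (q' x - q x) * (u x * u' x)) 0 b :=
  ((h.fst.mul h'.snd).sub (h.snd.mul h'.fst)).congr_deriv
    (Eventually.of_forall fun x _ => by ring)

theorem wronskian_integral (h : IsLinSol q u v b) (h' : IsLinSol q' u' v' b) {c : ℂ}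
    (hc : ∀ x, q' x - q x = c) {x : ℝ} (hx : x ∈ Icc 0 b) :
    u x * v' x - v x * u' x = u 0 * v' 0 - v 0 * u' 0 + c * ∫ t in (0 : ℝ)..x, u t * u' t := by
  have h1 := ((h.mono hx.1 hx.2).wronskian (h'.mono hx.1 hx.2))
  have h2 := h1.integral_eq_sub h1.intervalIntegrable_complex
  simp only [hc] at h2
  rw [intervalIntegral.integral_const_mul] at h2
  rw [h2]; ring

/-- A solution is determined by its initial values. -/
theorem eq_linSol (hb : 0 ≤ b) (hq : IntervalIntegrable q volume 0 b) (h : IsLinSol q u v b)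
    {x : ℝ} (hx : x ∈ Icc 0 b) :
    u x = u 0 * (linSol q (1, 0) x).1 + v 0 * (linSol q (0, 1) x).1 ∧
    v x = u 0 * (linSol q (1, 0) x).2 + v 0 * (linSol q (0, 1) x).2 := by
  have hc : ∀ x, q x - q x = 0 := fun x => sub_self _
  have hφ := linSol_isLinSol (y := (0, 1)) hb hq
  have hχ := linSol_isLinSol (y := (1, 0)) hb hq
  have h1 := h.wronskian_integral hφ hc hx
  have h2 := h.wronskian_integral hχ hc hx
  have h3 := hχ.wronskian_integral hφ hc hx
  simp only [linSol_zero, zero_mul, mul_one, mul_zero, sub_zero, zero_sub, add_zero] at h1 h2 h3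
  constructor
  · linear_combination (-u x) * h3 + (linSol q (1, 0) x).1 * h1 - (linSol q (0, 1) x).1 * h2
  · linear_combination (-v x) * h3 + (linSol q (1, 0) x).2 * h1 - (linSol q (0, 1) x).2 * h2

end IsLinSol
end

section
variable {V : ℝ → ℝ} {b : ℝ}

theorem intervalIntegrable_coeff (hV : IntervalIntegrable V volume 0 b) (z : ℂ) :
    IntervalIntegrable (fun t => (V t : ℂ) - z) volume 0 b :=
  IntervalIntegrable.sub ⟨hV.1.ofReal, hV.2.ofReal⟩ intervalIntegrable_const

/-- The solution of `-u'' + V u = z u`, `u(0) = 0`, `u'(0) = 1`. -/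
noncomputable def regSol (V : ℝ → ℝ) (z : ℂ) (x : ℝ) : ℂ :=
  (linSol (fun t => (V t : ℂ) - z) (0, 1) x).1

/-- The derivative of `regSol`. -/
noncomputable def regSolD (V : ℝ → ℝ) (z : ℂ) (x : ℝ) : ℂ :=
  (linSol (fun t => (V t : ℂ) - z) (0, 1) x).2

theorem regSol_isLinSol (hb : 0 ≤ b) (hV : IntervalIntegrable V volume 0 b) (z : ℂ) :
    IsLinSol (fun t => (V t : ℂ) - z) (regSol V z) (regSolD V z) b :=
  linSol_isLinSol hb (intervalIntegrable_coeff hV z)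

@[simp] theorem regSol_zero (z : ℂ) : regSol V z 0 = 0 := by simp [regSol, linSol_zero]

@[simp] theorem regSolD_zero (z : ℂ) : regSolD V z 0 = 1 := by simp [regSolD, linSol_zero]

theorem IsLinSol.eq_regSol {u v : ℝ → ℂ} {z : ℂ} (hb : 0 ≤ b)
    (hV : IntervalIntegrable V volume 0 b) (h : IsLinSol (fun t => (V t : ℂ) - z) u v b)
    (h0 : u 0 = 0) {x : ℝ} (hx : x ∈ Icc 0 b) :
    u x = v 0 * regSol V z x ∧ v x = v 0 * regSolD V z x := by
  have := h.eq_linSol hb (intervalIntegrable_coeff hV z) hx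
  simpa [h0, regSol, regSolD] using this

theorem regSol_ne_zero (hb : 0 ≤ b) (hV : IntervalIntegrable V volume 0 b) (z : ℂ) {x : ℝ}
    (hx : x ∈ Icc 0 b) : ¬ (regSol V z x = 0 ∧ regSolD V z x = 0) := by
  rintro ⟨h1, h2⟩
  have hq := intervalIntegrable_coeff hV z
  have h := (linSol_isLinSol (y := (1, 0)) hb hq).wronskian_integral
    (regSol_isLinSol hb hV z) (c := 0) (fun x => sub_self _) hx
  simp [h1, h2, linSol_zero] at h

theorem regSol_conj (hb : 0 ≤ b) (hV : IntervalIntegrable V volume 0 b) (z : ℂ) {x : ℝ}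
    (hx : x ∈ Icc 0 b) : regSol V (starRingEnd ℂ z) x = starRingEnd ℂ (regSol V z x) ∧
      regSolD V (starRingEnd ℂ z) x = starRingEnd ℂ (regSolD V z x) := by
  have h := (regSol_isLinSol hb hV z).conj
  simp only [map_sub, Complex.conj_ofReal] at h
  have h2 := h.eq_regSol hb hV (by simp) hx
  simp only [regSolD_zero, map_one, one_mul] at h2
  exact ⟨h2.1.symm, h2.2.symm⟩

theorem linMajorant_le (hV : IntervalIntegrable V volume 0 b) (hb : 0 ≤ b) {z : ℂ} {R : ℝ}
    (hz : ‖z‖ ≤ R) : linMajorant (fun t => (V t : ℂ) - z) b ≤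
      ∫ t in (0 : ℝ)..b, (1 + R + |V t|) := by
  refine intervalIntegral.integral_mono_on hb
    (intervalIntegrable_one_add_norm (intervalIntegrable_coeff hV z))
    (intervalIntegrable_const.add hV.abs) fun t _ => ?_
  have h1 := norm_sub_le (V t : ℂ) z
  rw [Complex.norm_real, Real.norm_eq_abs] at h1
  linarith

/-- A bound on the solutions which is uniform in the spectral parameter. -/
theorem exists_norm_linSol_le (hb : 0 ≤ b) (hV : IntervalIntegrable V volume 0 b) (R : ℝ) :
    ∃ C, 0 < C ∧ ∀ y : ℂ × ℂ, ∀ z : ℂ, ‖z‖ ≤ R → ∀ x ∈ Icc 0 b,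
      ‖linSol (fun t => (V t : ℂ) - z) y x‖ ≤ ‖y‖ * C := by
  refine ⟨_, Real.exp_pos (∫ t in (0 : ℝ)..b, (1 + R + |V t|)), fun y z hz x hx => ?_⟩
  refine (norm_linSol_le hb (intervalIntegrable_coeff hV z) hx).trans ?_
  gcongr
  exact linMajorant_le hV hb hz

theorem regSol_continuousOn (hb : 0 ≤ b) (hV : IntervalIntegrable V volume 0 b) (z : ℂ) :
    ContinuousOn (regSol V z) (Icc 0 b) ∧ ContinuousOn (regSolD V z) (Icc 0 b) := by
  have h := regSol_isLinSol hb hV z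
  rw [← uIcc_of_le hb]
  exact ⟨h.fst.continuousOn, h.snd.continuousOn⟩

/-- Variation of constants in the spectral parameter. -/
theorem linSol_sub (hb : 0 ≤ b) (hV : IntervalIntegrable V volume 0 b) (z z' : ℂ) {x : ℝ}
    (hx : x ∈ Icc 0 b) :
    linSol (fun t => (V t : ℂ) - z') (0, 1) x - linSol (fun t => (V t : ℂ) - z) (0, 1) x =
      (z' - z) • ((∫ t in (0 : ℝ)..x, regSol V z' t * regSol V z t) •
          linSol (fun t => (V t : ℂ) - z) (1, 0) x -
        (∫ t in (0 : ℝ)..x, regSol V z' t * (linSol (fun t => (V t : ℂ) - z) (1, 0) t).1) •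
          linSol (fun t => (V t : ℂ) - z) (0, 1) x) := by
  have hq := intervalIntegrable_coeff hV z
  have hφ := regSol_isLinSol hb hV z
  have hu := regSol_isLinSol hb hV z'
  have hχ := linSol_isLinSol (y := (1, 0)) hb hq
  have hc : ∀ x, ((V x : ℂ) - z) - (V x - z') = z' - z := fun x => by ring
  have h1 := hu.wronskian_integral hφ hc hx
  have h2 := hu.wronskian_integral hχ hc hx
  have h3 := hχ.wronskian_integral hφ (fun x => sub_self _) hx
  simp only [linSol_zero, regSol_zero, regSolD_zero, zero_mul, mul_one, mul_zero, sub_zero,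
    zero_sub, add_zero] at h1 h2 h3
  simp only [regSol, regSolD] at h1 h2 h3 ⊢
  ext
  · simp only [Prod.fst_sub, Prod.smul_fst, smul_eq_mul]
    linear_combination (-(linSol (fun t => (V t : ℂ) - z') (0, 1) x).1) * h3 +
      (linSol (fun t => (V t : ℂ) - z) (1, 0) x).1 * h1 -
      (linSol (fun t => (V t : ℂ) - z) (0, 1) x).1 * h2
  · simp only [Prod.snd_sub, Prod.smul_snd, smul_eq_mul]
    linear_combination (-(linSol (fun t => (V t : ℂ) - z') (0, 1) x).2) * h3 +
      (linSol (fun t => (V t : ℂ) - z) (1, 0) x).2 * h1 -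
      (linSol (fun t => (V t : ℂ) - z) (0, 1) x).2 * h2

/-- The regular solution is locally Lipschitz in the spectral parameter. -/
theorem exists_norm_linSol_sub_le (hb : 0 ≤ b) (hV : IntervalIntegrable V volume 0 b) (R : ℝ) :
    ∃ C, 0 < C ∧ ∀ z z' : ℂ, ‖z‖ ≤ R → ‖z'‖ ≤ R → ∀ x ∈ Icc 0 b,
      ‖linSol (fun t => (V t : ℂ) - z') (0, 1) x - linSol (fun t => (V t : ℂ) - z) (0, 1) x‖ ≤
        C * ‖z' - z‖ := by
  obtain ⟨C, hC, h⟩ := exists_norm_linSol_le hb hV R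
  have h01 : ‖((0, 1) : ℂ × ℂ)‖ = 1 := by simp [Prod.norm_def]
  have h10 : ‖((1, 0) : ℂ × ℂ)‖ = 1 := by simp [Prod.norm_def]
  have hu : ∀ z : ℂ, ‖z‖ ≤ R → ∀ x ∈ Icc 0 b, ‖regSol V z x‖ ≤ C := fun z hz x hx => by
    have := h (0, 1) z hz x hx
    rw [h01, one_mul] at this
    exact (norm_fst_le _).trans this
  refine ⟨C * C * b * C + C * C * b * C + 1, by positivity, fun z z' hz hz' x hx => ?_⟩
  rw [linSol_sub hb hV z z' hx, norm_smul, mul_comm]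
  have b1 := h (1, 0) z hz x hx
  have b2 := h (0, 1) z hz x hx
  rw [h01, one_mul] at b2
  rw [h10, one_mul] at b1
  have hint : ∀ f g : ℝ → ℂ, (∀ t ∈ Icc 0 b, ‖f t‖ ≤ C) → (∀ t ∈ Icc 0 b, ‖g t‖ ≤ C) →
      ‖∫ t in (0 : ℝ)..x, f t * g t‖ ≤ C * C * b := by
    intro f g hf hg
    refine (intervalIntegral.norm_integral_le_of_norm_le_const (C := C * C) fun t ht => ?_).trans ?_
    · rw [uIoc_of_le hx.1] at ht
      have ht' : t ∈ Icc 0 b := ⟨ht.1.le, ht.2.trans hx.2⟩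
      rw [norm_mul]
      exact mul_le_mul (hf t ht') (hg t ht') (norm_nonneg _) hC.le
    · rw [sub_zero, abs_of_nonneg hx.1]
      gcongr
      exact hx.2
  have i1 := hint _ _ (hu z' hz') (hu z hz)
  have i2 := hint (regSol V z') (fun t => (linSol (fun t => (V t : ℂ) - z) (1, 0) t).1)
    (hu z' hz') (fun t ht => by
      have := h (1, 0) z hz t ht
      rw [h10, one_mul] at this
      exact (norm_fst_le _).trans this)
  gcongr
  refine (norm_sub_le _ _).trans ?_
  rw [norm_smul, norm_smul]
  have := mul_le_mul i1 b1 (norm_nonneg _) (by positivity)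
  have := mul_le_mul i2 b2 (norm_nonneg _) (by positivity)
  linarith

theorem exists_norm_regSol_sub_le (hb : 0 ≤ b) (hV : IntervalIntegrable V volume 0 b) (R : ℝ) :
    ∃ C, 0 < C ∧ ∀ z z' : ℂ, ‖z‖ ≤ R → ‖z'‖ ≤ R → ∀ x ∈ Icc 0 b,
      ‖regSol V z' x - regSol V z x‖ ≤ C * ‖z' - z‖ := by
  obtain ⟨C, hC, h⟩ := exists_norm_linSol_sub_le hb hV R
  exact ⟨C, hC, fun z z' hz hz' x hx => (norm_fst_le _).trans (h z z' hz hz' x hx)⟩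

theorem integral_mul_regSol_tendsto (hV : IntervalIntegrable V volume 0 b)
    (z : ℂ) {x : ℝ} (hx : x ∈ Icc 0 b) {g : ℝ → ℂ} (hg : ContinuousOn g (Icc 0 b)) :
    Tendsto (fun z' => ∫ t in (0 : ℝ)..x, regSol V z' t * g t) (𝓝 z)
      (𝓝 (∫ t in (0 : ℝ)..x, regSol V z t * g t)) := by
  have hb : 0 ≤ b := hx.1.trans hx.2
  obtain ⟨C, hC, h⟩ := exists_norm_regSol_sub_le hb hV (‖z‖ + 1)
  obtain ⟨D, hD⟩ := isCompact_Icc.exists_bound_of_continuousOn hg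
  have hsub : uIcc 0 x ⊆ Icc 0 b := by rw [uIcc_of_le hx.1]; exact Icc_subset_Icc le_rfl hx.2
  have hi : ∀ z, IntervalIntegrable (fun t => regSol V z t * g t) volume 0 x := fun z =>
    (((regSol_continuousOn hb hV z).1.mul hg).mono hsub).intervalIntegrable
  rw [tendsto_iff_norm_sub_tendsto_zero]
  refine squeeze_zero' (g := fun z' => C * ‖z' - z‖ * D * |x - 0|)
    (Eventually.of_forall fun _ => norm_nonneg _) ?_ ?_
  · filter_upwards [Metric.ball_mem_nhds z one_pos] with z' hz'
    rw [← intervalIntegral.integral_sub (hi z') (hi z)]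
    refine intervalIntegral.norm_integral_le_of_norm_le_const fun t ht => ?_
    have ht' := hsub (uIoc_subset_uIcc ht)
    rw [← sub_mul, norm_mul]
    have hz'' : ‖z'‖ ≤ ‖z‖ + 1 := by
      have := norm_sub_norm_le z' z
      rw [mem_ball_iff_norm] at hz'
      linarith
    exact mul_le_mul (h z z' (by linarith [norm_nonneg z]) hz'' t ht') (hD t ht') (norm_nonneg _)
      (by positivity)
  · have : Continuous fun z' : ℂ => C * ‖z' - z‖ * D * |x - 0| := by fun_prop
    simpa using this.tendsto z

theorem linSol_hasDerivAt_param (hV : IntervalIntegrable V volume 0 b) (z : ℂ)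
    {x : ℝ} (hx : x ∈ Icc 0 b) :
    HasDerivAt (fun z' => linSol (fun t => (V t : ℂ) - z') (0, 1) x)
      ((∫ t in (0 : ℝ)..x, regSol V z t * regSol V z t) •
          linSol (fun t => (V t : ℂ) - z) (1, 0) x -
        (∫ t in (0 : ℝ)..x, regSol V z t * (linSol (fun t => (V t : ℂ) - z) (1, 0) t).1) •
          linSol (fun t => (V t : ℂ) - z) (0, 1) x) z := by
  have hb : 0 ≤ b := hx.1.trans hx.2
  have h1 := integral_mul_regSol_tendsto hV z hx (regSol_continuousOn hb hV z).1
  have h2 := integral_mul_regSol_tendsto hV z hx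
    (continuous_fst.comp_continuousOn
      (linSol_continuousOn (y := (1, 0)) hb (intervalIntegrable_coeff hV z)))
  rw [hasDerivAt_iff_tendsto_slope]
  refine (((h1.smul_const _).sub (h2.smul_const _)).mono_left nhdsWithin_le_nhds).congr' ?_
  filter_upwards [self_mem_nhdsWithin] with z' hz'
  rw [slope_def_module, linSol_sub hb hV z z' hx, smul_smul, inv_mul_cancel₀ (sub_ne_zero.2 hz'),
    one_smul]
  rfl

theorem regSol_differentiable (hb : 0 ≤ b) (hV : IntervalIntegrable V volume 0 b) :
    Differentiable ℂ (fun z => regSol V z b) ∧ Differentiable ℂ (fun z => regSolD V z b) := by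
  have h : Differentiable ℂ fun z => linSol (fun t => (V t : ℂ) - z) (0, 1) b := fun z =>
    (linSol_hasDerivAt_param hV z ⟨hb, le_rfl⟩).differentiableAt
  exact ⟨h.fst, h.snd⟩

/-- The real solution of `-u'' + V u = s u`, `u(0) = 0`, `u'(0) = 1`. -/
noncomputable def realSol (V : ℝ → ℝ) (s : ℝ) (x : ℝ) : ℝ := (regSol V s x).re

/-- The derivative of `realSol`. -/
noncomputable def realSolD (V : ℝ → ℝ) (s : ℝ) (x : ℝ) : ℝ := (regSolD V s x).re

theorem regSol_ofReal (hb : 0 ≤ b) (hV : IntervalIntegrable V volume 0 b) (s : ℝ) :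
    regSol V s b = realSol V s b ∧ regSolD V s b = realSolD V s b := by
  have h := regSol_conj hb hV s ⟨hb, le_rfl⟩
  rw [Complex.conj_ofReal] at h
  exact ⟨(Complex.conj_eq_iff_re.1 h.1.symm).symm, (Complex.conj_eq_iff_re.1 h.2.symm).symm⟩

@[simp] theorem realSol_zero (s : ℝ) : realSol V s 0 = 0 := by simp [realSol]

@[simp] theorem realSolD_zero (s : ℝ) : realSolD V s 0 = 1 := by simp [realSolD]

theorem realSol_hasACDeriv (hb : 0 ≤ b) (hV : IntervalIntegrable V volume 0 b) (s : ℝ) :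
    HasACDeriv (realSol V s) (realSolD V s) 0 b := (regSol_isLinSol hb hV s).fst.re

theorem realSolD_hasACDeriv (hb : 0 ≤ b) (hV : IntervalIntegrable V volume 0 b) (s : ℝ) :
    HasACDeriv (realSolD V s) (fun x => (V x - s) * realSol V s x) 0 b :=
  (regSol_isLinSol hb hV s).snd.re.congr_deriv (Eventually.of_forall fun x _ => by
    simp [realSol])

theorem realSol_continuousOn (hb : 0 ≤ b) (hV : IntervalIntegrable V volume 0 b) (s : ℝ) :
    ContinuousOn (realSol V s) (Icc 0 b) ∧ ContinuousOn (realSolD V s) (Icc 0 b) :=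
  ⟨Complex.continuous_re.comp_continuousOn (regSol_continuousOn hb hV s).1,
    Complex.continuous_re.comp_continuousOn (regSol_continuousOn hb hV s).2⟩

theorem realSol_hasDerivAt (hV : IntervalIntegrable V volume 0 b) (s : ℝ) {x : ℝ}
    (hx : x ∈ Ioo 0 b) : HasDerivAt (realSol V s) (realSolD V s x) x :=
  Complex.reCLM.hasFDerivAt.comp_hasDerivAt x
    ((regSol_isLinSol (hx.1.trans hx.2).le hV s).hasDerivAt hx)

theorem realSol_continuous_param (hb : 0 ≤ b) (hV : IntervalIntegrable V volume 0 b) :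
    Continuous (fun s => realSol V s b) ∧ Continuous (fun s => realSolD V s b) :=
  ⟨Complex.continuous_re.comp ((regSol_differentiable hb hV).1.continuous.comp
      Complex.continuous_ofReal),
    Complex.continuous_re.comp ((regSol_differentiable hb hV).2.continuous.comp
      Complex.continuous_ofReal)⟩

theorem realSol_ne_zero (hb : 0 ≤ b) (hV : IntervalIntegrable V volume 0 b) (s : ℝ) :
    ¬ (realSol V s b = 0 ∧ realSolD V s b = 0) := by
  rintro ⟨h1, h2⟩
  refine regSol_ne_zero hb hV s ⟨hb, le_rfl⟩ ?_
  rw [(regSol_ofReal hb hV s).1, (regSol_ofReal hb hV s).2, h1, h2]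
  simp

end

/-- Non-negative measurable potentials with finite second moment, extended by zero to the negative
half-line. -/
structure IsShortRange (V : ℝ → ℝ) : Prop where
  measurable : Measurable V
  nonneg : ∀ x, 0 ≤ V x
  integrable_weight : Integrable (fun x => V x * (1 + x ^ 2))

namespace IsShortRange
variable {V : ℝ → ℝ}

theorem integrable (hV : IsShortRange V) : Integrable V :=
  hV.integrable_weight.mono' hV.measurable.aestronglyMeasurable (Eventually.of_forall fun x => by
    rw [Real.norm_eq_abs, abs_of_nonneg (hV.nonneg x)]
    nlinarith [hV.nonneg x, mul_nonneg (hV.nonneg x) (sq_nonneg x)])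

theorem intervalIntegrable (hV : IsShortRange V) (a b : ℝ) : IntervalIntegrable V volume a b :=
  hV.integrable.intervalIntegrable

theorem setIntegral_mono (hV : IsShortRange V) (s : Set ℝ) :
    ∫ x in s, V x * (1 + x ^ 2) ≤ ∫ x, V x * (1 + x ^ 2) :=
  setIntegral_le_integral hV.integrable_weight (Eventually.of_forall fun x =>
    mul_nonneg (hV.nonneg x) (by positivity))

end IsShortRange

theorem isShortRange_zero : IsShortRange (fun _ => 0) :=
  ⟨measurable_const, fun _ => le_rfl, by simp⟩

/-- The Prüfer angle of the regular solution. -/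
noncomputable def pruferAngle (V : ℝ → ℝ) (k x : ℝ) : ℝ :=
  ∫ t in (0 : ℝ)..x, (k - 1 / k * (V t * ((k * realSol V (k ^ 2) t) ^ 2 /
    (realSolD V (k ^ 2) t ^ 2 + (k * realSol V (k ^ 2) t) ^ 2))))

theorem sin_sq_sub_sin_sq_eq (a b : ℝ) :
    Real.sin a ^ 2 - Real.sin b ^ 2 = Real.sin (a + b) * Real.sin (a - b) := by
  rw [Real.sin_add, Real.sin_sub]
  have h1 := Real.sin_sq_add_cos_sq a
  have h2 := Real.sin_sq_add_cos_sq b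
  linear_combination Real.sin b ^ 2 * h1 - Real.sin a ^ 2 * h2

theorem sinc_mul_self (x : ℝ) : Real.sinc x * x = Real.sin x := by
  by_cases h : x = 0
  · simp [h]
  · rw [Real.sinc_of_ne_zero h]; field_simp

theorem abs_sin_sq_sub_le (a b : ℝ) : |Real.sin a ^ 2 - Real.sin b ^ 2| ≤ |a - b| := by
  rw [sin_sq_sub_sin_sq_eq, abs_mul]
  calc _ ≤ 1 * |a - b| := mul_le_mul (Real.abs_sin_le_one _) Real.abs_sin_le_abs (abs_nonneg _)
        zero_le_one
    _ = _ := one_mul _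

/-- Comparison for the linear equation `d' = p - c d`, `d(0) = 0`. -/
theorem HasACDeriv.linear_bounds {d p c r P : ℝ → ℝ} {b ε : ℝ} (hb : 0 ≤ b)
    (hd : HasACDeriv d (fun x => p x - c x * d x) 0 b) (h0 : d 0 = 0)
    (hc : IntervalIntegrable c volume 0 b) (hr : IntervalIntegrable r volume 0 b)
    (hP : IntervalIntegrable P volume 0 b)
    (hcr : ∀ x ∈ Icc 0 b, |c x| ≤ r x) (hp : ∀ x ∈ Icc 0 b, ε ≤ p x ∧ p x ≤ P x) (hε : 0 ≤ ε) :
    ε * b * Real.exp (-(2 * ∫ x in (0 : ℝ)..b, r x)) ≤ d b ∧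
      d b ≤ (∫ x in (0 : ℝ)..b, P x) * Real.exp (2 * ∫ x in (0 : ℝ)..b, r x) := by
  set C : ℝ → ℝ := fun x => ∫ t in (0 : ℝ)..x, c t with hC
  set S := ∫ x in (0 : ℝ)..b, r x with hS
  have hCS : ∀ x ∈ Icc 0 b, |C x| ≤ S := by
    intro x hx
    have hsub : uIcc 0 x ⊆ uIcc 0 b := by
      rw [uIcc_of_le hx.1, uIcc_of_le hb]; exact Icc_subset_Icc le_rfl hx.2
    calc |C x| ≤ ∫ t in (0 : ℝ)..x, r t := by
          change ‖∫ t in (0 : ℝ)..x, c t‖ ≤ _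
          exact intervalIntegral.norm_integral_le_of_norm_le hx.1
            (Eventually.of_forall fun t ht => hcr t ⟨ht.1.le, ht.2.trans hx.2⟩) (hr.mono_set hsub)
      _ ≤ S := by
          refine intervalIntegral.integral_mono_interval le_rfl hx.1 hx.2 ?_ hr
          rw [EventuallyLE, ae_restrict_iff' measurableSet_Ioc]
          exact Eventually.of_forall fun t ht => (abs_nonneg _).trans (hcr t ⟨ht.1.le, ht.2⟩)
  have h1 : HasACDeriv (fun x => d x * Real.exp (C x)) (fun x => p x * Real.exp (C x)) 0 b :=
    (hd.mul (HasACDeriv.integral hc left_mem_uIcc).exp).congr_deriv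
      (Eventually.of_forall fun x _ => by ring)
  have hI := h1.integral_eq_sub h1.intervalIntegrable
  rw [h0, zero_mul, sub_zero] at hI
  have hlo : ε * b * Real.exp (-S) ≤ d b * Real.exp (C b) := by
    rw [← hI]
    have : ∫ x in (0 : ℝ)..b, ε * Real.exp (-S) = ε * b * Real.exp (-S) := by
      rw [intervalIntegral.integral_const]; simp; ring
    rw [← this]
    refine intervalIntegral.integral_mono_on hb (by simp) h1.intervalIntegrable fun x hx => ?_
    have := (abs_le.1 (hCS x hx)).1
    exact mul_le_mul (hp x hx).1 (Real.exp_le_exp.2 this) (Real.exp_pos _).le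
      (hε.trans (hp x hx).1)
  have hhi : d b * Real.exp (C b) ≤ (∫ x in (0 : ℝ)..b, P x) * Real.exp S := by
    rw [← hI, ← intervalIntegral.integral_mul_const]
    refine intervalIntegral.integral_mono_on hb h1.intervalIntegrable (hP.mul_const _) fun x hx => ?_
    have := (abs_le.1 (hCS x hx)).2
    exact mul_le_mul (hp x hx).2 (Real.exp_le_exp.2 this) (Real.exp_pos _).le
      (hε.trans ((hp x hx).1.trans (hp x hx).2))
  have hCb := abs_le.1 (hCS b ⟨hb, le_rfl⟩)
  have hPos : 0 ≤ d b := by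
    have h2 : 0 ≤ d b * Real.exp (C b) := le_trans (by positivity) hlo
    exact nonneg_of_mul_nonneg_left h2 (Real.exp_pos _)
  constructor
  · have h2 : d b * Real.exp (C b) ≤ d b * Real.exp S := by gcongr; exact hCb.2
    have h3 := hlo.trans h2
    have h4 : -(2 * S) = -S + -S := by ring
    rw [h4, Real.exp_add, ← mul_assoc]
    calc _ ≤ d b * Real.exp S * Real.exp (-S) := by gcongr
      _ = d b := by rw [mul_assoc, ← Real.exp_add]; simp
  · have h2 : d b * Real.exp (-S) ≤ d b * Real.exp (C b) := by gcongr; exact hCb.1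
    have h3 := h2.trans hhi
    have h4 : 2 * S = S + S := by ring
    rw [h4, Real.exp_add, ← mul_assoc]
    calc d b = d b * Real.exp (-S) * Real.exp S := by rw [mul_assoc, ← Real.exp_add]; simp
      _ ≤ _ := by gcongr

section Prufer
variable {V : ℝ → ℝ} {k b : ℝ}

theorem prufer_denom_pos (hb : 0 ≤ b) (hV : IntervalIntegrable V volume 0 b) (hk : 0 < k) {x : ℝ}
    (hx : x ∈ Icc 0 b) : 0 < realSolD V (k ^ 2) x ^ 2 + (k * realSol V (k ^ 2) x) ^ 2 := by
  have hVx : IntervalIntegrable V volume 0 x := hV.mono_set (by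
    rw [uIcc_of_le hx.1, uIcc_of_le hb]; exact Icc_subset_Icc le_rfl hx.2)
  have h := realSol_ne_zero hx.1 hVx (k ^ 2)
  by_contra! hc
  have h1 : realSolD V (k ^ 2) x = 0 := by
    nlinarith [sq_nonneg (realSolD V (k ^ 2) x), sq_nonneg (k * realSol V (k ^ 2) x)]
  have h2 : k * realSol V (k ^ 2) x = 0 := by
    nlinarith [sq_nonneg (realSolD V (k ^ 2) x), sq_nonneg (k * realSol V (k ^ 2) x)]
  exact h ⟨(mul_eq_zero.1 h2).resolve_left hk.ne', h1⟩

theorem prufer_ratio_continuousOn (hb : 0 ≤ b) (hV : IntervalIntegrable V volume 0 b)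
    (hk : 0 < k) : ContinuousOn (fun t => (k * realSol V (k ^ 2) t) ^ 2 /
      (realSolD V (k ^ 2) t ^ 2 + (k * realSol V (k ^ 2) t) ^ 2)) (Icc 0 b) := by
  have h := realSol_continuousOn hb hV (k ^ 2)
  exact ((continuousOn_const.mul h.1).pow 2).div ((h.2.pow 2).add ((continuousOn_const.mul h.1).pow 2))
    fun x hx => (prufer_denom_pos hb hV hk hx).ne'

theorem pruferAngle_hasACDeriv_ratio (hb : 0 ≤ b) (hV : IntervalIntegrable V volume 0 b)
    (hk : 0 < k) : HasACDeriv (pruferAngle V k) (fun t => k - 1 / k * (V t *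
      ((k * realSol V (k ^ 2) t) ^ 2 / (realSolD V (k ^ 2) t ^ 2 + (k * realSol V (k ^ 2) t) ^ 2))))
      0 b := by
  refine HasACDeriv.integral (intervalIntegrable_const.sub ((hV.mul_continuousOn ?_).const_mul _))
    left_mem_uIcc
  rw [uIcc_of_le hb]
  exact prufer_ratio_continuousOn hb hV hk

theorem pruferAngle_zero (k : ℝ) : pruferAngle V k 0 = 0 := by simp [pruferAngle]

/-- The polar representation of the regular solution. -/
theorem prufer_polar (hb : 0 ≤ b) (hV : IntervalIntegrable V volume 0 b)
    (hVnn : ∀ x, 0 ≤ V x) (hk : 0 < k) : ∃ B : ℝ, B ≠ 0 ∧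
      k * realSol V (k ^ 2) b = B * Real.sin (pruferAngle V k b) ∧
      realSolD V (k ^ 2) b = B * Real.cos (pruferAngle V k b) := by
  have hθ := pruferAngle_hasACDeriv_ratio hb hV hk
  have hs := hθ.scomp' (fun y => Real.hasDerivAt_sin y) Real.continuous_cos
  have hc := hθ.scomp' (fun y => Real.hasDerivAt_cos y) Real.continuous_sin.neg
  have hu := (HasACDeriv.const k).mul (realSol_hasACDeriv hb hV (k ^ 2))
  have hv := realSolD_hasACDeriv hb hV (k ^ 2)
  have hA := (hv.mul hs).sub (hu.mul hc)
  have hA2 := hA.mul hA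
  have h0 := hA2.eq_zero_of_deriv_le hb (p := fun x => V x / k) (hV.div_const _)
    (by simp [pruferAngle_zero]) (mul_self_nonneg _) (by
      refine Eventually.of_forall fun x hx => ?_
      have hD := prufer_denom_pos hb hV hk hx
      simp only [smul_eq_mul]
      set u := realSol V (k ^ 2) x
      set v := realSolD V (k ^ 2) x
      set s := Real.sin (pruferAngle V k x)
      set c := Real.cos (pruferAngle V k x)
      have hsc : s ^ 2 + c ^ 2 = 1 := Real.sin_sq_add_cos_sq _
      set A := v * s - k * u * c with hAdef
      have key : ((V x - k ^ 2) * u * s + v * ((k - 1 / k * (V x *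
          ((k * u) ^ 2 / (v ^ 2 + (k * u) ^ 2)))) * c) - ((0 * u + k * v) * c + k * u *
          ((k - 1 / k * (V x * ((k * u) ^ 2 / (v ^ 2 + (k * u) ^ 2)))) * -s))) =
          V x * (u * v / (v ^ 2 + (k * u) ^ 2)) * A := by
        have hD1 : v ^ 2 + k ^ 2 * u ^ 2 ≠ 0 := by rw [← mul_pow]; exact hD.ne'
        rw [hAdef, mul_pow]; field_simp; ring
      rw [key]
      have h1 : u * v / (v ^ 2 + (k * u) ^ 2) ≤ 1 / (2 * k) := by
        rw [div_le_div_iff₀ hD (by positivity)]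
        nlinarith [sq_nonneg (v - k * u)]
      have h2 : V x * (u * v / (v ^ 2 + (k * u) ^ 2)) ≤ V x * (1 / (2 * k)) :=
        mul_le_mul_of_nonneg_left h1 (hVnn x)
      have h3 : V x / k = 2 * (V x * (1 / (2 * k))) := by field_simp
      rw [h3]
      nlinarith [mul_self_nonneg A])
  have hA0 := mul_self_eq_zero.1 h0
  set u := realSol V (k ^ 2) b
  set v := realSolD V (k ^ 2) b
  set s := Real.sin (pruferAngle V k b)
  set c := Real.cos (pruferAngle V k b)
  have hsc : s ^ 2 + c ^ 2 = 1 := Real.sin_sq_add_cos_sq _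
  have hD : 0 < v ^ 2 + (k * u) ^ 2 := prufer_denom_pos hb hV hk ⟨hb, le_rfl⟩
  have e1 : k * u = (v * c + k * u * s) * s := by linear_combination (-k * u) * hsc - c * hA0
  have e2 : v = (v * c + k * u * s) * c := by linear_combination (-v) * hsc + s * hA0
  refine ⟨v * c + k * u * s, fun h => ?_, e1, e2⟩
  rw [h, zero_mul] at e1 e2
  rw [e1, e2] at hD
  simp at hD

theorem prufer_sin_sq (hb : 0 ≤ b) (hV : IntervalIntegrable V volume 0 b)
    (hVnn : ∀ x, 0 ≤ V x) (hk : 0 < k) : Real.sin (pruferAngle V k b) ^ 2 =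
      (k * realSol V (k ^ 2) b) ^ 2 / (realSolD V (k ^ 2) b ^ 2 + (k * realSol V (k ^ 2) b) ^ 2) := by
  obtain ⟨B, hB, h1, h2⟩ := prufer_polar hb hV hVnn hk
  rw [h1, h2, mul_pow, mul_pow, ← mul_add, Real.cos_sq_add_sin_sq, mul_one,
    mul_div_cancel_left₀ _ (pow_ne_zero 2 hB)]

theorem prufer_sin_eq_zero_iff (hb : 0 ≤ b) (hV : IntervalIntegrable V volume 0 b)
    (hVnn : ∀ x, 0 ≤ V x) (hk : 0 < k) :
    Real.sin (pruferAngle V k b) = 0 ↔ realSol V (k ^ 2) b = 0 := by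
  obtain ⟨B, hB, h1, h2⟩ := prufer_polar hb hV hVnn hk
  constructor
  · intro h
    rw [h, mul_zero] at h1
    exact (mul_eq_zero.1 h1).resolve_left hk.ne'
  · intro h
    rw [h, mul_zero] at h1
    exact (mul_eq_zero.1 h1.symm).resolve_left hB

theorem pruferAngle_hasACDeriv (hb : 0 ≤ b) (hV : IntervalIntegrable V volume 0 b)
    (hVnn : ∀ x, 0 ≤ V x) (hk : 0 < k) : HasACDeriv (pruferAngle V k)
      (fun t => k - 1 / k * (V t * Real.sin (pruferAngle V k t) ^ 2)) 0 b := by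
  refine (pruferAngle_hasACDeriv_ratio hb hV hk).congr_deriv (Eventually.of_forall fun x hx => ?_)
  rw [uIcc_of_le hb] at hx
  rw [prufer_sin_sq hx.1 (hV.mono_set ?_) hVnn hk]
  rw [uIcc_of_le hx.1, uIcc_of_le hb]
  exact Icc_subset_Icc le_rfl hx.2

end Prufer

section Phase
variable {V : ℝ → ℝ} {k : ℝ}

theorem IsShortRange.prufer (hV : IsShortRange V) (hk : 0 < k) {b : ℝ} (hb : 0 ≤ b) :
    HasACDeriv (pruferAngle V k)
      (fun t => k - 1 / k * (V t * Real.sin (pruferAngle V k t) ^ 2)) 0 b :=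
  pruferAngle_hasACDeriv hb (hV.intervalIntegrable 0 b) hV.nonneg hk

theorem HasACDeriv.continuousOn_Ici {F f : ℝ → ℝ} (h : ∀ b, 0 ≤ b → HasACDeriv F f 0 b) :
    ContinuousOn F (Ici 0) := by
  intro x hx
  have h1 := (h (x + 1) (add_nonneg hx zero_le_one)).continuousOn
  have hx' : (0 : ℝ) ≤ x := hx
  rw [uIcc_of_le (by linarith)] at h1
  refine (h1 x ⟨hx, by linarith⟩).mono_of_mem_nhdsWithin ?_
  filter_upwards [self_mem_nhdsWithin, mem_nhdsWithin_of_mem_nhds (Iic_mem_nhds (lt_add_one x))]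
    with y h2 h3 using ⟨h2, h3⟩

theorem HasACDeriv.ae_Ioi {E : Type*} [NormedAddCommGroup E] [NormedSpace ℝ E] {F f : ℝ → E}
    (h : ∀ b, 0 ≤ b → HasACDeriv F f 0 b) :
    ∀ᵐ x ∂(volume : Measure ℝ).restrict (Ioi 0), HasDerivAt F (f x) x := by
  have h1 : ∀ᵐ x : ℝ, ∀ n : ℕ, x ∈ uIcc (0 : ℝ) n → HasDerivAt F (f x) x :=
    ae_all_iff.2 fun n => (h n n.cast_nonneg).hasDerivAt
  filter_upwards [ae_restrict_of_ae h1, ae_restrict_mem measurableSet_Ioi] with x hx hx0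
  obtain ⟨n, hn⟩ := exists_nat_ge x
  exact hx n (by rw [uIcc_of_le n.cast_nonneg]; exact ⟨le_of_lt hx0, hn⟩)

theorem IsShortRange.isPruferAngle (hV : IsShortRange V) (hk : 0 < k) :
    IsPruferAngle V k (pruferAngle V k) :=
  ⟨pruferAngle_zero k, fun _ hb => (hV.prufer hk hb.le).ac,
    HasACDeriv.ae_Ioi fun _ hb => hV.prufer hk hb⟩

theorem IsPruferAngle.hasACDeriv {θ : ℝ → ℝ} (h : IsPruferAngle V k θ) {b : ℝ} (hb : 0 ≤ b) :
    HasACDeriv θ (fun x => k - 1 / k * (V x * Real.sin (θ x) ^ 2)) 0 b := by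
  have h1 := (ae_restrict_iff' measurableSet_Ioi).1 h.ode
  refine ⟨(h.ac (b + 1) (by linarith)).mono ?_, ?_⟩
  · rw [uIcc_of_le hb, uIcc_of_le (by linarith)]; exact Icc_subset_Icc le_rfl (by linarith)
  · have h2 : ∀ᵐ x : ℝ, x ≠ 0 := by simp [ae_iff, measure_singleton]
    filter_upwards [h1, h2] with x h3 h4 h5
    rw [uIcc_of_le hb] at h5
    exact h3 (lt_of_le_of_ne h5.1 h4.symm)

theorem IsPruferAngle.eq_pruferAngle (hV : IsShortRange V) (hk : 0 < k) {θ : ℝ → ℝ}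
    (h : IsPruferAngle V k θ) {x : ℝ} (hx : 0 ≤ x) : θ x = pruferAngle V k x := by
  have hd := (h.hasACDeriv hx).sub (hV.prufer hk hx)
  have h0 := (hd.mul hd).eq_zero_of_deriv_le hx (p := fun x => 2 / k * V x)
    ((hV.intervalIntegrable 0 x).const_mul _) (by simp [h.zero, pruferAngle_zero])
    (mul_self_nonneg _) (Eventually.of_forall fun t _ => by
      have h1 := abs_sin_sq_sub_le (θ t) (pruferAngle V k t)
      set d := θ t - pruferAngle V k t
      have h2 : k - 1 / k * (V t * Real.sin (θ t) ^ 2) - (k - 1 / k *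
        (V t * Real.sin (pruferAngle V k t) ^ 2)) =
        -(1 / k * V t) * (Real.sin (θ t) ^ 2 - Real.sin (pruferAngle V k t) ^ 2) := by ring
      rw [h2]
      set σ := Real.sin (θ t) ^ 2 - Real.sin (pruferAngle V k t) ^ 2
      have h3 : -(σ * d) ≤ d * d := by
        calc -(σ * d) ≤ |σ * d| := neg_le_abs _
          _ = |σ| * |d| := abs_mul _ _
          _ ≤ |d| * |d| := by gcongr
          _ = d * d := abs_mul_abs_self d
      have h4 : 0 ≤ 1 / k * V t := mul_nonneg (by positivity) (hV.nonneg t)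
      have h5 := mul_le_mul_of_nonneg_left h3 h4
      have h6 : 2 / k * V t * (d * d) = 2 * (1 / k * V t * (d * d)) := by ring
      rw [h6]; linarith)
  have := mul_self_eq_zero.1 h0
  linarith

theorem IsShortRange.prufer_le (hV : IsShortRange V) (hk : 0 < k) {x : ℝ} (hx : 0 ≤ x) :
    pruferAngle V k x ≤ k * x := by
  have h := ((HasACDeriv.const k).mul HasACDeriv.id).sub (hV.prufer hk hx)
  have h1 := h.le_of_nonneg hx (Eventually.of_forall fun t _ => by
    have h4 : 0 ≤ 1 / k * (V t * Real.sin (pruferAngle V k t) ^ 2) :=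
      mul_nonneg (by positivity) (mul_nonneg (hV.nonneg t) (sq_nonneg _))
    linarith)
  simp only [pruferAngle_zero, mul_zero, sub_zero] at h1
  linarith

theorem IsShortRange.prufer_pos (hV : IsShortRange V) (hk : 0 < k) {x : ℝ} (hx : 0 < x) :
    0 < pruferAngle V k x := by
  have hc : ContinuousOn (fun t => Real.sin (pruferAngle V k t) * Real.sinc (pruferAngle V k t))
      (uIcc 0 x) :=
    (Real.continuous_sin.mul Real.continuous_sinc).comp_continuousOn (hV.prufer hk hx.le).continuousOn
  have hcV : IntervalIntegrable (fun t => 1 / k * (V t * (Real.sin (pruferAngle V k t) *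
      Real.sinc (pruferAngle V k t)))) volume 0 x :=
    ((hV.intervalIntegrable 0 x).mul_continuousOn hc).const_mul _
  have h := HasACDeriv.linear_bounds (d := pruferAngle V k) (p := fun _ => k) (P := fun _ => k)
    (c := fun t => 1 / k * (V t * (Real.sin (pruferAngle V k t) * Real.sinc (pruferAngle V k t))))
    (r := fun t => 1 / k * V t) (ε := k) hx.le
    ((hV.prufer hk hx.le).congr_deriv (Eventually.of_forall fun t _ => by
      linear_combination (1 / k * V t * Real.sin (pruferAngle V k t)) * sinc_mul_self (pruferAngle V k t)))
    (pruferAngle_zero k) hcV ((hV.intervalIntegrable 0 x).const_mul _) intervalIntegrable_const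
    (fun t _ => by
      rw [abs_mul, abs_mul, abs_mul, abs_of_nonneg (hV.nonneg t), abs_of_pos (by positivity)]
      have h1 := Real.abs_sin_le_one (pruferAngle V k t)
      have h2 := Real.abs_sinc_le_one (pruferAngle V k t)
      have h3 : |Real.sin (pruferAngle V k t)| * |Real.sinc (pruferAngle V k t)| ≤ 1 :=
        mul_le_one₀ h1 (abs_nonneg _) h2
      have h4 := mul_le_mul_of_nonneg_left h3 (hV.nonneg t)
      rw [mul_one] at h4
      gcongr)
    (fun t _ => ⟨le_rfl, le_rfl⟩) hk.le
  exact lt_of_lt_of_le (by positivity) h.1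

theorem IsShortRange.prufer_nonneg (hV : IsShortRange V) (hk : 0 < k) {x : ℝ} (hx : 0 ≤ x) :
    0 ≤ pruferAngle V k x := by
  rcases hx.eq_or_lt with rfl | hx
  · rw [pruferAngle_zero]
  · exact (hV.prufer_pos hk hx).le

theorem IsShortRange.sin_sq_le (hV : IsShortRange V) (hk : 0 < k) {x : ℝ} (hx : 0 ≤ x) :
    Real.sin (pruferAngle V k x) ^ 2 ≤ k ^ 2 * x ^ 2 := by
  have h1 := hV.prufer_le hk hx
  have h2 := hV.prufer_nonneg hk hx
  calc _ ≤ pruferAngle V k x ^ 2 := Real.sin_sq_le_sq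
    _ ≤ (k * x) ^ 2 := by gcongr
    _ = _ := mul_pow _ _ _

/-- The derivative of the difference of two Prüfer angles, in linearised form. -/
theorem prufer_sub_deriv_eq {v a a' k k' : ℝ} (hk : 0 < k) (hk' : 0 < k') :
    (k' - 1 / k' * (v * Real.sin a' ^ 2)) - (k - 1 / k * (v * Real.sin a ^ 2)) =
      (k' - k) * (1 + v * (Real.sin a ^ 2 / (k * k'))) -
        (1 / k' * (v * (Real.sin (a' + a) * Real.sinc (a' - a)))) * (a' - a) := by
  have h1 := sinc_mul_self (a' - a)
  have h2 := sin_sq_sub_sin_sq_eq a' a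
  have h3 : Real.sin a' ^ 2 = Real.sin a ^ 2 + Real.sin (a' + a) * (Real.sinc (a' - a) * (a' - a)) := by
    rw [h1, ← h2]; ring
  rw [h3]
  field_simp
  ring

theorem IsShortRange.prufer_coeff_bounds (hV : IsShortRange V) {k' : ℝ} (hk : 0 < k) (hkk : k ≤ k')
    {t : ℝ} (ht : 0 ≤ t) :
    |1 / k' * (V t * (Real.sin (pruferAngle V k' t + pruferAngle V k t) *
        Real.sinc (pruferAngle V k' t - pruferAngle V k t)))| ≤ 2 * (V t * t) ∧
    V t * (Real.sin (pruferAngle V k t) ^ 2 / (k * k')) ≤ V t * t ^ 2 := by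
  have hk' : 0 < k' := hk.trans_le hkk
  constructor
  · have h1 : |Real.sin (pruferAngle V k' t + pruferAngle V k t)| ≤ 2 * k' * t := by
      refine Real.abs_sin_le_abs.trans ?_
      rw [abs_of_nonneg (add_nonneg (hV.prufer_nonneg hk' ht) (hV.prufer_nonneg hk ht))]
      have := hV.prufer_le hk' ht
      have := hV.prufer_le hk ht
      nlinarith
    have h2 := Real.abs_sinc_le_one (pruferAngle V k' t - pruferAngle V k t)
    rw [abs_mul, abs_mul, abs_mul, abs_of_nonneg (hV.nonneg t), abs_of_pos (by positivity)]
    calc _ ≤ 1 / k' * (V t * (2 * k' * t * 1)) := by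
          have := hV.nonneg t
          gcongr
      _ = _ := by field_simp
  · refine mul_le_mul_of_nonneg_left ?_ (hV.nonneg t)
    rw [div_le_iff₀ (by positivity)]
    refine (hV.sin_sq_le hk ht).trans ?_
    have : 0 ≤ t ^ 2 * k * (k' - k) := by
      have := sub_nonneg.2 hkk
      positivity
    nlinarith

/-- The constant in `prufer_sub_bounds`. -/
noncomputable def pruferLipConst (V : ℝ → ℝ) : ℝ :=
  (1 + ∫ x, V x * (1 + x ^ 2)) * Real.exp (4 * ∫ x, V x * (1 + x ^ 2))

theorem IsShortRange.integral_weight_nonneg (hV : IsShortRange V) :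
    0 ≤ ∫ x, V x * (1 + x ^ 2) :=
  integral_nonneg fun x => mul_nonneg (hV.nonneg x) (by positivity)

theorem IsShortRange.pruferLipConst_pos (hV : IsShortRange V) : 0 < pruferLipConst V := by
  have := hV.integral_weight_nonneg
  rw [pruferLipConst]; positivity

theorem IsShortRange.prufer_sub_bounds (hV : IsShortRange V) {k' : ℝ} (hk : 0 < k) (hkk : k ≤ k')
    {x : ℝ} (hx : 0 ≤ x) :
    (k' - k) * x * Real.exp (-(4 * ∫ x, V x * (1 + x ^ 2))) ≤ pruferAngle V k' x - pruferAngle V k x ∧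
    pruferAngle V k' x - pruferAngle V k x ≤ pruferLipConst V * (k' - k) * (1 + x) := by
  have hk' : 0 < k' := hk.trans_le hkk
  have hd := (hV.prufer hk' hx).sub (hV.prufer hk hx)
  have hθ := (hV.prufer hk hx).continuousOn
  have hθ' := (hV.prufer hk' hx).continuousOn
  have hVi := hV.intervalIntegrable 0 x
  have hW : IntervalIntegrable (fun t => V t * (1 + t ^ 2)) volume 0 x :=
    hV.integrable_weight.intervalIntegrable
  have hWle : ∫ t in (0 : ℝ)..x, V t * (1 + t ^ 2) ≤ ∫ x, V x * (1 + x ^ 2) := by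
    rw [intervalIntegral.integral_of_le hx]; exact hV.setIntegral_mono _
  have hc : IntervalIntegrable (fun t => 1 / k' * (V t * (Real.sin (pruferAngle V k' t +
      pruferAngle V k t) * Real.sinc (pruferAngle V k' t - pruferAngle V k t)))) volume 0 x :=
    (hVi.mul_continuousOn ((Real.continuous_sin.comp_continuousOn (hθ'.add hθ)).mul
      (Real.continuous_sinc.comp_continuousOn (hθ'.sub hθ)))).const_mul _
  have h := HasACDeriv.linear_bounds (d := fun t => pruferAngle V k' t - pruferAngle V k t)
    (p := fun t => (k' - k) * (1 + V t * (Real.sin (pruferAngle V k t) ^ 2 / (k * k'))))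
    (c := fun t => 1 / k' * (V t * (Real.sin (pruferAngle V k' t +
      pruferAngle V k t) * Real.sinc (pruferAngle V k' t - pruferAngle V k t))))
    (r := fun t => 2 * (V t * t)) (P := fun t => (k' - k) * (1 + V t * (1 + t ^ 2)))
    (ε := k' - k) hx
    (hd.congr_deriv (Eventually.of_forall fun t _ => prufer_sub_deriv_eq hk hk'))
    (by simp [pruferAngle_zero]) hc
    ((hVi.mul_continuousOn continuousOn_id).const_mul _)
    ((intervalIntegrable_const.add hW).const_mul _)
    (fun t ht => (hV.prufer_coeff_bounds hk hkk ht.1).1)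
    (fun t ht => by
      have h1 := (hV.prufer_coeff_bounds hk hkk ht.1).2
      have h2 := sub_nonneg.2 hkk
      have h3 : 0 ≤ V t * (Real.sin (pruferAngle V k t) ^ 2 / (k * k')) :=
        mul_nonneg (hV.nonneg t) (by positivity)
      have h4 := hV.nonneg t
      constructor <;> nlinarith)
    (sub_nonneg.2 hkk)
  have hr : ∫ t in (0 : ℝ)..x, 2 * (V t * t) ≤ 2 * ∫ x, V x * (1 + x ^ 2) := by
    rw [intervalIntegral.integral_const_mul]
    refine mul_le_mul_of_nonneg_left (le_trans ?_ hWle) zero_le_two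
    refine intervalIntegral.integral_mono_on hx (hVi.mul_continuousOn continuousOn_id) hW
      fun t _ => mul_le_mul_of_nonneg_left ?_ (hV.nonneg t)
    nlinarith [sq_nonneg (t - 1), sq_nonneg t]
  have hkk0 := sub_nonneg.2 hkk
  constructor
  · exact le_trans (mul_le_mul_of_nonneg_left (Real.exp_le_exp.2 (by linarith))
      (mul_nonneg hkk0 hx)) h.1
  · refine h.2.trans ?_
    have hnn := hV.integral_weight_nonneg
    have hP : ∫ t in (0 : ℝ)..x, (k' - k) * (1 + V t * (1 + t ^ 2)) ≤
        (k' - k) * ((1 + ∫ x, V x * (1 + x ^ 2)) * (1 + x)) := by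
      rw [intervalIntegral.integral_const_mul, intervalIntegral.integral_add
        intervalIntegrable_const hW]
      gcongr
      simp only [intervalIntegral.integral_const, sub_zero, smul_eq_mul, mul_one]
      nlinarith
    calc _ ≤ (k' - k) * ((1 + ∫ x, V x * (1 + x ^ 2)) * (1 + x)) *
          Real.exp (4 * ∫ x, V x * (1 + x ^ 2)) := by
          refine mul_le_mul hP (Real.exp_le_exp.2 (by linarith)) (Real.exp_pos _).le (by positivity)
      _ = _ := by rw [pruferLipConst]; ring

end Phase

/-- The scattering phase shift. -/
noncomputable def phaseShift (V : ℝ → ℝ) (k : ℝ) : ℝ :=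
  -(1 / k) * ∫ t in Ioi (0 : ℝ), V t * Real.sin (pruferAngle V k t) ^ 2

section
variable {V : ℝ → ℝ} {k : ℝ}

theorem IsShortRange.prufer_continuousOn (hV : IsShortRange V) (hk : 0 < k) :
    ContinuousOn (pruferAngle V k) (Ici 0) :=
  HasACDeriv.continuousOn_Ici fun _ hb => hV.prufer hk hb

theorem IsShortRange.integrableOn_sin_sq (hV : IsShortRange V) (hk : 0 < k) :
    IntegrableOn (fun t => V t * Real.sin (pruferAngle V k t) ^ 2) (Ioi 0) := by
  refine hV.integrable.integrableOn.mono' ?_ (Eventually.of_forall fun t => ?_)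
  · refine hV.measurable.aestronglyMeasurable.mul (ContinuousOn.aestronglyMeasurable ?_
      measurableSet_Ioi)
    exact (Real.continuous_sin.comp_continuousOn
      ((hV.prufer_continuousOn hk).mono Ioi_subset_Ici_self)).pow 2
  · have h1 := hV.nonneg t
    have h2 := Real.sin_sq_le_one (pruferAngle V k t)
    rw [Real.norm_eq_abs, abs_of_nonneg (by positivity)]
    nlinarith

theorem IsShortRange.prufer_sub_eq (hV : IsShortRange V) (hk : 0 < k) {x : ℝ} (hx : 0 ≤ x) :
    pruferAngle V k x - k * x =
      -(1 / k) * ∫ t in (0 : ℝ)..x, V t * Real.sin (pruferAngle V k t) ^ 2 := by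
  have h := (hV.prufer hk hx).sub ((HasACDeriv.const k).mul HasACDeriv.id)
  have h1 := h.integral_eq_sub h.intervalIntegrable
  simp only [pruferAngle_zero, mul_zero, sub_zero] at h1
  rw [← h1, ← intervalIntegral.integral_const_mul]
  refine intervalIntegral.integral_congr fun t _ => ?_
  ring

theorem IsShortRange.tendsto_phaseShift (hV : IsShortRange V) (hk : 0 < k) :
    Tendsto (fun x => pruferAngle V k x - k * x) atTop (𝓝 (phaseShift V k)) := by
  have h := (intervalIntegral_tendsto_integral_Ioi 0 (hV.integrableOn_sin_sq hk)
    tendsto_id).const_mul (-(1 / k))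
  refine h.congr' ?_
  filter_upwards [eventually_ge_atTop 0] with x hx
  rw [hV.prufer_sub_eq hk hx]; rfl

theorem IsShortRange.isPhaseShift (hV : IsShortRange V) : IsPhaseShift V (phaseShift V) :=
  fun _ hk => ⟨_, hV.isPruferAngle hk, hV.tendsto_phaseShift hk⟩

theorem IsPhaseShift.eq_phaseShift (hV : IsShortRange V) {δ : ℝ → ℝ} (h : IsPhaseShift V δ)
    (hk : 0 < k) : δ k = phaseShift V k := by
  obtain ⟨θ, hθ, hlim⟩ := h k hk
  refine tendsto_nhds_unique hlim ((hV.tendsto_phaseShift hk).congr' ?_)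
  filter_upwards [eventually_ge_atTop 0] with x hx
  rw [hθ.eq_pruferAngle hV hk hx]

/-- The tail of the weighted integral of the potential. -/
noncomputable def weightTail (V : ℝ → ℝ) (T : ℝ) : ℝ := ∫ t in Ioi T, V t * (1 + t ^ 2)

theorem IsShortRange.weightTail_nonneg (hV : IsShortRange V) (T : ℝ) : 0 ≤ weightTail V T :=
  integral_nonneg fun t => mul_nonneg (hV.nonneg t) (by positivity)

theorem IsShortRange.tendsto_weightTail (hV : IsShortRange V) :
    Tendsto (weightTail V) atTop (𝓝 0) := by
  have h := intervalIntegral_tendsto_integral_Ioi 0 hV.integrable_weight.integrableOn tendsto_id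
  have h2 := (tendsto_const_nhds (x := ∫ t in Ioi 0, V t * (1 + t ^ 2))).sub h
  rw [sub_self] at h2
  refine h2.congr fun T => ?_
  have := intervalIntegral.integral_Ioi_sub_Ioi' (a := 0) (b := T) (μ := volume)
    (f := fun t => V t * (1 + t ^ 2))
    hV.integrable_weight.integrableOn hV.integrable_weight.integrableOn
  simp only [weightTail, id]
  linarith

theorem IsShortRange.integral_le_weightTail (hV : IsShortRange V) {S T : ℝ} (hST : S ≤ T) :
    ∫ t in S..T, V t * (1 + t ^ 2) ≤ weightTail V S := by
  rw [intervalIntegral.integral_of_le hST]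
  exact setIntegral_mono_set hV.integrable_weight.integrableOn
    (Eventually.of_forall fun t => mul_nonneg (hV.nonneg t) (by positivity))
    (Eventually.of_forall Ioc_subset_Ioi_self)

/-- The phase shift of the potential truncated at `T`. -/
noncomputable def phaseAt (V : ℝ → ℝ) (T k : ℝ) : ℝ := pruferAngle V k T - k * T

@[simp] theorem phaseAt_zero (k : ℝ) : phaseAt V 0 k = 0 := by simp [phaseAt, pruferAngle_zero]

theorem IsShortRange.phaseAt_hasACDeriv (hV : IsShortRange V) (hk : 0 < k) {b : ℝ} (hb : 0 ≤ b) :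
    HasACDeriv (fun T => phaseAt V T k)
      (fun t => -(1 / k) * (V t * Real.sin (pruferAngle V k t) ^ 2)) 0 b :=
  ((hV.prufer hk hb).sub ((HasACDeriv.const k).mul HasACDeriv.id)).congr_deriv
    (Eventually.of_forall fun t _ => by ring)

theorem IsShortRange.phaseShift_sub_phaseAt (hV : IsShortRange V) (hk : 0 < k) {T : ℝ}
    (hT : 0 ≤ T) : |phaseShift V k - phaseAt V T k| * (k * (1 + T ^ 2)) ≤ weightTail V T := by
  have h1 : phaseShift V k - phaseAt V T k =
      -(1 / k) * ∫ t in Ioi T, V t * Real.sin (pruferAngle V k t) ^ 2 := by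
    have := intervalIntegral.integral_Ioi_sub_Ioi' (a := 0) (b := T) (μ := volume)
      (hV.integrableOn_sin_sq hk) ((hV.integrableOn_sin_sq hk).mono_set (Ioi_subset_Ioi hT))
    rw [phaseShift, phaseAt, hV.prufer_sub_eq hk hT, ← this]; ring
  have h2 : 0 ≤ ∫ t in Ioi T, V t * Real.sin (pruferAngle V k t) ^ 2 :=
    integral_nonneg fun t => mul_nonneg (hV.nonneg t) (sq_nonneg _)
  rw [h1, abs_mul, abs_neg, abs_of_pos (by positivity), abs_of_nonneg h2]
  have h3 : 1 / k * (∫ t in Ioi T, V t * Real.sin (pruferAngle V k t) ^ 2) * (k * (1 + T ^ 2)) =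
      ∫ t in Ioi T, (1 + T ^ 2) * (V t * Real.sin (pruferAngle V k t) ^ 2) := by
    rw [integral_const_mul]; field_simp
  rw [h3, weightTail]
  refine setIntegral_mono_on (((hV.integrableOn_sin_sq hk).mono_set (Ioi_subset_Ioi hT)).const_mul _)
    hV.integrable_weight.integrableOn measurableSet_Ioi fun t ht => ?_
  have ht' : T < t := ht
  have h4 := hV.nonneg t
  have h5 := Real.sin_sq_le_one (pruferAngle V k t)
  calc (1 + T ^ 2) * (V t * Real.sin (pruferAngle V k t) ^ 2) ≤ (1 + t ^ 2) * (V t * 1) := by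
        gcongr
    _ = _ := by ring

/-- The increments of `δ - δ_T` in `k` are small. -/
theorem IsShortRange.abs_phase_increment_le (hV : IsShortRange V) {k' : ℝ} (hk : 0 < k)
    (hkk : k ≤ k') {T : ℝ} (hT : 0 ≤ T) :
    |(phaseShift V k' - phaseShift V k) - (phaseAt V T k' - phaseAt V T k)| ≤
      (1 + 4 * pruferLipConst V) * (k' - k) * weightTail V T := by
  have hk' : 0 < k' := hk.trans_le hkk
  have hK := hV.pruferLipConst_pos
  have hlim : Tendsto (fun S => |(phaseAt V S k' - phaseAt V S k) -
      (phaseAt V T k' - phaseAt V T k)|) atTop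
      (𝓝 |(phaseShift V k' - phaseShift V k) - (phaseAt V T k' - phaseAt V T k)|) :=
    (((hV.tendsto_phaseShift hk').sub (hV.tendsto_phaseShift hk)).sub tendsto_const_nhds).abs
  refine le_of_tendsto hlim ?_
  filter_upwards [eventually_ge_atTop T] with S hS
  have hS0 : 0 ≤ S := hT.trans hS
  have hd := ((hV.phaseAt_hasACDeriv hk' hS0).sub (hV.phaseAt_hasACDeriv hk hS0)).mono
    (c := T) (d := S) (by rw [uIcc_of_le hS, uIcc_of_le hS0]; exact Icc_subset_Icc hT le_rfl)
  rw [← hd.integral_eq_sub hd.intervalIntegrable]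
  have hW : IntervalIntegrable (fun t => V t * (1 + t ^ 2)) volume T S :=
    hV.integrable_weight.intervalIntegrable
  have h1 : ‖∫ t in T..S, (-(1 / k') * (V t * Real.sin (pruferAngle V k' t) ^ 2) -
      -(1 / k) * (V t * Real.sin (pruferAngle V k t) ^ 2))‖ ≤
      ∫ t in T..S, (1 + 4 * pruferLipConst V) * (k' - k) * (V t * (1 + t ^ 2)) := by
    refine intervalIntegral.norm_integral_le_of_norm_le hS (Eventually.of_forall fun t ht => ?_)
      (hW.const_mul _)
    have ht0 : 0 ≤ t := hT.trans ht.1.le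
    have hkk0 := sub_nonneg.2 hkk
    have e := prufer_sub_deriv_eq (v := V t) (a := pruferAngle V k t) (a' := pruferAngle V k' t)
      hk hk'
    have e2 : (-(1 / k') * (V t * Real.sin (pruferAngle V k' t) ^ 2) -
        -(1 / k) * (V t * Real.sin (pruferAngle V k t) ^ 2)) =
        (k' - k) * (V t * (Real.sin (pruferAngle V k t) ^ 2 / (k * k'))) -
        (1 / k' * (V t * (Real.sin (pruferAngle V k' t + pruferAngle V k t) *
          Real.sinc (pruferAngle V k' t - pruferAngle V k t)))) *
          (pruferAngle V k' t - pruferAngle V k t) := by linear_combination e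
    rw [e2, Real.norm_eq_abs]
    obtain ⟨c1, c2⟩ := hV.prufer_coeff_bounds hk hkk ht0
    have c3 := (hV.prufer_sub_bounds hk hkk ht0).2
    have c4 : 0 ≤ pruferAngle V k' t - pruferAngle V k t :=
      le_trans (by positivity) (hV.prufer_sub_bounds hk hkk ht0).1
    have hVt := hV.nonneg t
    refine (abs_sub _ _).trans ?_
    rw [abs_mul, abs_mul (1 / k' * _), abs_of_nonneg hkk0, abs_of_nonneg c4,
      abs_of_nonneg (mul_nonneg hVt (by positivity))]
    have m1 := mul_le_mul_of_nonneg_left c2 hkk0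
    have m2 := mul_le_mul c1 c3 c4 (by positivity)
    have m3 : 2 * (V t * t) * (pruferLipConst V * (k' - k) * (1 + t)) ≤
        4 * pruferLipConst V * (k' - k) * (V t * (1 + t ^ 2)) := by
      have : 0 ≤ pruferLipConst V * (k' - k) * V t := by positivity
      have h3 : t * (1 + t) ≤ 2 * (1 + t ^ 2) := by nlinarith [sq_nonneg (t - 1)]
      have := mul_le_mul_of_nonneg_left h3 this
      linarith
    have m4 : 0 ≤ (k' - k) * V t := by positivity
    linarith
  refine h1.trans ?_
  rw [intervalIntegral.integral_const_mul]
  exact mul_le_mul_of_nonneg_left (hV.integral_le_weightTail hS)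
    (mul_nonneg (by positivity) (sub_nonneg.2 hkk))

/-- The Lipschitz constant of the phase shift. -/
noncomputable def phaseLipConst (V : ℝ → ℝ) : ℝ := (1 + 4 * pruferLipConst V) * weightTail V 0

theorem IsShortRange.phaseLipConst_nonneg (hV : IsShortRange V) : 0 ≤ phaseLipConst V :=
  mul_nonneg (by linarith [hV.pruferLipConst_pos]) (hV.weightTail_nonneg 0)

theorem IsShortRange.phaseShift_lipschitz (hV : IsShortRange V) {k' : ℝ} (hk : 0 < k)
    (hk' : 0 < k') : |phaseShift V k' - phaseShift V k| ≤ phaseLipConst V * |k' - k| := by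
  rcases le_total k k' with h | h
  · have := hV.abs_phase_increment_le hk h le_rfl
    simp only [phaseAt_zero, sub_zero] at this
    rw [abs_of_nonneg (sub_nonneg.2 h), phaseLipConst]
    linarith
  · have := hV.abs_phase_increment_le hk' h le_rfl
    simp only [phaseAt_zero, sub_zero] at this
    rw [abs_sub_comm, abs_sub_comm k', abs_of_nonneg (sub_nonneg.2 h), phaseLipConst]
    linarith

theorem IsShortRange.abs_phaseShift_le (hV : IsShortRange V) (hk : 0 < k) :
    |phaseShift V k| ≤ k * weightTail V 0 ∧ |phaseShift V k| * k ≤ weightTail V 0 := by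
  have h0 := hV.phaseShift_sub_phaseAt hk le_rfl
  simp only [phaseAt_zero, sub_zero] at h0
  norm_num at h0
  refine ⟨?_, h0⟩
  have h2 : 0 ≤ ∫ t in Ioi (0 : ℝ), V t * Real.sin (pruferAngle V k t) ^ 2 :=
    integral_nonneg fun t => mul_nonneg (hV.nonneg t) (sq_nonneg _)
  rw [phaseShift, abs_mul, abs_neg, abs_of_pos (by positivity), abs_of_nonneg h2, one_div,
    inv_mul_le_iff₀ hk, weightTail, ← mul_assoc, ← integral_const_mul]
  refine setIntegral_mono_on (hV.integrableOn_sin_sq hk)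
    (hV.integrable_weight.integrableOn.const_mul _) measurableSet_Ioi fun t ht => ?_
  have h1 := hV.sin_sq_le hk (le_of_lt ht)
  have h3 := hV.nonneg t
  have h4 := mul_le_mul_of_nonneg_left h1 h3
  have : 0 ≤ k * k * V t := by positivity
  nlinarith

theorem IsShortRange.abs_phaseShift_le_const (hV : IsShortRange V) (hk : 0 < k) :
    |phaseShift V k| ≤ weightTail V 0 := by
  obtain ⟨h1, h2⟩ := hV.abs_phaseShift_le hk
  have h3 := hV.weightTail_nonneg 0
  rcases le_total k 1 with h | h
  · nlinarith
  · nlinarith [abs_nonneg (phaseShift V k)]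

end

section
variable {V : ℝ → ℝ}

theorem realSol_contDiff_param {b : ℝ} (hb : 0 ≤ b) (hV : IntervalIntegrable V volume 0 b) :
    ContDiff ℝ 1 (fun s => realSol V s b) ∧ ContDiff ℝ 1 (fun s => realSolD V s b) := by
  have h := regSol_differentiable hb hV
  have h0 : ContDiff ℝ 1 (fun s : ℝ => (s : ℂ)) := Complex.ofRealCLM.contDiff
  have h1 : ContDiff ℝ 1 (fun z => regSol V z b) := (h.1.contDiff (n := 1)).restrict_scalars ℝ
  have h2 : ContDiff ℝ 1 (fun z => regSolD V z b) := (h.2.contDiff (n := 1)).restrict_scalars ℝ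
  exact ⟨Complex.reCLM.contDiff.comp (h1.comp h0), Complex.reCLM.contDiff.comp (h2.comp h0)⟩

theorem IsShortRange.prufer_continuousAt_param (hV : IsShortRange V) {k T : ℝ} (hk : 0 < k)
    (hT : 0 ≤ T) : ContinuousAt (fun k => pruferAngle V k T) k := by
  have hK := hV.pruferLipConst_pos
  have hbd : ∀ k' : ℝ, 0 < k' → |pruferAngle V k' T - pruferAngle V k T| ≤
      pruferLipConst V * |k' - k| * (1 + T) := by
    intro k' hk'
    rcases le_total k k' with h | h
    · have h1 := hV.prufer_sub_bounds hk h hT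
      have h2 := sub_nonneg.2 h
      rw [abs_of_nonneg h2, abs_of_nonneg (le_trans (by positivity) h1.1)]
      exact h1.2
    · have h1 := hV.prufer_sub_bounds hk' h hT
      have h2 := sub_nonneg.2 h
      rw [abs_sub_comm, abs_sub_comm k', abs_of_nonneg h2,
        abs_of_nonneg (le_trans (by positivity) h1.1)]
      exact h1.2
  rw [ContinuousAt, tendsto_iff_norm_sub_tendsto_zero]
  refine squeeze_zero' (g := fun k' => pruferLipConst V * |k' - k| * (1 + T))
    (Eventually.of_forall fun _ => norm_nonneg _) ?_ ?_
  · filter_upwards [Ioi_mem_nhds hk] with k' hk' using hbd k' hk'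
  · have : Continuous fun k' : ℝ => pruferLipConst V * |k' - k| * (1 + T) := by fun_prop
    simpa using this.tendsto k

/-- The Prüfer angle is continuously differentiable in `k`. -/
theorem IsShortRange.exists_hasDerivAt_phaseAt (hV : IsShortRange V) {T : ℝ} (hT : 0 ≤ T) :
    ∃ D : ℝ → ℝ, ContinuousOn D (Ioi 0) ∧ ∀ k, 0 < k → HasDerivAt (phaseAt V T) (D k) k := by
  have hVi := hV.intervalIntegrable 0 T
  set f : ℝ → ℝ := fun k => realSolD V (k ^ 2) T with hf
  set g : ℝ → ℝ := fun k => k * realSol V (k ^ 2) T with hg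
  have hfc : ContDiff ℝ 1 f := (realSol_contDiff_param hT hVi).2.comp (by fun_prop)
  have hgc : ContDiff ℝ 1 g := contDiff_id.mul ((realSol_contDiff_param hT hVi).1.comp (by fun_prop))
  have hpos : ∀ k, 0 < k → 0 < f k ^ 2 + g k ^ 2 := fun k hk =>
    prufer_denom_pos hT hVi hk ⟨hT, le_rfl⟩
  refine ⟨fun k => (deriv g k * f k - deriv f k * g k) / (f k ^ 2 + g k ^ 2) - T, ?_, ?_⟩
  · refine ContinuousOn.sub (ContinuousOn.div ?_ ?_ fun k hk => (hpos k hk).ne') continuousOn_const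
    · have h1 := hfc.continuous_deriv_one
      have h2 := hgc.continuous_deriv_one
      have h3 := hfc.continuous
      have h4 := hgc.continuous
      fun_prop
    · have h3 := hfc.continuous
      have h4 := hgc.continuous
      fun_prop
  · intro k hk
    have hD := hpos k hk
    have hf' : HasDerivAt f (deriv f k) k := (hfc.differentiable one_ne_zero k).hasDerivAt
    have hg' : HasDerivAt g (deriv g k) k := (hgc.differentiable one_ne_zero k).hasDerivAt
    have hnum : HasDerivAt (fun k' => g k' * f k - f k' * g k)
        (deriv g k * f k - deriv f k * g k) k := (hg'.mul_const _).sub (hf'.mul_const _)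
    have hden : HasDerivAt (fun k' => f k' * f k + g k' * g k)
        (deriv f k * f k + deriv g k * g k) k := (hf'.mul_const _).add (hg'.mul_const _)
    have hD2 : f k * f k + g k * g k ≠ 0 := by nlinarith
    have hq := (hnum.div hden hD2).arctan
    have hq2 : HasDerivAt (fun k' => pruferAngle V k T +
        Real.arctan ((g k' * f k - f k' * g k) / (f k' * f k + g k' * g k)))
        ((deriv g k * f k - deriv f k * g k) / (f k ^ 2 + g k ^ 2)) k := by
      refine (hq.const_add (pruferAngle V k T)).congr_deriv ?_
      have e0 : g k * f k - f k * g k = 0 := by ring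
      have hD3 : f k ^ 2 + g k ^ 2 ≠ 0 := hD.ne'
      simp only [Pi.div_apply, e0, zero_div, zero_mul, sub_zero]
      rw [show f k * f k + g k * g k = f k ^ 2 + g k ^ 2 by ring]
      field_simp
      ring
    have hθ : HasDerivAt (fun k' => pruferAngle V k' T)
        ((deriv g k * f k - deriv f k * g k) / (f k ^ 2 + g k ^ 2)) k := by
      refine hq2.congr_of_eventuallyEq ?_
      have hcont := hV.prufer_continuousAt_param hk hT
      have hnear := hcont.eventually (Metric.ball_mem_nhds _ (half_pos Real.pi_pos))
      filter_upwards [hnear, Ioi_mem_nhds hk] with k' hk1 hk2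
      rw [Real.dist_eq, abs_lt] at hk1
      obtain ⟨B, hB, h1, h2⟩ := prufer_polar hT hVi hV.nonneg hk
      obtain ⟨B', hB', h1', h2'⟩ := prufer_polar hT hVi hV.nonneg hk2
      have e1 : g k' * f k - f k' * g k =
          (B' * B) * Real.sin (pruferAngle V k' T - pruferAngle V k T) := by
        simp only [hf, hg]; rw [h1, h2, h1', h2', Real.sin_sub]; ring
      have e2 : f k' * f k + g k' * g k =
          (B' * B) * Real.cos (pruferAngle V k' T - pruferAngle V k T) := by
        simp only [hf, hg]; rw [h1, h2, h1', h2', Real.cos_sub]; ring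
      rw [e1, e2, mul_div_mul_left _ _ (mul_ne_zero hB' hB), ← Real.tan_eq_sin_div_cos,
        Real.arctan_tan hk1.1 hk1.2]
      ring
    exact (hθ.sub ((hasDerivAt_id k).mul_const T)).congr_deriv (by ring)

/-- `f` is differentiable on `s` uniformly and up to an arbitrarily small multiple of the
increment. -/
def AlmostUniformlyDifferentiableOn (f : ℝ → ℝ) (s : Set ℝ) : Prop :=
  ∀ η > 0, ∃ ρ > 0, ∃ C : ℝ, ∃ D : ℝ → ℝ, (∀ x ∈ s, |D x| ≤ C) ∧
    ∀ x ∈ s, ∀ y ∈ s, |y - x| < ρ → |f y - f x - D x * (y - x)| ≤ η * |y - x|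

theorem IsShortRange.phaseShift_almostUniformlyDifferentiableOn (hV : IsShortRange V) {ε K : ℝ}
    (hε : 0 < ε) : AlmostUniformlyDifferentiableOn (phaseShift V) (Icc ε K) := by
  intro η hη
  have hK := hV.pruferLipConst_pos
  have hlim : Tendsto (fun T => (1 + 4 * pruferLipConst V) * weightTail V T) atTop (𝓝 0) := by
    simpa using hV.tendsto_weightTail.const_mul (1 + 4 * pruferLipConst V)
  obtain ⟨T, hT1, hT0⟩ := ((hlim.eventually (gt_mem_nhds (half_pos hη))).and
    (eventually_ge_atTop 0)).exists
  obtain ⟨D, hDc, hD⟩ := hV.exists_hasDerivAt_phaseAt hT0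
  have hsub : Icc ε K ⊆ Ioi 0 := fun x hx => hε.trans_le hx.1
  have hDc' := hDc.mono hsub
  obtain ⟨C, hC⟩ := isCompact_Icc.exists_bound_of_continuousOn hDc'
  have hU := isCompact_Icc.uniformContinuousOn_of_continuous hDc'
  obtain ⟨ρ, hρ, hρ'⟩ := Metric.uniformContinuousOn_iff.1 hU (η / 2) (half_pos hη)
  refine ⟨ρ, hρ, C, D, hC, fun x hx y hy hxy => ?_⟩
  have h1 : |(phaseShift V y - phaseShift V x) - (phaseAt V T y - phaseAt V T x)| ≤
      η / 2 * |y - x| := by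
    rcases le_total x y with h | h
    · have := hV.abs_phase_increment_le (hsub hx) h hT0
      have h2 := sub_nonneg.2 h
      rw [abs_of_nonneg h2]
      nlinarith
    · have := hV.abs_phase_increment_le (hsub hy) h hT0
      have h2 := sub_nonneg.2 h
      rw [abs_sub_comm y, abs_of_nonneg h2]
      rw [show (phaseShift V y - phaseShift V x) - (phaseAt V T y - phaseAt V T x) =
        -((phaseShift V x - phaseShift V y) - (phaseAt V T x - phaseAt V T y)) by ring, abs_neg]
      nlinarith
  have h2 : |phaseAt V T y - phaseAt V T x - D x * (y - x)| ≤ η / 2 * |y - x| := by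
    have hsub2 : uIcc x y ⊆ Icc ε K := by
      rw [← uIcc_of_le (hx.1.trans hx.2)]
      exact uIcc_subset_uIcc (by rw [uIcc_of_le (hx.1.trans hx.2)]; exact hx)
        (by rw [uIcc_of_le (hx.1.trans hx.2)]; exact hy)
    have := (convex_uIcc x y).norm_image_sub_le_of_norm_hasDerivWithin_le
      (f := fun z => phaseAt V T z - D x * z) (f' := fun z => D z - D x) (C := η / 2)
      (fun z hz => (((hD z (hsub (hsub2 hz))).sub
        ((hasDerivAt_id z).const_mul (D x))).congr_deriv (by ring)).hasDerivWithinAt)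
      (fun z hz => ?_) left_mem_uIcc right_mem_uIcc
    · rw [Real.norm_eq_abs, Real.norm_eq_abs] at this
      convert this using 2
      ring
    · rw [Real.norm_eq_abs, ← Real.dist_eq]
      refine (hρ' z (hsub2 hz) x hx ?_).le
      rw [Real.dist_eq]
      refine lt_of_le_of_lt ?_ hxy
      exact abs_sub_left_of_mem_uIcc hz
  calc |phaseShift V y - phaseShift V x - D x * (y - x)|
      = |((phaseShift V y - phaseShift V x) - (phaseAt V T y - phaseAt V T x)) +
        (phaseAt V T y - phaseAt V T x - D x * (y - x))| := by congr 1; ring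
    _ ≤ _ := (abs_add_le _ _).trans (by linarith)

end

theorem abs_mul_le_mul {a b A B : ℝ} (ha : |a| ≤ A) (hb : |b| ≤ B) : |a * b| ≤ A * B := by
  rw [abs_mul]
  exact mul_le_mul ha hb (abs_nonneg _) ((abs_nonneg _).trans ha)

/-- The bounded and Lipschitz functions on the half-line which are almost uniformly differentiable
on compact subintervals. -/
structure IsTamePhase (δ : ℝ → ℝ) (Λ W : ℝ) : Prop where
  lip : ∀ x, 0 ≤ x → ∀ y, 0 ≤ y → |δ x - δ y| ≤ Λ * |x - y|
  bound : ∀ x, 0 ≤ x → |δ x| ≤ W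
  diff : ∀ ε K, 0 < ε → AlmostUniformlyDifferentiableOn δ (Icc ε K)

/-- The asymptotic expression for the energy difference. -/
noncomputable def energyAsymptotics (δ : ℝ → ℝ) (h x : ℝ) : ℝ :=
  -(2 / Real.pi) * (∫ t in (0 : ℝ)..x, t * δ t) - h / Real.pi * (x * δ x) +
    h / Real.pi ^ 2 * (x * δ x ^ 2)

namespace IsTamePhase
variable {δ : ℝ → ℝ} {Λ W : ℝ}

theorem nonneg (hδ : IsTamePhase δ Λ W) : 0 ≤ Λ ∧ 0 ≤ W := by
  constructor
  · have := (abs_nonneg _).trans (hδ.lip 1 zero_le_one 0 le_rfl)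
    simpa using this
  · exact (abs_nonneg _).trans (hδ.bound 0 le_rfl)

theorem continuousOn (hδ : IsTamePhase δ Λ W) : ContinuousOn δ (Ici 0) := by
  have : LipschitzOnWith Λ.toNNReal δ (Ici 0) :=
    LipschitzOnWith.of_dist_le_mul fun x hx y hy => by
      rw [Real.coe_toNNReal _ hδ.nonneg.1, Real.dist_eq, Real.dist_eq]
      exact hδ.lip x hx y hy
  exact this.continuousOn

theorem intervalIntegrable (hδ : IsTamePhase δ Λ W) {a b : ℝ} (ha : 0 ≤ a) (hb : 0 ≤ b) :
    IntervalIntegrable (fun t => t * δ t) volume a b := by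
  refine ContinuousOn.intervalIntegrable (continuousOn_id.mul (hδ.continuousOn.mono ?_))
  intro x hx
  exact (le_inf ha hb).trans hx.1

theorem step_eq (hδ : IsTamePhase δ Λ W) {a h k ρ : ℝ} (ha : 0 ≤ a) (hh : 0 < h)
    (hk : k = (a + h) - h / Real.pi * ρ) :
    Real.pi * ((k ^ 2 - (a + h) ^ 2) -
      (energyAsymptotics δ h (a + h) - energyAsymptotics δ h a)) =
      (∫ t in a..(a + h), (2 * (t * δ t) - a * δ a - (a + h) * δ (a + h))) +
        2 * h * (a + h) * (δ (a + h) - ρ) + h ^ 2 / Real.pi * (ρ ^ 2 - δ a ^ 2) -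
        h / Real.pi * (a + h) * ((δ (a + h) - δ a) * (δ (a + h) + δ a)) := by
  have hπ := Real.pi_pos
  have h1 : ∫ t in (0 : ℝ)..(a + h), t * δ t =
      (∫ t in (0 : ℝ)..a, t * δ t) + ∫ t in a..(a + h), t * δ t :=
    (intervalIntegral.integral_add_adjacent_intervals (hδ.intervalIntegrable le_rfl ha)
      (hδ.intervalIntegrable ha (by linarith))).symm
  have h2 : ∫ t in a..(a + h), (2 * (t * δ t) - a * δ a - (a + h) * δ (a + h)) =
      2 * (∫ t in a..(a + h), t * δ t) - h * (a * δ a) - h * ((a + h) * δ (a + h)) := by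
    have hi := (hδ.intervalIntegrable ha (by linarith : 0 ≤ a + h)).const_mul 2
    rw [intervalIntegral.integral_sub (hi.sub intervalIntegrable_const) intervalIntegrable_const,
      intervalIntegral.integral_sub hi intervalIntegrable_const,
      intervalIntegral.integral_const_mul, intervalIntegral.integral_const,
      intervalIntegral.integral_const]
    simp only [smul_eq_mul]; ring
  rw [h2, hk, energyAsymptotics, energyAsymptotics, h1]
  field_simp
  ring

theorem abs_step_le (hδ : IsTamePhase δ Λ W) {a h k ρ τ K : ℝ} (ha : 0 ≤ a) (hh : 0 < h)
    (hK : a + h ≤ K) (hk : k = (a + h) - h / Real.pi * ρ) (hρ0 : ρ ≤ 0) (hρ : |ρ| ≤ W)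
    (hτ : |ρ - δ k| ≤ τ) :
    |(k ^ 2 - (a + h) ^ 2) - (energyAsymptotics δ h (a + h) - energyAsymptotics δ h a)| ≤
      (2 * (W + K * Λ) + 4 * K * Λ * W + 2 * W ^ 2) * h ^ 2 + 2 * h * K * τ := by
  have hπ := Real.pi_gt_three
  obtain ⟨hΛ, hW⟩ := hδ.nonneg
  have hκ : 0 ≤ a + h := by linarith
  have hK0 : 0 ≤ K := hκ.trans hK
  have hτ0 : 0 ≤ τ := (abs_nonneg _).trans hτ
  set E := (k ^ 2 - (a + h) ^ 2) - (energyAsymptotics δ h (a + h) - energyAsymptotics δ h a)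
  have hE : |E| ≤ |Real.pi * E| := by
    rw [abs_mul, abs_of_pos Real.pi_pos]
    nlinarith [abs_nonneg E]
  have hkκ : |(a + h) - k| ≤ h * W := by
    rw [hk, show a + h - (a + h - h / Real.pi * ρ) = h / Real.pi * ρ by ring]
    refine abs_mul_le_mul ?_ hρ
    rw [abs_of_pos (by positivity)]
    exact div_le_self hh.le (by linarith)
  have hk0 : 0 ≤ k := by
    rw [hk]
    have : 0 ≤ h / Real.pi * (-ρ) := mul_nonneg (by positivity) (by linarith)
    linarith
  have b1 : |∫ t in a..(a + h), (2 * (t * δ t) - a * δ a - (a + h) * δ (a + h))| ≤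
      2 * (W + K * Λ) * h * h := by
    have := intervalIntegral.norm_integral_le_of_norm_le_const (a := a) (b := a + h)
      (f := fun t => 2 * (t * δ t) - a * δ a - (a + h) * δ (a + h)) (C := 2 * (W + K * Λ) * h)
      fun t ht => by
        rw [uIoc_of_le (by linarith)] at ht
        have ht0 : 0 ≤ t := ha.trans ht.1.le
        have e : 2 * (t * δ t) - a * δ a - (a + h) * δ (a + h) =
          ((t - a) * δ t + a * (δ t - δ a)) +
          ((t - (a + h)) * δ t + (a + h) * (δ t - δ (a + h))) := by ring
        rw [e, Real.norm_eq_abs]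
        have c1 : |t - a| ≤ h := by rw [abs_of_pos (by linarith [ht.1])]; linarith [ht.2]
        have c2 : |t - (a + h)| ≤ h := by rw [abs_of_nonpos (by linarith [ht.2])]; linarith [ht.1]
        have d1 := abs_mul_le_mul c1 (hδ.bound t ht0)
        have d2 := abs_mul_le_mul c2 (hδ.bound t ht0)
        have d3 := abs_mul_le_mul (show |a| ≤ K by rw [abs_of_nonneg ha]; linarith)
          ((hδ.lip t ht0 a ha).trans (mul_le_mul_of_nonneg_left c1 hΛ))
        have d4 := abs_mul_le_mul (show |a + h| ≤ K by rw [abs_of_nonneg hκ]; linarith)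
          ((hδ.lip t ht0 _ hκ).trans (mul_le_mul_of_nonneg_left c2 hΛ))
        refine (abs_add_le _ _).trans ?_
        have e1 := abs_add_le ((t - a) * δ t) (a * (δ t - δ a))
        have e2 := abs_add_le ((t - (a + h)) * δ t) ((a + h) * (δ t - δ (a + h)))
        linarith
    rwa [Real.norm_eq_abs, show a + h - a = h by ring, abs_of_pos hh] at this
  have b2 : |2 * h * (a + h) * (δ (a + h) - ρ)| ≤ 2 * h * K * (Λ * (h * W) + τ) := by
    refine abs_mul_le_mul ?_ ?_
    · rw [abs_of_nonneg (by positivity)]; gcongr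
    · rw [show δ (a + h) - ρ = (δ (a + h) - δ k) - (ρ - δ k) by ring]
      refine (abs_sub _ _).trans (add_le_add ?_ hτ)
      exact (hδ.lip _ hκ _ hk0).trans (mul_le_mul_of_nonneg_left hkκ hΛ)
  have b3 : |h ^ 2 / Real.pi * (ρ ^ 2 - δ a ^ 2)| ≤ h ^ 2 * (2 * W ^ 2) := by
    refine abs_mul_le_mul ?_ ?_
    · rw [abs_of_nonneg (by positivity)]
      exact div_le_self (by positivity) (by linarith)
    · refine (abs_sub _ _).trans ?_
      rw [abs_pow, abs_pow]
      have := pow_le_pow_left₀ (abs_nonneg _) hρ 2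
      have := pow_le_pow_left₀ (abs_nonneg _) (hδ.bound a ha) 2
      linarith
  have b4 : |h / Real.pi * (a + h) * ((δ (a + h) - δ a) * (δ (a + h) + δ a))| ≤
      h * K * ((Λ * h) * (2 * W)) := by
    refine abs_mul_le_mul (abs_mul_le_mul ?_ ?_) (abs_mul_le_mul ?_ ?_)
    · rw [abs_of_nonneg (by positivity)]
      exact div_le_self hh.le (by linarith)
    · rwa [abs_of_nonneg hκ]
    · have := hδ.lip _ hκ _ ha
      rwa [show a + h - a = h by ring, abs_of_pos hh] at this
    · refine (abs_add_le _ _).trans ?_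
      linarith [hδ.bound a ha, hδ.bound _ hκ]
  refine hE.trans ?_
  rw [hδ.step_eq ha hh hk]
  refine (abs_sub _ _).trans ?_
  have e1 := abs_add_le ((∫ t in a..(a + h), (2 * (t * δ t) - a * δ a - (a + h) * δ (a + h))) +
    2 * h * (a + h) * (δ (a + h) - ρ)) (h ^ 2 / Real.pi * (ρ ^ 2 - δ a ^ 2))
  have e2 := abs_add_le (∫ t in a..(a + h), (2 * (t * δ t) - a * δ a - (a + h) * δ (a + h)))
    (2 * h * (a + h) * (δ (a + h) - ρ))
  linarith

theorem abs_step_le_of_diff (hδ : IsTamePhase δ Λ W) {a h k ρ σ K d C η : ℝ} (ha : 0 ≤ a)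
    (hh : 0 < h) (hK : a + h ≤ K) (hk : k = (a + h) - h / Real.pi * ρ) (hρ0 : ρ ≤ 0)
    (hρ : |ρ| ≤ W) (hσ : |ρ - δ k| ≤ σ * h) (hη : 0 ≤ η) (hd : |d| ≤ C)
    (hdk : |δ k - δ (a + h) - d * (k - (a + h))| ≤ η * |k - (a + h)|)
    (hda : ∀ t ∈ Icc a (a + h), |δ t - δ (a + h) - d * (t - (a + h))| ≤ η * |t - (a + h)|) :
    |(k ^ 2 - (a + h) ^ 2) - (energyAsymptotics δ h (a + h) - energyAsymptotics δ h a)| ≤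
      (3 * K + 4 * K * W) * η * h ^ 2 + 2 * K * σ * h ^ 2 +
        (C + K * C * (2 * σ + 2 * Λ * W + Λ) + 2 * W * (σ + Λ * W + Λ)) * h ^ 3 := by
  have hπ := Real.pi_gt_three
  obtain ⟨hΛ, hW⟩ := hδ.nonneg
  have hκ : 0 ≤ a + h := by linarith
  have hK0 : 0 ≤ K := hκ.trans hK
  have hC0 : 0 ≤ C := (abs_nonneg _).trans hd
  set E := (k ^ 2 - (a + h) ^ 2) - (energyAsymptotics δ h (a + h) - energyAsymptotics δ h a)
  have hE : |E| ≤ |Real.pi * E| := by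
    rw [abs_mul, abs_of_pos Real.pi_pos]
    nlinarith [abs_nonneg E]
  have hhπ : |h / Real.pi| ≤ h := by
    rw [abs_of_nonneg (by positivity)]; exact div_le_self hh.le (by linarith)
  have hkκ : |k - (a + h)| ≤ h * W := by
    rw [hk, show a + h - h / Real.pi * ρ - (a + h) = -(h / Real.pi * ρ) by ring, abs_neg]
    exact abs_mul_le_mul hhπ hρ
  have hk0 : 0 ≤ k := by
    rw [hk]
    have : 0 ≤ h / Real.pi * (-ρ) := mul_nonneg (by positivity) (by linarith)
    linarith
  have haK : |a| ≤ K := by rw [abs_of_nonneg ha]; linarith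
  have hκK : |a + h| ≤ K := by rwa [abs_of_nonneg hκ]
  set r₁ := δ k - δ (a + h) - d * (k - (a + h)) with hr₁
  set r₂ := δ a - δ (a + h) - d * (a - (a + h)) with hr₂
  have br₁ : |r₁| ≤ η * (h * W) := hdk.trans (mul_le_mul_of_nonneg_left hkκ hη)
  have hsub : |a - (a + h)| = h := by
    rw [show a - (a + h) = -h by ring, abs_neg, abs_of_pos hh]
  have br₂ : |r₂| ≤ η * h := by
    have := hda a ⟨le_rfl, by linarith⟩
    rwa [hsub] at this
  have lk : |δ k - δ (a + h)| ≤ Λ * (h * W) :=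
    (hδ.lip _ hk0 _ hκ).trans (mul_le_mul_of_nonneg_left hkκ hΛ)
  have la : |δ a - δ (a + h)| ≤ Λ * h := by
    have := hδ.lip a ha _ hκ
    rwa [hsub] at this
  -- the trapezoidal rule
  have hT : ∫ t in a..(a + h), (2 * (t * δ t) - a * δ a - (a + h) * δ (a + h)) =
      (∫ t in a..(a + h), 2 * t * (δ t - δ (a + h) - d * (t - (a + h)))) - d * h ^ 3 / 3 -
        h * (a * r₂) := by
    have hi := (hδ.intervalIntegrable ha hκ).const_mul 2
    have hp : IntervalIntegrable (fun t => 2 * t * (δ (a + h) + d * (t - (a + h)))) volume a (a + h) :=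
      (by fun_prop : Continuous fun t => 2 * t * (δ (a + h) + d * (t - (a + h)))).intervalIntegrable
        _ _
    have e1 : ∫ t in a..(a + h), (2 * (t * δ t) - a * δ a - (a + h) * δ (a + h)) =
        (∫ t in a..(a + h), 2 * (t * δ t)) - h * (a * δ a) - h * ((a + h) * δ (a + h)) := by
      rw [intervalIntegral.integral_sub (hi.sub intervalIntegrable_const) intervalIntegrable_const,
        intervalIntegral.integral_sub hi intervalIntegrable_const, intervalIntegral.integral_const,
        intervalIntegral.integral_const]
      simp only [smul_eq_mul]; ring
    have e2 : ∫ t in a..(a + h), 2 * t * (δ t - δ (a + h) - d * (t - (a + h))) =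
        (∫ t in a..(a + h), 2 * (t * δ t)) -
          ∫ t in a..(a + h), 2 * t * (δ (a + h) + d * (t - (a + h))) := by
      rw [← intervalIntegral.integral_sub hi hp]
      exact intervalIntegral.integral_congr fun t _ => by ring
    have e3 : ∫ t in a..(a + h), 2 * t * (δ (a + h) + d * (t - (a + h))) =
        (fun t => t ^ 2 * (δ (a + h) - d * (a + h)) + 2 / 3 * d * t ^ 3) (a + h) -
        (fun t => t ^ 2 * (δ (a + h) - d * (a + h)) + 2 / 3 * d * t ^ 3) a := by
      refine intervalIntegral.integral_eq_sub_of_hasDerivAt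
        (f := fun t => t ^ 2 * (δ (a + h) - d * (a + h)) + 2 / 3 * d * t ^ 3) (fun t _ => ?_) hp
      refine (((hasDerivAt_pow 2 t).mul_const _).add ((hasDerivAt_pow 3 t).const_mul _)).congr_deriv
        ?_
      push_cast; ring
    rw [e1, e2, e3, hr₂]
    ring
  have b1 : |∫ t in a..(a + h), 2 * t * (δ t - δ (a + h) - d * (t - (a + h)))| ≤
      2 * K * (η * h) * h := by
    have := intervalIntegral.norm_integral_le_of_norm_le_const (a := a) (b := a + h)
      (f := fun t => 2 * t * (δ t - δ (a + h) - d * (t - (a + h)))) (C := 2 * K * (η * h))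
      fun t ht => by
        rw [uIoc_of_le (by linarith)] at ht
        have ht0 : 0 ≤ t := ha.trans ht.1.le
        refine abs_mul_le_mul ?_ ?_
        · rw [abs_of_nonneg (by positivity)]; linarith [ht.2]
        · refine (hda t ⟨ht.1.le, ht.2⟩).trans (mul_le_mul_of_nonneg_left ?_ hη)
          rw [abs_of_nonpos (by linarith [ht.2])]; linarith [ht.1]
    rwa [Real.norm_eq_abs, show a + h - a = h by ring, abs_of_pos hh] at this
  have key : Real.pi * E =
      (∫ t in a..(a + h), 2 * t * (δ t - δ (a + h) - d * (t - (a + h)))) +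
      (-(d * (h ^ 3 / 3))) + (-(h * (a * r₂))) + (-(2 * h * (a + h) * (ρ - δ k))) +
      h / Real.pi * h * (a + h) * (d * (2 * (ρ - δ k) + 2 * (δ k - δ (a + h)) -
        (δ a - δ (a + h)))) + (-(2 * h * (a + h) * r₁)) +
      h / Real.pi * (a + h) * (r₂ * (δ (a + h) + δ a)) +
      h / Real.pi * h * (((ρ - δ k) + (δ k - δ (a + h)) - (δ a - δ (a + h))) * (ρ + δ a)) := by
    rw [hδ.step_eq ha hh hk, hT]
    have e1 : δ (a + h) - ρ = -(ρ - δ k) - r₁ + d * (h / Real.pi * ρ) := by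
      rw [hr₁]; linear_combination (-d) * hk
    have e2 : δ (a + h) - δ a = d * h - r₂ := by rw [hr₂]; ring
    rw [e1, e2]
    ring
  have b2 : |d * (h ^ 3 / 3)| ≤ C * h ^ 3 := by
    refine abs_mul_le_mul hd ?_
    rw [abs_of_nonneg (by positivity)]
    have : 0 ≤ h ^ 3 := by positivity
    linarith
  have b3 : |h * (a * r₂)| ≤ h * (K * (η * h)) :=
    abs_mul_le_mul (abs_of_pos hh).le (abs_mul_le_mul haK br₂)
  have b2h : |2 * h * (a + h)| ≤ 2 * h * K :=
    abs_mul_le_mul (abs_of_pos (by positivity)).le hκK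
  have b4 := abs_mul_le_mul b2h hσ
  have b5 : |h / Real.pi * h * (a + h) * (d * (2 * (ρ - δ k) + 2 * (δ k - δ (a + h)) -
        (δ a - δ (a + h))))| ≤ h * h * K * (C * (2 * (σ * h) + 2 * (Λ * (h * W)) + Λ * h)) := by
    refine abs_mul_le_mul (abs_mul_le_mul (abs_mul_le_mul hhπ (abs_of_pos hh).le) hκK)
      (abs_mul_le_mul hd ?_)
    refine (abs_sub _ _).trans (add_le_add ((abs_add_le _ _).trans (add_le_add ?_ ?_)) la)
    · exact abs_mul_le_mul (by norm_num) hσ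
    · exact abs_mul_le_mul (by norm_num) lk
  have b6 := abs_mul_le_mul b2h br₁
  have b7 : |h / Real.pi * (a + h) * (r₂ * (δ (a + h) + δ a))| ≤ h * K * (η * h * (2 * W)) := by
    refine abs_mul_le_mul (abs_mul_le_mul hhπ hκK) (abs_mul_le_mul br₂ ?_)
    refine (abs_add_le _ _).trans ?_
    linarith [hδ.bound a ha, hδ.bound _ hκ]
  have b8 : |h / Real.pi * h * (((ρ - δ k) + (δ k - δ (a + h)) - (δ a - δ (a + h))) * (ρ + δ a))| ≤
      h * h * ((σ * h + Λ * (h * W) + Λ * h) * (2 * W)) := by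
    refine abs_mul_le_mul (abs_mul_le_mul hhπ (abs_of_pos hh).le) (abs_mul_le_mul ?_ ?_)
    · exact (abs_sub _ _).trans (add_le_add ((abs_add_le _ _).trans (add_le_add hσ lk)) la)
    · refine (abs_add_le _ _).trans ?_
      linarith [hδ.bound a ha]
  refine hE.trans ?_
  rw [key]
  refine (abs_add_le _ _).trans ((add_le_add ((abs_add_le _ _).trans (add_le_add
    ((abs_add_le _ _).trans (add_le_add ((abs_add_le _ _).trans (add_le_add
    ((abs_add_le _ _).trans (add_le_add ((abs_add_le _ _).trans (add_le_add
    ((abs_add_le _ _).trans (add_le_add b1 ((abs_neg _).trans_le b2))) ((abs_neg _).trans_le b3)))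
    ((abs_neg _).trans_le b4))) b5)) ((abs_neg _).trans_le b6))) b7)) b8).trans ?_)
  have e : (3 * K + 4 * K * W) * η * h ^ 2 + 2 * K * σ * h ^ 2 +
        (C + K * C * (2 * σ + 2 * Λ * W + Λ) + 2 * W * (σ + Λ * W + Λ)) * h ^ 3 =
    2 * K * (η * h) * h + C * h ^ 3 + h * (K * (η * h)) + 2 * h * K * (σ * h) +
      h * h * K * (C * (2 * (σ * h) + 2 * (Λ * (h * W)) + Λ * h)) + 2 * h * K * (η * (h * W)) +
      h * K * (η * h * (2 * W)) + h * h * ((σ * h + Λ * (h * W) + Λ * h) * (2 * W)) := by ring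
  exact e.ge

end IsTamePhase

namespace IsTamePhase
variable {δ : ℝ → ℝ} {Λ W : ℝ}

/-- The sum of the squares of the perturbed wave numbers. -/
theorem abs_sum_sub_le (hδ : IsTamePhase δ Λ W) {K β : ℝ} (hK : 0 < K) (hβ : 0 < β) :
    ∃ h₀ > 0, ∃ σ > 0, ∀ h, 0 < h → h < h₀ → ∀ N : ℕ, N * h ≤ K → ∀ k ρ : ℕ → ℝ,
      (∀ n ∈ Finset.Icc 1 N, k n = n * h - h / Real.pi * ρ n ∧ ρ n ≤ 0 ∧ |ρ n| ≤ W ∧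
        |ρ n - δ (k n)| ≤ σ * h) →
      |∑ n ∈ Finset.Icc 1 N, (k n ^ 2 - (n * h) ^ 2) - energyAsymptotics δ h (N * h)| ≤ β * h := by
  have hπ := Real.pi_gt_three
  obtain ⟨hΛ, hW⟩ := hδ.nonneg
  set A := 2 * (W + K * Λ) + 4 * K * Λ * W + 2 * W ^ 2 + 2 * K with hA
  have hA0 : 0 < A := by positivity
  set ε := β / (4 * A) with hε
  have hε0 : 0 < ε := by positivity
  have hεA : 2 * ε * A = β / 2 := by rw [hε]; field_simp; norm_num
  set M := K * (3 * K + 4 * K * W) with hM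
  have hM0 : 0 < M := by positivity
  set η := β / (8 * M) with hη
  have hη0 : 0 < η := by positivity
  have hηM : M * η = β / 8 := by rw [hη]; field_simp
  obtain ⟨r, hr, C₀, D, hD, hDd⟩ := hδ.diff ε (K + W) hε0 η hη0
  set C := |C₀| with hC
  set σ := min 1 (β / (16 * K ^ 2)) with hσ
  have hσ0 : 0 < σ := lt_min one_pos (by positivity)
  have hσ1 : σ ≤ 1 := min_le_left _ _
  have hσK : 2 * K ^ 2 * σ ≤ β / 8 := by
    have : σ ≤ β / (16 * K ^ 2) := min_le_right _ _
    calc 2 * K ^ 2 * σ ≤ 2 * K ^ 2 * (β / (16 * K ^ 2)) := by gcongr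
      _ = β / 8 := by field_simp; norm_num
  set Q := K * (C + K * C * (2 * σ + 2 * Λ * W + Λ) + 2 * W * (σ + Λ * W + Λ)) with hQ
  have hQ0 : 0 ≤ Q := by positivity
  refine ⟨min (min 1 ε) (min (r / (W + 1)) (β / (8 * (Q + 1)))), by positivity, σ, hσ0, ?_⟩
  intro h hh hh₀ N hN k ρ hkρ
  have hh1 : h < 1 := hh₀.trans_le ((min_le_left _ _).trans (min_le_left _ _))
  have hhε : h < ε := hh₀.trans_le ((min_le_left _ _).trans (min_le_right _ _))
  have hhr : h * (W + 1) < r := by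
    have := hh₀.trans_le ((min_le_right _ _).trans (min_le_left _ _))
    rwa [lt_div_iff₀ (by positivity)] at this
  have hhQ : Q * h ≤ β / 8 := by
    have := hh₀.trans_le ((min_le_right _ _).trans (min_le_right _ _))
    rw [lt_div_iff₀ (by positivity)] at this
    nlinarith
  -- telescoping
  have htel : energyAsymptotics δ h (N * h) = ∑ n ∈ Finset.Icc 1 N,
      (energyAsymptotics δ h (n * h) - energyAsymptotics δ h ((n - 1 : ℕ) * h)) := by
    clear hN hkρ
    induction N with
    | zero => simp [energyAsymptotics]
    | succ N ih => rw [Finset.sum_Icc_succ_top (by omega), ← ih]; simp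
  rw [htel, ← Finset.sum_sub_distrib]
  refine (Finset.abs_sum_le_sum_abs _ _).trans ?_
  have hstep : ∀ n ∈ Finset.Icc 1 N,
      |k n ^ 2 - (n * h) ^ 2 - (energyAsymptotics δ h (n * h) -
        energyAsymptotics δ h ((n - 1 : ℕ) * h))| ≤
      (if (n : ℝ) * h ≤ 2 * ε then A * h ^ 2 else 0) +
        (M * η + 2 * K ^ 2 * σ + Q * h) / K * h ^ 2 := by
    intro n hn
    obtain ⟨e1, e2, e3, e4⟩ := hkρ n hn
    rw [Finset.mem_Icc] at hn
    have hcast : ((n - 1 : ℕ) : ℝ) * h + h = n * h := by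
      rw [Nat.cast_sub hn.1]; push_cast; ring
    set a := ((n - 1 : ℕ) : ℝ) * h with ha
    have ha0 : 0 ≤ a := by positivity
    have hnN : (n : ℝ) * h ≤ K := le_trans (by gcongr; exact hn.2) hN
    rw [← hcast] at e1 hnN ⊢
    split_ifs with hcase
    · have h1 := hδ.abs_step_le ha0 hh hnN e1 e2 e3 e4
      have h2 : 0 ≤ (M * η + 2 * K ^ 2 * σ + Q * h) / K * h ^ 2 := by positivity
      have h3 : K * h ^ 2 * σ ≤ K * h ^ 2 * 1 := by gcongr
      have h4 : A * h ^ 2 = (2 * (W + K * Λ) + 4 * K * Λ * W + 2 * W ^ 2) * h ^ 2 +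
        2 * (K * h ^ 2 * 1) := by rw [hA]; ring
      linarith
    · push Not at hcase
      have hhπ : h / Real.pi ≤ h := div_le_self hh.le (by linarith)
      have hkκ : |k n - (a + h)| ≤ h * W := by
        rw [e1, show a + h - h / Real.pi * ρ n - (a + h) = -(h / Real.pi * ρ n) by ring, abs_neg]
        exact abs_mul_le_mul (by rw [abs_of_nonneg (by positivity)]; exact hhπ) e3
      have hhW : h * W ≤ W := mul_le_of_le_one_left hW hh1.le
      have hhW0 : 0 ≤ h * W := by positivity
      have hkge : a + h ≤ k n := by
        have : 0 ≤ h / Real.pi * (-ρ n) := mul_nonneg (by positivity) (by linarith)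
        linarith
      have hmem : a + h ∈ Icc ε (K + W) := ⟨by linarith, by linarith⟩
      have hkmem : k n ∈ Icc ε (K + W) := ⟨by linarith, by linarith [(abs_le.1 hkκ).2]⟩
      have h1 := hδ.abs_step_le_of_diff (C := C) ha0 hh hnN e1 e2 e3 e4 hη0.le
        ((hD _ hmem).trans (le_abs_self _)) (hDd _ hmem _ hkmem (by linarith))
        (fun t ht => hDd _ hmem _ ⟨by linarith [ht.1], by linarith [ht.2]⟩ (by
          rw [abs_of_nonpos (by linarith [ht.2])]
          linarith [ht.1]))
      rw [zero_add]
      refine h1.trans (le_of_eq ?_)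
      rw [hM, hQ]; field_simp
  refine (Finset.sum_le_sum hstep).trans ?_
  rw [Finset.sum_add_distrib, ← Finset.sum_filter, Finset.sum_const, Finset.sum_const,
    nsmul_eq_mul, nsmul_eq_mul, Nat.card_Icc, Nat.add_sub_cancel]
  have hcard : ((Finset.filter (fun n : ℕ => (n : ℝ) * h ≤ 2 * ε) (Finset.Icc 1 N)).card : ℝ) * h ≤
      2 * ε := by
    have h1 : Finset.filter (fun n : ℕ => (n : ℝ) * h ≤ 2 * ε) (Finset.Icc 1 N) ⊆
        Finset.Icc 1 ⌊2 * ε / h⌋₊ := by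
      intro n hn
      rw [Finset.mem_filter, Finset.mem_Icc] at hn
      rw [Finset.mem_Icc]
      exact ⟨hn.1.1, Nat.le_floor (by rw [le_div_iff₀ hh]; exact hn.2)⟩
    have h2 := Finset.card_le_card h1
    rw [Nat.card_Icc, Nat.add_sub_cancel] at h2
    have h3 : ((Finset.filter (fun n : ℕ => (n : ℝ) * h ≤ 2 * ε) (Finset.Icc 1 N)).card : ℝ) ≤
        2 * ε / h := le_trans (by exact_mod_cast h2) (Nat.floor_le (by positivity))
    rwa [le_div_iff₀ hh] at h3
  have t1 := mul_le_mul_of_nonneg_right hcard (by positivity : 0 ≤ A * h)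
  have t2 : (N : ℝ) * ((M * η + 2 * K ^ 2 * σ + Q * h) / K * h ^ 2) ≤
      (β / 8 + β / 8 + β / 8) * h := by
    have : (N : ℝ) * ((M * η + 2 * K ^ 2 * σ + Q * h) / K * h ^ 2) =
      (N * h) * ((M * η + 2 * K ^ 2 * σ + Q * h) / K * h) := by ring
    rw [this]
    calc _ ≤ K * ((M * η + 2 * K ^ 2 * σ + Q * h) / K * h) := by gcongr
      _ = (M * η + 2 * K ^ 2 * σ + Q * h) * h := by field_simp
      _ ≤ _ := by gcongr; exact hηM.le
  have t3 : 2 * ε * (A * h) = β / 2 * h := by rw [← hεA]; ring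
  have t4 := mul_pos hβ hh
  linarith

end IsTamePhase

/-- The phase shift of a short-range potential satisfies the regularity requirements. -/
theorem IsShortRange.isTamePhase {V : ℝ → ℝ} (hV : IsShortRange V) :
    IsTamePhase (phaseShift V) (phaseLipConst V + weightTail V 0) (weightTail V 0) := by
  have h0 : phaseShift V 0 = 0 := by simp [phaseShift]
  have hW := hV.weightTail_nonneg 0
  have hL := hV.phaseLipConst_nonneg
  refine ⟨fun x hx y hy => ?_, fun x hx => ?_,
    fun ε K hε => hV.phaseShift_almostUniformlyDifferentiableOn hε⟩
  · rcases hx.eq_or_lt with rfl | hx' <;> rcases hy.eq_or_lt with rfl | hy'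
    · simp
    · have := (hV.abs_phaseShift_le hy').1
      rw [h0, zero_sub, zero_sub, abs_neg, abs_neg, abs_of_pos hy']
      nlinarith
    · have := (hV.abs_phaseShift_le hx').1
      rw [h0, sub_zero, sub_zero, abs_of_pos hx']
      nlinarith
    · have := hV.phaseShift_lipschitz hy' hx'
      have h2 : 0 ≤ weightTail V 0 * |x - y| := by positivity
      linarith
  · rcases hx.eq_or_lt with rfl | hx'
    · simpa [h0] using hW
    · exact hV.abs_phaseShift_le_const hx'

section Positivity
variable {V : ℝ → ℝ} {b s : ℝ}

/-- Below the spectrum the regular solution is increasing and convex. -/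
theorem realSol_ge (hb : 0 ≤ b) (hV : IntervalIntegrable V volume 0 b) (hVnn : ∀ x, 0 ≤ V x)
    (hs : s ≤ 0) : (∀ x ∈ Icc 0 b, x ≤ realSol V s x) ∧ ∀ x ∈ Icc 0 b, 1 ≤ realSolD V s x := by
  have hu := realSol_hasACDeriv hb hV s
  have hv := realSolD_hasACDeriv hb hV s
  obtain ⟨huc, hvc⟩ := realSol_continuousOn hb hV s
  have hsub : ∀ x y, 0 ≤ x → x ≤ y → y ≤ b → uIcc x y ⊆ uIcc 0 b := fun x y h0 hxy hy => by
    rw [uIcc_of_le hxy, uIcc_of_le hb]; exact Icc_subset_Icc h0 hy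
  have h1 : ∀ x ∈ Icc 0 b, 0 ≤ realSol V s x * realSolD V s x := by
    intro x hx
    have := ((hu.mul hv).mono (hsub 0 x le_rfl hx.1 hx.2)).le_of_nonneg hx.1
      (Eventually.of_forall fun t _ => by
        have h2 : 0 ≤ V t - s := by linarith [hVnn t]
        nlinarith [mul_self_nonneg (realSolD V s t),
          mul_nonneg h2 (mul_self_nonneg (realSol V s t))])
    simpa using this
  have h2 : ∀ x y, 0 ≤ x → x ≤ y → y ≤ b →
      realSol V s x * realSol V s x ≤ realSol V s y * realSol V s y := by
    intro x y h0 hxy hy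
    refine ((hu.mul hu).mono (hsub x y h0 hxy hy)).le_of_nonneg hxy
      (Eventually.of_forall fun t ht => ?_)
    have := h1 t ⟨h0.trans ht.1, ht.2.trans hy⟩
    nlinarith
  have h3 : ∀ x ∈ Icc 0 b, 0 ≤ realSol V s x := by
    by_contra! hneg
    obtain ⟨x, hx, hxneg⟩ := hneg
    have hx0 : 0 < x := lt_of_le_of_ne hx.1 (by rintro rfl; simp at hxneg)
    have hc0 : ∀ᶠ t in 𝓝[Icc 0 b] 0, 1 / 2 < realSolD V s t :=
      (hvc 0 ⟨le_rfl, hb⟩).eventually (lt_mem_nhds (by simp; norm_num))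
    obtain ⟨ε, hε, hεb⟩ := Metric.mem_nhdsWithin_iff.1 hc0
    set y := min x (ε / 2) with hy
    have hy0 : 0 < y := lt_min hx0 (half_pos hε)
    have hyx : y ≤ x := min_le_left _ _
    have hyε : y < ε := (min_le_right _ _).trans_lt (half_lt_self hε)
    have hypos : 0 < realSol V s y := by
      have := ((hu.sub ((HasACDeriv.const (1 / 2 : ℝ)).mul HasACDeriv.id)).mono
        (hsub 0 y le_rfl hy0.le (hyx.trans hx.2))).le_of_nonneg hy0.le
        (Eventually.of_forall fun t ht => by
          have h4 : t ∈ Metric.ball (0 : ℝ) ε ∩ Icc 0 b :=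
            ⟨by rw [Metric.mem_ball, Real.dist_eq, sub_zero, abs_of_nonneg ht.1]; linarith [ht.2],
              ht.1, (ht.2.trans hyx).trans hx.2⟩
          have h5 : 1 / 2 < realSolD V s t := hεb h4
          linarith)
      simp at this
      linarith
    have hcont : ContinuousOn (realSol V s) (Icc y x) :=
      huc.mono (Icc_subset_Icc hy0.le hx.2)
    obtain ⟨z, hz, hz0⟩ := intermediate_value_Icc' hyx hcont ⟨hxneg.le, hypos.le⟩
    have := h2 y z hy0.le hz.1 (hz.2.trans hx.2)
    rw [hz0] at this
    nlinarith
  have h4 : ∀ x ∈ Icc 0 b, 1 ≤ realSolD V s x := by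
    intro x hx
    have := (hv.mono (hsub 0 x le_rfl hx.1 hx.2)).le_of_nonneg hx.1
      (Eventually.of_forall fun t ht => mul_nonneg (by linarith [hVnn t])
        (h3 t ⟨ht.1, ht.2.trans hx.2⟩))
    simpa using this
  refine ⟨fun x hx => ?_, h4⟩
  have := ((hu.sub HasACDeriv.id).mono (hsub 0 x le_rfl hx.1 hx.2)).le_of_nonneg hx.1
    (Eventually.of_forall fun t ht => sub_nonneg.2 (h4 t ⟨ht.1, ht.2.trans hx.2⟩))
  simpa using this

end Positivity

section WaveNumbers
variable {V : ℝ → ℝ} {L : ℝ}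

theorem IsShortRange.phaseAt_bounds (hV : IsShortRange V) {k : ℝ} (hk : 0 < k) {T : ℝ}
    (hT : 0 ≤ T) : phaseAt V T k ≤ 0 ∧ |phaseAt V T k| ≤ weightTail V 0 := by
  have h1 := hV.prufer_le hk hT
  have h2 : phaseAt V T k ≤ 0 := by rw [phaseAt]; linarith
  refine ⟨h2, le_trans ?_ (hV.abs_phaseShift_le_const hk)⟩
  have h3 : phaseShift V k ≤ phaseAt V T k := by
    refine le_of_tendsto (hV.tendsto_phaseShift hk) ?_
    filter_upwards [eventually_ge_atTop T] with S hS
    have h := ((hV.phaseAt_hasACDeriv hk (hT.trans hS)).mono (c := T) (d := S) (by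
      rw [uIcc_of_le hS, uIcc_of_le (hT.trans hS)]; exact Icc_subset_Icc hT le_rfl))
    have h4 := ((HasACDeriv.const (0 : ℝ)).sub h).le_of_nonneg hS (Eventually.of_forall fun t _ => by
      have : 0 ≤ 1 / k * (V t * Real.sin (pruferAngle V k t) ^ 2) :=
        mul_nonneg (by positivity) (mul_nonneg (hV.nonneg t) (sq_nonneg _))
      linarith)
    simp only [phaseAt] at h4 ⊢
    linarith
  rw [abs_of_nonpos h2, abs_of_nonpos (h3.trans h2)]
  linarith

theorem IsShortRange.prufer_strictMono (hV : IsShortRange V) (hL : 0 < L) {k k' : ℝ} (hk : 0 < k)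
    (hkk : k < k') : pruferAngle V k L < pruferAngle V k' L := by
  have h1 := (hV.prufer_sub_bounds hk hkk.le hL.le).1
  have h2 : 0 < (k' - k) * L * Real.exp (-(4 * ∫ x, V x * (1 + x ^ 2))) := by
    have := sub_pos.2 hkk
    positivity
  linarith

theorem IsShortRange.exists_waveNumber (hV : IsShortRange V) (hL : 0 < L) {n : ℕ} (hn : 1 ≤ n) :
    ∃ k, 0 < k ∧ pruferAngle V k L = n * Real.pi := by
  have hπ := Real.pi_pos
  have hn0 : (0 : ℝ) < n := by exact_mod_cast hn
  have hW := hV.weightTail_nonneg 0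
  have ha : 0 < n * Real.pi / L := by positivity
  have hab : n * Real.pi / L ≤ (n * Real.pi + weightTail V 0) / L := by gcongr; linarith
  have hb := ha.trans_le hab
  have hc : ContinuousOn (fun k => pruferAngle V k L)
      (Icc (n * Real.pi / L) ((n * Real.pi + weightTail V 0) / L)) := fun k hk =>
    (hV.prufer_continuousAt_param (ha.trans_le hk.1) hL.le).continuousWithinAt
  obtain ⟨k, hk, hk'⟩ := intermediate_value_Icc hab hc (show n * Real.pi ∈ _ by
    constructor
    · refine (hV.prufer_le ha hL.le).trans (le_of_eq ?_)
      field_simp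
    · have := (abs_le.1 (hV.phaseAt_bounds hb hL.le).2).1
      rw [phaseAt, div_mul_cancel₀ _ hL.ne'] at this
      linarith)
  exact ⟨k, ha.trans_le hk.1, hk'⟩

/-- The `n`-th wave number of the Dirichlet problem on `(0, L)`, for `n ≥ 1`. -/
noncomputable def waveNumber (V : ℝ → ℝ) (L : ℝ) (n : ℕ) : ℝ :=
  sSup {k | 0 < k ∧ pruferAngle V k L = n * Real.pi}

theorem IsShortRange.waveNumber_spec (hV : IsShortRange V) (hL : 0 < L) {n : ℕ} (hn : 1 ≤ n) :
    0 < waveNumber V L n ∧ pruferAngle V (waveNumber V L n) L = n * Real.pi := by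
  obtain ⟨k, hk, hk'⟩ := hV.exists_waveNumber hL hn
  have : {k | 0 < k ∧ pruferAngle V k L = n * Real.pi} = {k} := by
    ext k₁
    simp only [mem_ofPred_eq, mem_singleton_iff]
    refine ⟨fun h => ?_, fun h => h ▸ ⟨hk, hk'⟩⟩
    rcases lt_trichotomy k₁ k with h1 | h1 | h1
    · have := hV.prufer_strictMono hL h.1 h1
      linarith [h.2]
    · exact h1
    · have := hV.prufer_strictMono hL hk h1
      linarith [h.2]
  rw [waveNumber, this, csSup_singleton]
  exact ⟨hk, hk'⟩

theorem IsShortRange.waveNumber_strictMono (hV : IsShortRange V) (hL : 0 < L) {m n : ℕ}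
    (hm : 1 ≤ m) (hmn : m < n) : waveNumber V L m < waveNumber V L n := by
  obtain ⟨h1, h2⟩ := hV.waveNumber_spec hL hm
  obtain ⟨h3, h4⟩ := hV.waveNumber_spec hL (hm.trans hmn.le)
  by_contra! h
  have h5 : pruferAngle V (waveNumber V L n) L ≤ pruferAngle V (waveNumber V L m) L := by
    rcases h.eq_or_lt with h | h
    · rw [h]
    · exact (hV.prufer_strictMono hL h3 h).le
  rw [h2, h4] at h5
  have h6 : (m : ℝ) < n := by exact_mod_cast hmn
  nlinarith [Real.pi_pos]

/-- The Dirichlet eigenvalues are the squares of the wave numbers. -/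
theorem IsShortRange.realSol_eq_zero_iff (hV : IsShortRange V) (hL : 0 < L) (s : ℝ) :
    realSol V s L = 0 ↔ ∃ n : ℕ, 1 ≤ n ∧ s = waveNumber V L n ^ 2 := by
  have hVi := hV.intervalIntegrable 0 L
  have hmem : L ∈ Icc 0 L := ⟨hL.le, le_rfl⟩
  constructor
  · intro h
    have hs : 0 < s := by
      by_contra! hs
      have := (realSol_ge hL.le hVi hV.nonneg hs).1 L hmem
      linarith
    have hk : 0 < √s := Real.sqrt_pos.2 hs
    have hk2 : √s ^ 2 = s := Real.sq_sqrt hs.le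
    rw [← hk2, ← prufer_sin_eq_zero_iff hL.le hVi hV.nonneg hk] at h
    obtain ⟨m, hm⟩ := Real.sin_eq_zero_iff.1 h
    have hpos := hV.prufer_pos hk hL
    have hm0 : 0 < m := by
      by_contra! hm0
      have : (m : ℝ) ≤ 0 := by exact_mod_cast hm0
      nlinarith [Real.pi_pos]
    lift m to ℕ using hm0.le
    have hm1 : 1 ≤ m := by exact_mod_cast hm0
    refine ⟨m, hm1, ?_⟩
    obtain ⟨h3, h4⟩ := hV.waveNumber_spec hL hm1
    rw [← hk2]
    push_cast at hm
    rcases lt_trichotomy (√s) (waveNumber V L m) with h1 | h1 | h1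
    · have := hV.prufer_strictMono hL hk h1
      linarith
    · rw [h1]
    · have := hV.prufer_strictMono hL h3 h1
      linarith
  · rintro ⟨n, hn, rfl⟩
    obtain ⟨h3, h4⟩ := hV.waveNumber_spec hL hn
    rw [← prufer_sin_eq_zero_iff hL.le hVi hV.nonneg h3, h4]
    exact Real.sin_nat_mul_pi n

end WaveNumbers

section Eigen
variable {V : ℝ → ℝ} {L : ℝ}

theorem ae_restrict_Ioo_of_ae_uIcc {p : ℝ → Prop} (hL : 0 ≤ L) (h : ∀ᵐ x, x ∈ uIcc 0 L → p x) :
    ∀ᵐ x ∂(volume : Measure ℝ).restrict (Ioo 0 L), p x := by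
  filter_upwards [ae_restrict_of_ae h, ae_restrict_mem measurableSet_Ioo] with x hx hx'
  exact hx (by rw [uIcc_of_le hL]; exact Ioo_subset_Icc_self hx')

theorem ae_uIcc_of_ae_restrict_Ioo {p : ℝ → Prop} (hL : 0 ≤ L)
    (h : ∀ᵐ x ∂(volume : Measure ℝ).restrict (Ioo 0 L), p x) : ∀ᵐ x, x ∈ uIcc 0 L → p x := by
  have h1 : ∀ y : ℝ, ∀ᵐ x : ℝ, x ≠ y := fun y => by simp [ae_iff, measure_singleton]
  filter_upwards [(ae_restrict_iff' measurableSet_Ioo).1 h, h1 0, h1 L] with x hx h0 h2 h3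
  rw [uIcc_of_le hL] at h3
  exact hx ⟨lt_of_le_of_ne h3.1 h0.symm, lt_of_le_of_ne h3.2 h2⟩

theorem mem_opEigenspace_iff (V : ℝ → ℝ) {I : Set ℝ} (hI : IsOpen I) (t : ℝ) (f : L2On I) :
    f ∈ opEigenspace (dirichletSchrodinger V I) t ↔ (f, (t : ℂ) • f) ∈ dirichletGraph V I := by
  rw [opEigenspace, Submodule.mem_comap, dirichletSchrodinger_graph V hI]
  rfl

/-- Eigenfunctions are multiples of the regular solution. -/
theorem IsShortRange.eigen_eq (hV : IsShortRange V) (hL : 0 < L) {t : ℝ} {f : L2On (Ioo 0 L)}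
    (hf : f ∈ opEigenspace (dirichletSchrodinger V (Ioo 0 L)) t) :
    ∃ c : ℂ, (f =ᵐ[(volume : Measure ℝ).restrict (Ioo 0 L)] fun x => c * regSol V t x) ∧
      c * regSol V t L = 0 := by
  rw [mem_opEigenspace_iff V isOpen_Ioo] at hf
  obtain ⟨u, v, h, hu⟩ := hf
  have hcl : closure (Ioo 0 L) = Icc 0 L := closure_Ioo hL.ne
  have hfr : frontier (Ioo 0 L) = {0, L} := frontier_Ioo hL
  have h0 : (0 : ℝ) ∈ closure (Ioo 0 L) := by rw [hcl]; exact ⟨le_rfl, hL.le⟩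
  have hL' : L ∈ closure (Ioo 0 L) := by rw [hcl]; exact ⟨hL.le, le_rfl⟩
  have hsol : IsLinSol (fun x => (V x : ℂ) - t) u v L := by
    refine ⟨⟨h.ac_fst 0 h0 L hL', ?_⟩, ⟨h.ac_snd 0 h0 L hL', ?_⟩⟩
    · refine ae_uIcc_of_ae_restrict_Ioo hL.le ?_
      filter_upwards [ae_restrict_mem measurableSet_Ioo] with x hx using h.deriv_fst x hx
    · refine ae_uIcc_of_ae_restrict_Ioo hL.le ?_
      simp only at h hu
      filter_upwards [h.deriv_snd, hu, Lp.coeFn_smul (t : ℂ) f] with x h1 h2 h3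
      refine h1.congr_deriv ?_
      rw [h3, Pi.smul_apply, h2, smul_eq_mul]
      ring
  have hu0 : u 0 = 0 := h.boundary 0 (by rw [hfr]; simp)
  have huL : u L = 0 := h.boundary L (by rw [hfr]; simp)
  have key := fun x hx => (hsol.eq_regSol hL.le (hV.intervalIntegrable 0 L) hu0 (x := x) hx).1
  refine ⟨v 0, ?_, ?_⟩
  · filter_upwards [hu, ae_restrict_mem measurableSet_Ioo] with x h1 h2
    rw [← key x (Ioo_subset_Icc_self h2), ← h1]
  · rw [← key L ⟨hL.le, le_rfl⟩, huL]

theorem IsShortRange.memLp_regSol (hV : IsShortRange V) (hL : 0 < L) (t : ℝ) :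
    MemLp (regSol V t) 2 ((volume : Measure ℝ).restrict (Ioo 0 L)) := by
  have hc := (regSol_continuousOn hL.le (hV.intervalIntegrable 0 L) t).1
  obtain ⟨C, hC⟩ := isCompact_Icc.exists_bound_of_continuousOn hc
  refine MemLp.of_bound ((hc.mono Ioo_subset_Icc_self).aestronglyMeasurable measurableSet_Ioo) C ?_
  filter_upwards [ae_restrict_mem measurableSet_Ioo] with x hx using hC x (Ioo_subset_Icc_self hx)

/-- The regular solution as an element of `L²(0, L)`. -/
noncomputable def IsShortRange.eigenvector (hV : IsShortRange V) (hL : 0 < L) (t : ℝ) :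
    L2On (Ioo 0 L) := (hV.memLp_regSol hL t).toLp _

theorem IsShortRange.eigenvector_mem (hV : IsShortRange V) (hL : 0 < L) {t : ℝ}
    (ht : realSol V t L = 0) :
    hV.eigenvector hL t ∈ opEigenspace (dirichletSchrodinger V (Ioo 0 L)) t := by
  have hcl : closure (Ioo 0 L) = Icc 0 L := closure_Ioo hL.ne
  have hVi := hV.intervalIntegrable 0 L
  have hsol := regSol_isLinSol hL.le hVi t
  have hcoe := (hV.memLp_regSol hL t).coeFn_toLp
  have hsub : ∀ a ∈ closure (Ioo 0 L), ∀ b ∈ closure (Ioo 0 L), uIcc a b ⊆ uIcc 0 L := by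
    intro a ha b hb
    rw [hcl, ← uIcc_of_le hL.le] at ha hb
    exact uIcc_subset_uIcc ha hb
  rw [mem_opEigenspace_iff V isOpen_Ioo]
  refine ⟨regSol V t, regSolD V t, ⟨fun a ha b hb => (hsol.fst.mono (hsub a ha b hb)).ac,
    fun a ha b hb => (hsol.snd.mono (hsub a ha b hb)).ac, ?_, fun x hx => hsol.hasDerivAt hx, ?_⟩,
    hcoe⟩
  · intro x hx
    rw [frontier_Ioo hL] at hx
    rcases hx with rfl | hx
    · simp
    · rw [mem_singleton_iff.1 hx, (regSol_ofReal hL.le hVi t).1, ht, Complex.ofReal_zero]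
  · filter_upwards [ae_restrict_Ioo_of_ae_uIcc hL.le hsol.snd.hasDerivAt, hcoe,
      Lp.coeFn_smul (t : ℂ) (hV.eigenvector hL t)] with x h1 h2 h3
    refine h1.congr_deriv ?_
    simp only [h3, Pi.smul_apply]
    rw [IsShortRange.eigenvector, h2, smul_eq_mul]
    ring

theorem IsShortRange.eigenvector_ne_zero (hV : IsShortRange V) (hL : 0 < L) (t : ℝ) :
    hV.eigenvector hL t ≠ 0 := by
  intro h
  have hVi := hV.intervalIntegrable 0 L
  have h1 : regSol V t =ᵐ[(volume : Measure ℝ).restrict (Ioo 0 L)] fun _ => (0 : ℂ) := by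
    filter_upwards [(hV.memLp_regSol hL t).coeFn_toLp, Lp.coeFn_zero ℂ 2
      ((volume : Measure ℝ).restrict (Ioo 0 L))] with x h1 h2
    rw [← h1]
    change (hV.eigenvector hL t : ℝ → ℂ) x = 0
    rw [h, h2]; rfl
  have hc := (regSol_continuousOn hL.le hVi t).1.mono Ioo_subset_Icc_self
  have h2 : EqOn (regSol V t) (fun _ => 0) (Ioo 0 L) :=
    Measure.eqOn_open_of_ae_eq h1 isOpen_Ioo hc continuousOn_const
  have hm : L / 2 ∈ Ioo 0 L := ⟨by linarith, by linarith⟩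
  have h3 : HasDerivAt (regSol V t) (regSolD V t (L / 2)) (L / 2) :=
    (regSol_isLinSol hL.le hVi t).hasDerivAt hm
  have h4 : HasDerivAt (regSol V t) 0 (L / 2) := (hasDerivAt_const (L / 2) (0 : ℂ)).congr_of_eventuallyEq
    (h2.eventuallyEq_of_mem (isOpen_Ioo.mem_nhds hm))
  exact regSol_ne_zero hL.le hVi t (Ioo_subset_Icc_self hm) ⟨h2 hm, h3.unique h4⟩

theorem IsShortRange.inner_eigenvector (hV : IsShortRange V) (hL : 0 < L) {s t : ℝ}
    (hs : realSol V s L = 0) (ht : realSol V t L = 0) (hst : s ≠ t) :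
    inner ℂ (hV.eigenvector hL s) (hV.eigenvector hL t) = 0 := by
  have hVi := hV.intervalIntegrable 0 L
  have h1 := (regSol_isLinSol hL.le hVi s).wronskian_integral (regSol_isLinSol hL.le hVi t)
    (c := (s : ℂ) - t) (fun x => by ring) ⟨hL.le, le_rfl⟩
  rw [(regSol_ofReal hL.le hVi s).1, (regSol_ofReal hL.le hVi t).1, hs, ht] at h1
  simp only [Complex.ofReal_zero, zero_mul, mul_zero, sub_zero, regSol_zero, zero_add] at h1
  have hne : (s : ℂ) - t ≠ 0 := sub_ne_zero.2 (by exact_mod_cast hst)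
  have h2 := (mul_eq_zero.1 h1.symm).resolve_left hne
  rw [intervalIntegral.integral_of_le hL.le, integral_Ioc_eq_integral_Ioo] at h2
  rw [L2.inner_def, ← h2]
  refine integral_congr_ae ?_
  filter_upwards [(hV.memLp_regSol hL t).coeFn_toLp, (hV.memLp_regSol hL s).coeFn_toLp,
    ae_restrict_mem measurableSet_Ioo] with x e1 e2 hx
  rw [IsShortRange.eigenvector, IsShortRange.eigenvector, e1, e2]
  have e3 := (regSol_ofReal hx.1.le (hV.intervalIntegrable 0 x) s).1
  rw [e3]
  simp [RCLike.inner_apply, mul_comm]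

theorem IsShortRange.nthEigenvalue_eq (hV : IsShortRange V) (hL : 0 < L) {n : ℕ} (hn : 1 ≤ n) :
    nthEigenvalue (dirichletSchrodinger V (Ioo 0 L)) n = waveNumber V L n ^ 2 := by
  classical
  set A := dirichletSchrodinger V (Ioo 0 L)
  set e : ℕ → L2On (Ioo 0 L) := fun m => hV.eigenvector hL (waveNumber V L m ^ 2) with he
  have hzero : ∀ m, 1 ≤ m → realSol V (waveNumber V L m ^ 2) L = 0 := fun m hm =>
    (hV.realSol_eq_zero_iff hL _).2 ⟨m, hm, rfl⟩
  have hsq : ∀ m m', 1 ≤ m → m < m' → waveNumber V L m ^ 2 < waveNumber V L m' ^ 2 := by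
    intro m m' hm hmm
    have h1 := hV.waveNumber_strictMono hL hm hmm
    have h2 := (hV.waveNumber_spec hL hm).1
    nlinarith
  have hset : {t : ℝ | (n : Cardinal) ≤ Module.rank ℂ
      (⨆ s : Iic t, opEigenspace A (s : ℝ) : Submodule ℂ (L2On (Ioo 0 L)))} =
      Ici (waveNumber V L n ^ 2) := by
    ext t
    simp only [mem_ofPred_eq, mem_Ici]
    constructor
    · intro h
      by_contra! hlt
      have hle : (⨆ s : Iic t, opEigenspace A (s : ℝ)) ≤
          Submodule.span ℂ (((Finset.Ico 1 n).image e : Finset _) : Set (L2On (Ioo 0 L))) := by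
        refine iSup_le fun s f hf => ?_
        obtain ⟨c, hc, hcL⟩ := hV.eigen_eq hL hf
        have hfe : f = c • hV.eigenvector hL (s : ℝ) := by
          refine Lp.ext ?_
          filter_upwards [hc, Lp.coeFn_smul c (hV.eigenvector hL (s : ℝ)),
            (hV.memLp_regSol hL (s : ℝ)).coeFn_toLp] with x e1 e2 e3
          rw [e1, e2, Pi.smul_apply, IsShortRange.eigenvector, e3, smul_eq_mul]
        rcases mul_eq_zero.1 hcL with h0 | h0
        · rw [hfe, h0, zero_smul]; exact Submodule.zero_mem _
        · rw [(regSol_ofReal hL.le (hV.intervalIntegrable 0 L) _).1, Complex.ofReal_eq_zero,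
            hV.realSol_eq_zero_iff hL] at h0
          obtain ⟨m, hm, hsm⟩ := h0
          rw [hfe]
          refine Submodule.smul_mem _ _ (Submodule.subset_span ?_)
          rw [Finset.coe_image]
          refine ⟨m, ?_, by rw [he, hsm]⟩
          rw [Finset.coe_Ico]
          refine ⟨hm, ?_⟩
          by_contra! hnm
          have h3 : waveNumber V L n ^ 2 ≤ waveNumber V L m ^ 2 := by
            rcases hnm.eq_or_lt with h4 | h4
            · rw [h4]
            · exact (hsq n m hn h4).le
          have h5 : (s : ℝ) ≤ t := s.2
          linarith
      have h1 := (h.trans (Submodule.rank_mono hle)).trans (rank_span_finset_le _)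
      have h2 : n ≤ ((Finset.Ico 1 n).image e).card := by exact_mod_cast h1
      have h3 := h2.trans Finset.card_image_le
      rw [Nat.card_Ico] at h3
      omega
    · intro h
      have hli : LinearIndependent ℂ (fun i : Fin n => e (i + 1)) := by
        refine linearIndependent_of_ne_zero_of_inner_eq_zero
          (fun i => hV.eigenvector_ne_zero hL _) fun i j hij => ?_
        refine hV.inner_eigenvector hL (hzero _ (by omega)) (hzero _ (by omega)) ?_
        rcases lt_or_gt_of_ne (fun h => hij (Fin.ext h) : (i : ℕ) ≠ j) with h1 | h1
        · exact (hsq _ _ (by omega) (by omega)).ne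
        · exact (hsq _ _ (by omega) (by omega)).ne'
      have hmem : ∀ i : Fin n, e (i + 1) ∈ (⨆ s : Iic t, opEigenspace A (s : ℝ)) := by
        intro i
        have hle : waveNumber V L (i + 1) ^ 2 ≤ t := by
          refine le_trans ?_ h
          rcases (show (i : ℕ) + 1 ≤ n from i.2).eq_or_lt with h4 | h4
          · rw [h4]
          · exact (hsq _ n (by omega) h4).le
        exact (le_iSup (fun s : Iic t => opEigenspace A (s : ℝ)) ⟨_, hle⟩)
          (hV.eigenvector_mem hL (hzero _ (by omega)))
      have hspan : Submodule.span ℂ (range fun i : Fin n => e (i + 1)) ≤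
          (⨆ s : Iic t, opEigenspace A (s : ℝ)) := by
        rw [Submodule.span_le]
        rintro _ ⟨i, rfl⟩
        exact hmem i
      refine le_trans ?_ (Submodule.rank_mono hspan)
      rw [rank_span hli, Cardinal.mk_range_eq _ hli.injective]
      simp
  rw [nthEigenvalue, hset, csInf_Ici]

theorem waveNumber_zero_potential (hL : 0 < L) {n : ℕ} (hn : 1 ≤ n) :
    waveNumber (fun _ => 0) L n = n * Real.pi / L := by
  obtain ⟨h1, h2⟩ := isShortRange_zero.waveNumber_spec hL hn
  have h3 := isShortRange_zero.prufer_sub_eq h1 hL.le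
  simp only [zero_mul, intervalIntegral.integral_zero, mul_zero] at h3
  rw [eq_div_iff hL.ne']
  linarith

end Eigen

section
variable {V : ℝ → ℝ} {L : ℝ}

theorem IsShortRange.energyDifference_eq (hV : IsShortRange V) (hL : 0 < L) (N : ℕ) :
    energyDifference V N L =
      ∑ n ∈ Finset.Icc 1 N, (waveNumber V L n ^ 2 - (n * (Real.pi / L)) ^ 2) := by
  rw [energyDifference, groundStateEnergy, groundStateEnergy, ← Finset.sum_sub_distrib]
  refine Finset.sum_congr rfl fun n hn => ?_
  have hn1 := (Finset.mem_Icc.1 hn).1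
  rw [hV.nthEigenvalue_eq hL hn1, isShortRange_zero.nthEigenvalue_eq hL hn1,
    waveNumber_zero_potential hL hn1, mul_div_assoc]

theorem IsTamePhase.comp_sqrt_continuousOn {δ : ℝ → ℝ} {Λ W : ℝ} (hδ : IsTamePhase δ Λ W) :
    Continuous (fun x => δ (√x)) := by
  rw [← continuousOn_univ]
  exact hδ.continuousOn.comp Real.continuous_sqrt.continuousOn fun x _ => Real.sqrt_nonneg x

theorem IsTamePhase.integral_comp_sqrt {δ : ℝ → ℝ} {Λ W : ℝ} (hδ : IsTamePhase δ Λ W) {x : ℝ}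
    (hx : 0 ≤ x) : ∫ t in (0 : ℝ)..x ^ 2, δ (√t) = 2 * ∫ t in (0 : ℝ)..x, t * δ t := by
  have h := intervalIntegral.integral_comp_mul_deriv (a := 0) (b := x) (f := fun t => t ^ 2)
    (f' := fun t => 2 * t) (g := fun x => δ (√x)) (fun t _ => by simpa using hasDerivAt_pow 2 t)
    (by fun_prop) hδ.comp_sqrt_continuousOn
  rw [zero_pow two_ne_zero] at h
  rw [← h, ← intervalIntegral.integral_const_mul]
  refine intervalIntegral.integral_congr fun t ht => ?_
  rw [uIcc_of_le hx] at ht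
  simp only [Function.comp, Real.sqrt_sq ht.1]
  ring

theorem IsShortRange.energyDifference_isLittleO (hV : IsShortRange V) {E : ℝ} (hE : 0 < E) :
    (fun p : ℕ × ℝ => energyDifference V p.1 p.2 -
      (-(1 / Real.pi) * (∫ x in (0 : ℝ)..((p.1 : ℝ) * Real.pi / p.2) ^ 2, phaseShift V (√x)) +
        √E / p.2 * (-phaseShift V (√E) + 1 / Real.pi * phaseShift V (√E) ^ 2)))
      =o[thermodynamicLimit E] fun p : ℕ × ℝ => 1 / p.2 := by
  have hδ := hV.isTamePhase
  set δ := phaseShift V with hδdef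
  have hπ := Real.pi_pos
  have hsE : 0 < √E := Real.sqrt_pos.2 hE
  rw [isLittleO_iff]
  intro c hc
  obtain ⟨h₀, hh₀, σ, hσ, hmain⟩ := hδ.abs_sum_sub_le (K := √E + 1) (β := c / (2 * Real.pi))
    (by positivity) (by positivity)
  set B : ℝ → ℝ := fun x => -(x * δ x) + 1 / Real.pi * (x * δ x ^ 2) with hB
  have hBc : ContinuousAt B (√E) := by
    have h1 : ContinuousAt δ (√E) := hδ.continuousOn.continuousAt (Ici_mem_nhds hsE)
    exact (continuousAt_id.mul h1).neg.add (continuousAt_const.mul (continuousAt_id.mul (h1.pow 2)))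
  have hp2 : Tendsto (fun p : ℕ × ℝ => p.2) (thermodynamicLimit E) atTop :=
    tendsto_snd.mono_left inf_le_left
  have hκ : Tendsto (fun p : ℕ × ℝ => (p.1 : ℝ) * Real.pi / p.2) (thermodynamicLimit E)
      (𝓝 (√E)) := by
    have h1 : Tendsto (fun p : ℕ × ℝ => (p.1 : ℝ) / p.2) (thermodynamicLimit E)
        (𝓝 (√E / Real.pi)) := tendsto_comap.mono_left inf_le_right
    have h2 := h1.mul_const Real.pi
    rw [div_mul_cancel₀ _ hπ.ne'] at h2
    exact h2.congr fun p => by ring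
  have ev1 := hp2.eventually (eventually_gt_atTop (max 1 (Real.pi / h₀)))
  have ev2 := hp2.eventually (hV.tendsto_weightTail.eventually
    (gt_mem_nhds (by positivity : 0 < σ * Real.pi ^ 2)))
  have ev3 := hκ.eventually (gt_mem_nhds (lt_add_one (√E)))
  have ev4 := (hBc.tendsto.comp hκ).eventually (Metric.ball_mem_nhds _ (half_pos hc))
  filter_upwards [ev1, ev2, ev3, ev4] with ⟨N, L⟩ h1 h2 h3 h4
  simp only at h1 h2 h3 h4 ⊢
  have hL1 : 1 < L := (le_max_left _ _).trans_lt h1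
  have hL : 0 < L := by linarith
  have hLh : Real.pi / L < h₀ := by
    have := (le_max_right _ _).trans_lt h1
    rw [div_lt_iff₀ hh₀] at this
    rw [div_lt_iff₀ hL]
    linarith
  have hh : 0 < Real.pi / L := by positivity
  have hhπ : Real.pi / L / Real.pi = 1 / L := by field_simp
  have hNκ : (N : ℝ) * Real.pi / L = N * (Real.pi / L) := mul_div_assoc _ _ _
  have hsum := hmain (Real.pi / L) hh hLh N (by rw [← hNκ]; exact h3.le) (waveNumber V L)
    (fun n => phaseAt V L (waveNumber V L n)) (fun n hn => by
      have hn1 := (Finset.mem_Icc.1 hn).1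
      obtain ⟨k1, k2⟩ := hV.waveNumber_spec hL hn1
      obtain ⟨k3, k4⟩ := hV.phaseAt_bounds k1 hL.le
      have e1 : waveNumber V L n = n * (Real.pi / L) -
          Real.pi / L / Real.pi * phaseAt V L (waveNumber V L n) := by
        rw [hhπ, phaseAt, k2]; field_simp; ring
      refine ⟨e1, k3, k4, ?_⟩
      have hkge : Real.pi / L ≤ waveNumber V L n := by
        have : (1 : ℝ) ≤ n := by exact_mod_cast hn1
        have e2 : 0 ≤ Real.pi / L / Real.pi * -phaseAt V L (waveNumber V L n) :=
          mul_nonneg (by positivity) (by linarith)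
        have e3 : 1 * (Real.pi / L) ≤ n * (Real.pi / L) := by gcongr
        linarith
      have e4 := hV.phaseShift_sub_phaseAt k1 hL.le
      rw [abs_sub_comm] at e4
      have e5 : Real.pi * L ≤ waveNumber V L n * (1 + L ^ 2) := by
        calc Real.pi * L = Real.pi / L * L ^ 2 := by field_simp
          _ ≤ waveNumber V L n * (1 + L ^ 2) := by gcongr; linarith
      have e6 := (mul_le_mul_of_nonneg_left e5 (abs_nonneg
        (phaseAt V L (waveNumber V L n) - phaseShift V (waveNumber V L n)))).trans (e4.trans h2.le)
      rw [← le_div_iff₀ (by positivity)] at e6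
      refine e6.trans (le_of_eq ?_)
      field_simp)
  rw [← hV.energyDifference_eq hL N, ← hNκ] at hsum
  set κ := (N : ℝ) * Real.pi / L with hκdef
  have hκ0 : 0 ≤ κ := by positivity
  rw [hδ.integral_comp_sqrt hκ0]
  have e1 : energyAsymptotics δ (Real.pi / L) κ =
      -(2 / Real.pi) * (∫ t in (0 : ℝ)..κ, t * δ t) + 1 / L * B κ := by
    rw [energyAsymptotics, hB]; field_simp; ring
  have e2 : energyDifference V N L - (-(1 / Real.pi) * (2 * ∫ t in (0 : ℝ)..κ, t * δ t) +
      √E / L * (-δ (√E) + 1 / Real.pi * δ (√E) ^ 2)) =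
      (energyDifference V N L - energyAsymptotics δ (Real.pi / L) κ) +
        1 / L * (B κ - B (√E)) := by
    rw [e1, hB]; ring
  rw [e2, Real.norm_eq_abs, Real.norm_eq_abs, abs_of_pos (by positivity : 0 < 1 / L)]
  refine (abs_add_le _ _).trans ?_
  have e3 : |1 / L * (B κ - B (√E))| ≤ 1 / L * (c / 2) :=
    abs_mul_le_mul (abs_of_pos (by positivity)).le (by
      rw [← Real.dist_eq]
      exact le_of_lt h4)
  have e4 : c / (2 * Real.pi) * (Real.pi / L) = 1 / L * (c / 2) := by field_simp
  rw [e4] at hsum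
  linarith

end

section
variable {V : ℝ → ℝ} {T : ℝ}

/-- The boundary form `φ' - i k φ` at `T` of the regular solution with energy `k²`. -/
noncomputable def jostForm (V : ℝ → ℝ) (T : ℝ) (k : ℂ) : ℂ :=
  regSolD V (k ^ 2) T - Complex.I * k * regSol V (k ^ 2) T

/-- The energy identity for the regular solution. -/
theorem conj_regSol_mul_regSolD (hT : 0 ≤ T) (hV : IntervalIntegrable V volume 0 T)
    (hVnn : ∀ x, 0 ≤ V x) (z : ℂ) : ∃ p i : ℝ, 0 ≤ p ∧ 0 ≤ i ∧
      starRingEnd ℂ (regSol V z T) * regSolD V z T = p - z * i := by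
  have hsol := regSol_isLinSol hT hV z
  have h1 := hsol.fst.conj.mul hsol.snd
  have hc := regSol_continuousOn hT hV z
  rw [← uIcc_of_le hT] at hc
  have i1 : IntervalIntegrable (fun x => Complex.normSq (regSolD V z x)) volume 0 T :=
    (Complex.continuous_normSq.comp_continuousOn hc.2).intervalIntegrable
  have hn := Complex.continuous_normSq.comp_continuousOn hc.1
  have i2 : IntervalIntegrable (fun x => Complex.normSq (regSol V z x)) volume 0 T :=
    hn.intervalIntegrable
  have i3 : IntervalIntegrable (fun x => V x * Complex.normSq (regSol V z x)) volume 0 T :=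
    hV.mul_continuousOn hn
  refine ⟨(∫ x in (0 : ℝ)..T, Complex.normSq (regSolD V z x)) +
      ∫ x in (0 : ℝ)..T, V x * Complex.normSq (regSol V z x),
    ∫ x in (0 : ℝ)..T, Complex.normSq (regSol V z x), ?_, ?_, ?_⟩
  · exact add_nonneg (intervalIntegral.integral_nonneg hT fun x _ => Complex.normSq_nonneg _)
      (intervalIntegral.integral_nonneg hT fun x _ => mul_nonneg (hVnn x) (Complex.normSq_nonneg _))
  · exact intervalIntegral.integral_nonneg hT fun x _ => Complex.normSq_nonneg _
  · have h2 := h1.integral_eq_sub h1.intervalIntegrable_complex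
    simp only [regSol_zero, map_zero, zero_mul, sub_zero] at h2
    rw [← h2]
    have hR : ∀ {r : ℝ → ℝ}, IntervalIntegrable r volume 0 T →
        IntervalIntegrable (fun x => (r x : ℂ)) volume 0 T := fun h => ⟨h.1.ofReal, h.2.ofReal⟩
    push_cast
    rw [← intervalIntegral.integral_ofReal, ← intervalIntegral.integral_ofReal,
      ← intervalIntegral.integral_ofReal, ← intervalIntegral.integral_const_mul,
      ← intervalIntegral.integral_add (hR i1) (hR i3),
      ← intervalIntegral.integral_sub ((hR i1).add (hR i3)) ((hR i2).const_mul _)]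
    refine intervalIntegral.integral_congr fun x _ => ?_
    simp only [Complex.ofReal_mul, Complex.normSq_eq_conj_mul_self]
    ring

theorem norm_mul_regSol_le (hT : 0 ≤ T) (hV : IntervalIntegrable V volume 0 T)
    (hVnn : ∀ x, 0 ≤ V x) {k : ℂ} (hk : 0 ≤ k.im) :
    ‖k * regSol V (k ^ 2) T‖ ≤ 2 * ‖jostForm V T k‖ := by
  obtain ⟨p, i, hp, hi, h⟩ := conj_regSol_mul_regSolD hT hV hVnn (k ^ 2)
  set φ := regSol V (k ^ 2) T with hφ
  have hw : starRingEnd ℂ φ * jostForm V T k = p - k ^ 2 * i - Complex.I * k * Complex.normSq φ := by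
    rw [Complex.normSq_eq_conj_mul_self, jostForm, mul_sub, h]; ring
  have hnn := Complex.normSq_nonneg φ
  set n := Complex.normSq φ with hn
  have hre : (starRingEnd ℂ φ * jostForm V T k).re =
      p - (k.re ^ 2 - k.im ^ 2) * i + k.im * n := by
    rw [hw]; simp [pow_two]
  have him : (starRingEnd ℂ φ * jostForm V T k).im = -(k.re * (2 * k.im * i + n)) := by
    rw [hw]; simp [pow_two]; ring
  have hnorm : ‖starRingEnd ℂ φ * jostForm V T k‖ = ‖φ‖ * ‖jostForm V T k‖ := by
    rw [norm_mul, RCLike.norm_conj]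
  have hn2 : n = ‖φ‖ * ‖φ‖ := by rw [hn, Complex.normSq_eq_norm_sq]; ring
  have h1 : |k.re| * n ≤ ‖φ‖ * ‖jostForm V T k‖ := by
    rw [← hnorm]
    refine le_trans ?_ (Complex.abs_im_le_norm _)
    have h5 : 0 ≤ k.im * i := mul_nonneg hk hi
    rw [him, abs_neg, abs_mul, abs_of_nonneg (by linarith : 0 ≤ 2 * k.im * i + n)]
    exact mul_le_mul_of_nonneg_left (by linarith) (abs_nonneg _)
  have h2 : k.im * n ≤ ‖φ‖ * ‖jostForm V T k‖ := by
    rcases le_total |k.re| k.im with h3 | h3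
    · rw [← hnorm]
      refine le_trans ?_ (Complex.re_le_norm _)
      rw [hre]
      have h4 : k.re ^ 2 ≤ k.im ^ 2 := by rw [← sq_abs]; gcongr
      have : 0 ≤ (k.im ^ 2 - k.re ^ 2) * i := mul_nonneg (by linarith) hi
      linarith
    · exact le_trans (mul_le_mul_of_nonneg_right h3 hnn) h1
  have h3 : ‖k‖ ≤ |k.re| + |k.im| := Complex.norm_le_abs_re_add_abs_im k
  rw [abs_of_nonneg hk] at h3
  rw [norm_mul]
  rcases (norm_nonneg φ).eq_or_lt with h0 | h0
  · rw [← h0, mul_zero]; positivity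
  · have h4 : ‖k‖ * n ≤ (|k.re| + k.im) * n := mul_le_mul_of_nonneg_right h3 hnn
    have h5 : ‖φ‖ * (‖k‖ * ‖φ‖) ≤ ‖φ‖ * (2 * ‖jostForm V T k‖) := by
      have : ‖φ‖ * (‖k‖ * ‖φ‖) = ‖k‖ * n := by rw [hn2]; ring
      rw [this]; linarith
    exact le_of_mul_le_mul_left h5 h0

theorem jostForm_ne_zero (hT : 0 ≤ T) (hV : IntervalIntegrable V volume 0 T)
    (hVnn : ∀ x, 0 ≤ V x) {k : ℂ} (hk : 0 ≤ k.im) : jostForm V T k ≠ 0 := by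
  intro h
  by_cases hk0 : k = 0
  · subst hk0
    have h1 := (realSol_ge hT hV hVnn le_rfl).2 T ⟨hT, le_rfl⟩
    have h2 := (regSol_ofReal hT hV 0).2
    simp only [Complex.ofReal_zero] at h2
    rw [jostForm, zero_pow two_ne_zero, mul_zero, zero_mul, sub_zero, h2,
      Complex.ofReal_eq_zero] at h
    linarith
  · have h1 := norm_mul_regSol_le hT hV hVnn hk
    rw [h, norm_zero, mul_zero, norm_le_zero_iff] at h1
    have h2 := (mul_eq_zero.1 h1).resolve_left hk0
    refine regSol_ne_zero hT hV (k ^ 2) ⟨hT, le_rfl⟩ ⟨h2, ?_⟩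
    rw [jostForm, h2, mul_zero, sub_zero] at h
    exact h

/-- `k φ / (φ' - i k φ)` at `T`, a bounded analytic function on the upper half-plane. -/
noncomputable def jostRatio (V : ℝ → ℝ) (T : ℝ) (k : ℂ) : ℂ :=
  k * regSol V (k ^ 2) T / jostForm V T k

theorem jostForm_differentiable (hT : 0 ≤ T) (hV : IntervalIntegrable V volume 0 T) :
    Differentiable ℂ (jostForm V T) := by
  obtain ⟨h1, h2⟩ := regSol_differentiable hT hV
  have h3 : Differentiable ℂ fun k : ℂ => regSol V (k ^ 2) T :=
    h1.comp (differentiable_id.pow 2)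
  have h4 : Differentiable ℂ fun k : ℂ => regSolD V (k ^ 2) T :=
    h2.comp (differentiable_id.pow 2)
  unfold jostForm
  fun_prop

theorem isOpen_jostForm_ne_zero (hT : 0 ≤ T) (hV : IntervalIntegrable V volume 0 T) :
    IsOpen {k | jostForm V T k ≠ 0} :=
  isOpen_ne_fun (jostForm_differentiable hT hV).continuous continuous_const

theorem jostRatio_differentiableOn (hT : 0 ≤ T) (hV : IntervalIntegrable V volume 0 T) :
    DifferentiableOn ℂ (jostRatio V T) {k | jostForm V T k ≠ 0} := by
  have h3 : Differentiable ℂ fun k : ℂ => k * regSol V (k ^ 2) T :=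
    differentiable_id.mul ((regSol_differentiable hT hV).1.comp (differentiable_id.pow 2))
  exact h3.differentiableOn.div (jostForm_differentiable hT hV).differentiableOn fun k hk => hk

theorem norm_jostRatio_le (hT : 0 ≤ T) (hV : IntervalIntegrable V volume 0 T)
    (hVnn : ∀ x, 0 ≤ V x) {k : ℂ} (hk : 0 ≤ k.im) : ‖jostRatio V T k‖ ≤ 2 := by
  rw [jostRatio, norm_div, div_le_iff₀ (norm_pos_iff.2 (jostForm_ne_zero hT hV hVnn hk))]
  exact norm_mul_regSol_le hT hV hVnn hk

/-- The squared sine of the Prüfer angle, as an even function of the wave number. -/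
noncomputable def sineSq (V : ℝ → ℝ) (T k : ℝ) : ℝ :=
  (k * realSol V (k ^ 2) T) ^ 2 / (realSolD V (k ^ 2) T ^ 2 + (k * realSol V (k ^ 2) T) ^ 2)

theorem jostRatio_ofReal_im (hT : 0 ≤ T) (hV : IntervalIntegrable V volume 0 T) (k : ℝ) :
    (jostRatio V T k).im = sineSq V T k := by
  have h := regSol_ofReal hT hV (k ^ 2)
  push_cast at h
  rw [jostRatio, jostForm, h.1, h.2, sineSq, Complex.div_im]
  simp [Complex.normSq_apply]
  ring

theorem jostRatio_I_mul (hT : 0 ≤ T) (hV : IntervalIntegrable V volume 0 T) (κ : ℝ) :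
    jostRatio V T (Complex.I * κ) = Complex.I * ((κ * realSol V (-κ ^ 2) T /
      (realSolD V (-κ ^ 2) T + κ * realSol V (-κ ^ 2) T) : ℝ) : ℂ) := by
  have h := regSol_ofReal hT hV (-κ ^ 2)
  have e : (Complex.I * (κ : ℂ)) ^ 2 = ((-κ ^ 2 : ℝ) : ℂ) := by
    rw [mul_pow, Complex.I_sq]; push_cast; ring
  rw [jostRatio, jostForm, e, h.1, h.2]
  push_cast
  rw [← mul_assoc Complex.I Complex.I, Complex.I_mul_I]
  ring

theorem sineSq_continuous (hT : 0 ≤ T) (hV : IntervalIntegrable V volume 0 T)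
    (hVnn : ∀ x, 0 ≤ V x) : Continuous (sineSq V T) := by
  have h1 : Continuous fun k : ℝ => jostRatio V T k := by
    rw [← continuousOn_univ]
    refine (jostRatio_differentiableOn hT hV).continuousOn.comp
      Complex.continuous_ofReal.continuousOn fun k _ => ?_
    exact jostForm_ne_zero hT hV hVnn (by simp)
  exact (Complex.continuous_im.comp h1).congr fun k => jostRatio_ofReal_im hT hV k

theorem sineSq_nonneg (k : ℝ) : 0 ≤ sineSq V T k := by
  rw [sineSq]; positivity

theorem sineSq_le_one (k : ℝ) : sineSq V T k ≤ 1 := by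
  rw [sineSq]
  refine div_le_one_of_le₀ ?_ (by positivity)
  linarith [sq_nonneg (realSolD V (k ^ 2) T)]

theorem sineSq_neg (k : ℝ) : sineSq V T (-k) = sineSq V T k := by
  simp only [sineSq, neg_sq, neg_mul]

theorem integrable_and_integral_inv_sq_add_sq {κ : ℝ} (hκ : 0 < κ) :
    Integrable (fun x : ℝ => (x ^ 2 + κ ^ 2)⁻¹) ∧ ∫ x : ℝ, (x ^ 2 + κ ^ 2)⁻¹ = Real.pi / κ := by
  have e : (fun x : ℝ => (x ^ 2 + κ ^ 2)⁻¹) = fun x => (κ ^ 2)⁻¹ * (1 + (x / κ) ^ 2)⁻¹ := by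
    ext x
    rw [← mul_inv]
    congr 1
    field_simp
    ring
  rw [e]
  refine ⟨(integrable_inv_one_add_sq.comp_div hκ.ne').const_mul _, ?_⟩
  rw [integral_const_mul, Measure.integral_comp_div (fun x => (1 + x ^ 2)⁻¹) κ,
    integral_univ_inv_one_add_sq, abs_of_pos hκ, smul_eq_mul]
  field_simp

/-- The contour integral over large rectangles in the upper half-plane. -/
theorem tendsto_integral_of_bounded_analytic {F : ℂ → ℂ} {U : Set ℂ} {κ C : ℝ} (hU : IsOpen U)
    (hUm : {k : ℂ | 0 ≤ k.im} ⊆ U) (hF : DifferentiableOn ℂ F U)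
    (hb : ∀ k : ℂ, 0 ≤ k.im → ‖F k‖ ≤ C) (hκ : 0 < κ) :
    Tendsto (fun R : ℝ => ∫ x in (-R)..R, (F x - F (Complex.I * κ)) / ((x : ℂ) ^ 2 + κ ^ 2))
      atTop (𝓝 0) := by
  have hC : 0 ≤ C := (norm_nonneg _).trans (hb 0 (by simp))
  set c : ℂ := Complex.I * κ with hc
  have hcim : c.im = κ := by simp [hc]
  have hcU : c ∈ U := hUm (by rw [mem_ofPred_eq, hcim]; exact hκ.le)
  set g : ℂ → ℂ := fun k => dslope F c k / (k + c) with hg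
  have hds : DifferentiableOn ℂ (dslope F c) U :=
    (Complex.differentiableOn_dslope (hU.mem_nhds hcU)).2 hF
  have hsum : ∀ k : ℂ, 0 ≤ k.im → k + c ≠ 0 := fun k hk h => by
    have := congrArg Complex.im h
    rw [Complex.add_im, hcim, Complex.zero_im] at this
    linarith
  have hgd : DifferentiableOn ℂ g {k : ℂ | 0 ≤ k.im} :=
    (hds.mono hUm).div (by fun_prop) fun k hk => hsum k hk
  have hcc : c ^ 2 = -κ ^ 2 := by rw [hc, mul_pow, Complex.I_sq]; ring
  have hge : ∀ k : ℂ, k ≠ c → g k = (F k - F c) / (k ^ 2 + κ ^ 2) := by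
    intro k hk
    have hk' : k - c ≠ 0 := sub_ne_zero.2 hk
    simp only [hg]
    rw [dslope_of_ne _ hk, slope_def_field, div_div]
    congr 1
    linear_combination -hcc
  have hgb : ∀ R : ℝ, 2 * κ ≤ R → ∀ k : ℂ, 0 ≤ k.im → R ≤ ‖k‖ → ‖g k‖ ≤ 4 * C / R ^ 2 := by
    intro R hR k hk hkR
    have hR0 : 0 < R := by linarith
    have hcn : ‖c‖ = κ := by rw [hc, norm_mul, Complex.norm_I, one_mul, Complex.norm_real,
      Real.norm_eq_abs, abs_of_pos hκ]
    have hne : k ≠ c := fun h => by rw [h, hcn] at hkR; linarith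
    rw [hge k hne, norm_div]
    have h1 : ‖F k - F c‖ ≤ 2 * C :=
      (norm_sub_le _ _).trans (by linarith [hb k hk, hb c (by rw [hcim]; exact hκ.le)])
    have h2 : R ^ 2 / 2 ≤ ‖k ^ 2 + (κ : ℂ) ^ 2‖ := by
      have h3 := norm_sub_le (k ^ 2 + (κ : ℂ) ^ 2) ((κ : ℂ) ^ 2)
      rw [add_sub_cancel_right, norm_pow, norm_pow, Complex.norm_real, Real.norm_eq_abs,
        abs_of_pos hκ] at h3
      have h4 : R ^ 2 ≤ ‖k‖ ^ 2 := by gcongr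
      nlinarith
    calc _ ≤ 2 * C / (R ^ 2 / 2) := by gcongr
      _ = _ := by field_simp; ring
  have hreal : ∀ x : ℝ, g x = (F x - F c) / ((x : ℂ) ^ 2 + κ ^ 2) := fun x =>
    hge x fun h => by
      have := congrArg Complex.im h
      rw [hcim, Complex.ofReal_im] at this
      linarith
  simp_rw [← hreal]
  refine squeeze_zero_norm' (a := fun R => 16 * C * R⁻¹) ?_ ?_
  · filter_upwards [eventually_ge_atTop (2 * κ)] with R hR
    have hR0 : 0 < R := by linarith
    have hrect := Complex.integral_boundary_rect_eq_zero_of_differentiableOn g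
      (-R : ℂ) (R + R * Complex.I) (hgd.mono fun k hk => by
        have h2 := hk.2
        simp only [Complex.neg_im, Complex.ofReal_im, neg_zero, Complex.add_im, Complex.mul_im,
          Complex.ofReal_re, Complex.I_im, mul_one, Complex.I_re, mul_zero, add_zero, zero_add]
          at h2
        rw [mem_preimage, uIcc_of_le hR0.le] at h2
        exact h2.1)
    simp only [Complex.neg_re, Complex.neg_im, Complex.ofReal_re, Complex.ofReal_im, neg_zero,
      Complex.add_re, Complex.add_im, Complex.mul_re, Complex.mul_im, Complex.I_re, Complex.I_im,
      mul_zero, mul_one, sub_zero, add_zero, zero_add, Complex.ofReal_zero, zero_mul] at hrect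
    have hbd : ∀ (a b : ℝ) (γ : ℝ → ℂ), (∀ t ∈ uIoc a b, 0 ≤ (γ t).im ∧ R ≤ ‖γ t‖) →
        ‖∫ t in a..b, g (γ t)‖ ≤ 4 * C / R ^ 2 * |b - a| := fun a b γ hγ =>
      intervalIntegral.norm_integral_le_of_norm_le_const fun t ht =>
        hgb R hR _ (hγ t ht).1 (hγ t ht).2
    have i1 := hbd (-R) R (fun x => x + R * Complex.I) fun t _ => by
      refine ⟨by simpa using hR0.le, ?_⟩
      have := Complex.abs_im_le_norm ((t : ℂ) + R * Complex.I)
      simp only [Complex.add_im, Complex.ofReal_im, Complex.mul_im, Complex.ofReal_re,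
        Complex.I_im, mul_one, Complex.I_re, mul_zero, add_zero, zero_add] at this
      rwa [abs_of_pos hR0] at this
    have i2 := hbd 0 R (fun y => R + y * Complex.I) fun t ht => by
      rw [uIoc_of_le hR0.le] at ht
      refine ⟨by simpa using ht.1.le, ?_⟩
      have := Complex.abs_re_le_norm ((R : ℂ) + t * Complex.I)
      simp only [Complex.add_re, Complex.ofReal_re, Complex.mul_re, Complex.ofReal_im,
        Complex.I_im, mul_one, Complex.I_re, mul_zero, add_zero, sub_zero] at this
      rwa [abs_of_pos hR0] at this
    have i3 := hbd 0 R (fun y => -R + y * Complex.I) fun t ht => by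
      rw [uIoc_of_le hR0.le] at ht
      refine ⟨by simpa using ht.1.le, ?_⟩
      have := Complex.abs_re_le_norm (-(R : ℂ) + t * Complex.I)
      simp only [Complex.add_re, Complex.neg_re, Complex.ofReal_re, Complex.mul_re,
        Complex.ofReal_im, Complex.I_im, mul_one, Complex.I_re, mul_zero, add_zero, sub_zero,
        abs_neg] at this
      rwa [abs_of_pos hR0] at this
    rw [show R - -R = 2 * R by ring, abs_of_pos (by positivity)] at i1
    rw [sub_zero, abs_of_pos hR0] at i2 i3
    have e : ∫ x in (-R)..R, g x = (∫ x in (-R)..R, g (x + R * Complex.I)) -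
        Complex.I • (∫ y in (0 : ℝ)..R, g (R + y * Complex.I)) +
        Complex.I • ∫ y in (0 : ℝ)..R, g (-R + y * Complex.I) := by
      push_cast at hrect
      linear_combination hrect
    rw [e]
    refine (norm_add_le _ _).trans ((add_le_add (norm_sub_le _ _) le_rfl).trans ?_)
    rw [norm_smul, norm_smul, Complex.norm_I, one_mul, one_mul]
    have : 16 * C * R⁻¹ = 4 * C / R ^ 2 * (2 * R) + 4 * C / R ^ 2 * R + 4 * C / R ^ 2 * R := by
      field_simp; ring
    rw [this]
    gcongr
  · simpa using tendsto_inv_atTop_zero.const_mul (16 * C)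

/-- The Green's function of the truncated potential at its end point. -/
noncomputable def greenEnd (V : ℝ → ℝ) (T κ : ℝ) : ℝ :=
  realSol V (-κ ^ 2) T / (realSolD V (-κ ^ 2) T + κ * realSol V (-κ ^ 2) T)

/-- The spectral representation of `greenEnd`. -/
theorem greenEnd_eq_integral (hT : 0 ≤ T) (hV : IntervalIntegrable V volume 0 T)
    (hVnn : ∀ x, 0 ≤ V x) {κ : ℝ} (hκ : 0 < κ) :
    greenEnd V T κ = 1 / Real.pi * ∫ x : ℝ, sineSq V T x * (x ^ 2 + κ ^ 2)⁻¹ := by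
  have hlim := tendsto_integral_of_bounded_analytic (isOpen_jostForm_ne_zero hT hV)
    (fun k hk => jostForm_ne_zero hT hV hVnn hk) (jostRatio_differentiableOn hT hV)
    (fun k hk => norm_jostRatio_le hT hV hVnn hk) hκ
  have hlim2 := (Complex.continuous_im.tendsto 0).comp hlim
  obtain ⟨hi, hval⟩ := integrable_and_integral_inv_sq_add_sq hκ
  have hSi : Integrable fun x : ℝ => sineSq V T x * (x ^ 2 + κ ^ 2)⁻¹ := by
    refine hi.mono' ?_ (Eventually.of_forall fun x => ?_)
    · exact ((sineSq_continuous hT hV hVnn).aestronglyMeasurable).mul hi.aestronglyMeasurable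
    · have h1 := sineSq_le_one (V := V) (T := T) x
      have h2 := sineSq_nonneg (V := V) (T := T) x
      rw [Real.norm_eq_abs, abs_of_nonneg (by positivity)]
      exact mul_le_of_le_one_left (by positivity) h1
  have hint : Integrable fun x : ℝ => (sineSq V T x - κ * greenEnd V T κ) * (x ^ 2 + κ ^ 2)⁻¹ := by
    simp_rw [sub_mul]
    exact hSi.sub (hi.const_mul _)
  have hlim3 := intervalIntegral_tendsto_integral hint tendsto_neg_atTop_atBot tendsto_id
  have heq : ∀ R : ℝ, (∫ x in (-R)..R, (jostRatio V T x - jostRatio V T (Complex.I * κ)) /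
      ((x : ℂ) ^ 2 + κ ^ 2)).im =
      ∫ x in (-R)..R, (sineSq V T x - κ * greenEnd V T κ) * (x ^ 2 + κ ^ 2)⁻¹ := by
    intro R
    have hcont : Continuous fun x : ℝ => (jostRatio V T x - jostRatio V T (Complex.I * κ)) /
      ((x : ℂ) ^ 2 + κ ^ 2) := by
      have h1 : Continuous fun k : ℝ => jostRatio V T k := by
        rw [← continuousOn_univ]
        refine (jostRatio_differentiableOn hT hV).continuousOn.comp
          Complex.continuous_ofReal.continuousOn fun k _ => ?_
        exact jostForm_ne_zero hT hV hVnn (by simp)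
      refine (h1.sub continuous_const).div (by fun_prop) fun x => ?_
      have : ((x ^ 2 + κ ^ 2 : ℝ) : ℂ) ≠ 0 := by
        rw [Complex.ofReal_ne_zero]; positivity
      simpa using this
    have := Complex.imCLM.intervalIntegral_comp_comm (μ := volume) (hcont.intervalIntegrable (-R) R)
    simp only [Complex.imCLM_apply] at this
    rw [← this]
    refine intervalIntegral.integral_congr fun x _ => ?_
    have e : ((x : ℂ) ^ 2 + (κ : ℂ) ^ 2) = ((x ^ 2 + κ ^ 2 : ℝ) : ℂ) := by push_cast; ring
    rw [e, Complex.div_ofReal_im, Complex.sub_im, jostRatio_ofReal_im hT hV, jostRatio_I_mul hT hV,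
      Complex.I_mul_im, Complex.ofReal_re, greenEnd, div_eq_mul_inv, mul_div_assoc]
  have hzero := tendsto_nhds_unique (hlim2.congr fun R => heq R) hlim3
  simp_rw [sub_mul] at hzero
  rw [integral_sub hSi (hi.const_mul _), integral_const_mul, hval, Complex.zero_im] at hzero
  have hπ := Real.pi_pos
  have : ∫ x : ℝ, sineSq V T x * (x ^ 2 + κ ^ 2)⁻¹ = Real.pi * greenEnd V T κ := by
    have h1 : κ * greenEnd V T κ * (Real.pi / κ) = Real.pi * greenEnd V T κ := by field_simp
    rw [h1] at hzero
    linarith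
  rw [this]
  field_simp

end

section
variable {V : ℝ → ℝ} {T : ℝ}

theorem realSol_wronskian (hT : 0 ≤ T) (hV : IntervalIntegrable V volume 0 T) (s s' : ℝ) :
    realSol V s T * realSolD V s' T - realSol V s' T * realSolD V s T =
      (s - s') * ∫ t in (0 : ℝ)..T, realSol V s' t * realSol V s t := by
  have h := ((realSol_hasACDeriv hT hV s).mul (realSolD_hasACDeriv hT hV s')).sub
    ((realSol_hasACDeriv hT hV s').mul (realSolD_hasACDeriv hT hV s))
  have h1 := h.integral_eq_sub h.intervalIntegrable
  simp only [realSol_zero, zero_mul, sub_zero] at h1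
  rw [← h1, ← intervalIntegral.integral_const_mul]
  refine intervalIntegral.integral_congr fun x _ => ?_
  ring

theorem integral_mul_realSol_tendsto (hT : 0 ≤ T) (hV : IntervalIntegrable V volume 0 T) (s : ℝ) :
    Tendsto (fun s' => ∫ t in (0 : ℝ)..T, realSol V s' t * realSol V s t) (𝓝 s)
      (𝓝 (∫ t in (0 : ℝ)..T, realSol V s t * realSol V s t)) := by
  have h := (integral_mul_regSol_tendsto hV (s : ℂ) ⟨hT, le_rfl⟩
    (regSol_continuousOn hT hV s).1).comp (Complex.continuous_ofReal.tendsto s)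
  have h2 := (Complex.continuous_re.tendsto _).comp h
  have e : ∀ s' : ℝ, (∫ t in (0 : ℝ)..T, regSol V s' t * regSol V s t).re =
      ∫ t in (0 : ℝ)..T, realSol V s' t * realSol V s t := by
    intro s'
    rw [← Complex.ofReal_re (∫ t in (0 : ℝ)..T, realSol V s' t * realSol V s t),
      ← intervalIntegral.integral_ofReal]
    congr 1
    refine intervalIntegral.integral_congr fun t ht => ?_
    rw [uIcc_of_le hT] at ht
    have hVt : IntervalIntegrable V volume 0 t := hV.mono_set (by
      rw [uIcc_of_le hT, uIcc_of_le ht.1]; exact Icc_subset_Icc le_rfl ht.2)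
    simp only [(regSol_ofReal ht.1 hVt _).1]
    push_cast
    rfl
  rw [← e]
  exact h2.congr fun s' => e s'

theorem greenEnd_denom_pos (hT : 0 ≤ T) (hV : IntervalIntegrable V volume 0 T)
    (hVnn : ∀ x, 0 ≤ V x) {κ : ℝ} (hκ : 0 ≤ κ) :
    0 < realSolD V (-κ ^ 2) T + κ * realSol V (-κ ^ 2) T := by
  have h := realSol_ge hT hV hVnn (s := -κ ^ 2) (by nlinarith)
  have h1 := h.1 T ⟨hT, le_rfl⟩
  have h2 := h.2 T ⟨hT, le_rfl⟩
  have : 0 ≤ κ * realSol V (-κ ^ 2) T := mul_nonneg hκ (hT.trans h1)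
  linarith

theorem greenEnd_sub (hT : 0 ≤ T) (hV : IntervalIntegrable V volume 0 T)
    (hVnn : ∀ x, 0 ≤ V x) {κ κ' : ℝ} (hκ : 0 < κ) (hκ' : 0 < κ') (hne : κ' ≠ κ) :
    ((∫ t in (0 : ℝ)..T, realSol V (-κ' ^ 2) t * realSol V (-κ ^ 2) t) +
        realSol V (-κ' ^ 2) T * realSol V (-κ ^ 2) T / (κ' + κ)) /
      ((realSolD V (-κ' ^ 2) T + κ' * realSol V (-κ' ^ 2) T) *
        (realSolD V (-κ ^ 2) T + κ * realSol V (-κ ^ 2) T)) =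
      1 / Real.pi * ∫ x : ℝ, sineSq V T x * (x ^ 2 + κ' ^ 2)⁻¹ * (x ^ 2 + κ ^ 2)⁻¹ := by
  have h1 := greenEnd_denom_pos hT hV hVnn hκ.le
  have h2 := greenEnd_denom_pos hT hV hVnn hκ'.le
  have hW := realSol_wronskian hT hV (-κ ^ 2) (-κ' ^ 2)
  have hd : κ' ^ 2 - κ ^ 2 ≠ 0 := by
    rw [sq_sub_sq]
    exact mul_ne_zero (by positivity) (sub_ne_zero.2 hne)
  have e1 := greenEnd_eq_integral hT hV hVnn hκ
  have e2 := greenEnd_eq_integral hT hV hVnn hκ'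
  have hi : ∀ {κ : ℝ}, 0 < κ → Integrable fun x : ℝ => sineSq V T x * (x ^ 2 + κ ^ 2)⁻¹ := by
    intro κ hκ
    refine (integrable_and_integral_inv_sq_add_sq hκ).1.bdd_mul (c := 1)
      (sineSq_continuous hT hV hVnn).aestronglyMeasurable (Eventually.of_forall fun x => ?_)
    rw [Real.norm_eq_abs, abs_of_nonneg (sineSq_nonneg x)]
    exact sineSq_le_one x
  have e3 : (∫ x : ℝ, sineSq V T x * (x ^ 2 + κ ^ 2)⁻¹) -
      (∫ x : ℝ, sineSq V T x * (x ^ 2 + κ' ^ 2)⁻¹) =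
      (κ' ^ 2 - κ ^ 2) * ∫ x : ℝ, sineSq V T x * (x ^ 2 + κ' ^ 2)⁻¹ * (x ^ 2 + κ ^ 2)⁻¹ := by
    rw [← integral_sub (hi hκ) (hi hκ'), ← integral_const_mul]
    refine integral_congr_ae (Eventually.of_forall fun x => ?_)
    have h3 : x ^ 2 + κ ^ 2 ≠ 0 := by positivity
    have h4 : x ^ 2 + κ' ^ 2 ≠ 0 := by positivity
    simp only
    field_simp
    ring
  have e4 : greenEnd V T κ - greenEnd V T κ' = (κ' ^ 2 - κ ^ 2) *
      (1 / Real.pi * ∫ x : ℝ, sineSq V T x * (x ^ 2 + κ' ^ 2)⁻¹ * (x ^ 2 + κ ^ 2)⁻¹) := by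
    rw [e1, e2, ← mul_sub, e3]; ring
  refine mul_left_cancel₀ hd ?_
  rw [← e4, greenEnd, greenEnd]
  have hs : κ' + κ ≠ 0 := by positivity
  rw [div_sub_div _ _ h1.ne' h2.ne', ← mul_div_assoc, mul_comm (realSolD V (-κ' ^ 2) T + _)]
  congr 1
  have hx : (κ' ^ 2 - κ ^ 2) * (realSol V (-κ' ^ 2) T * realSol V (-κ ^ 2) T / (κ' + κ)) =
      (κ' - κ) * (realSol V (-κ' ^ 2) T * realSol V (-κ ^ 2) T) := by
    field_simp
    ring
  rw [mul_add, hx]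
  linear_combination -hW

/-- The squared norm of the normalized solution, in terms of the Prüfer angles. -/
theorem solution_norm_eq_integral (hT : 0 ≤ T) (hV : IntervalIntegrable V volume 0 T)
    (hVnn : ∀ x, 0 ≤ V x) {κ : ℝ} (hκ : 0 < κ) :
    ((∫ t in (0 : ℝ)..T, realSol V (-κ ^ 2) t ^ 2) + realSol V (-κ ^ 2) T ^ 2 / (2 * κ)) /
      (realSolD V (-κ ^ 2) T + κ * realSol V (-κ ^ 2) T) ^ 2 =
      2 / Real.pi * ∫ x in Ioi (0 : ℝ), sineSq V T x / (x ^ 2 + κ ^ 2) ^ 2 := by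
  have hcs : Tendsto (fun κ' : ℝ => -κ' ^ 2) (𝓝[≠] κ) (𝓝 (-κ ^ 2)) :=
    ((continuous_id.pow 2).neg.tendsto κ).mono_left nhdsWithin_le_nhds
  have hid : Tendsto (fun κ' : ℝ => κ') (𝓝[≠] κ) (𝓝 κ) := nhdsWithin_le_nhds
  obtain ⟨hp1, hp2⟩ := realSol_continuous_param hT hV
  have l1 := (integral_mul_realSol_tendsto hT hV (-κ ^ 2)).comp hcs
  have l2 := (hp1.tendsto (-κ ^ 2)).comp hcs
  have l3 := (hp2.tendsto (-κ ^ 2)).comp hcs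
  have hw := greenEnd_denom_pos hT hV hVnn hκ.le
  have L := (l1.add ((l2.mul_const (realSol V (-κ ^ 2) T)).div (hid.add_const κ)
    (by positivity))).div ((l3.add (hid.mul l2)).mul_const
      (realSolD V (-κ ^ 2) T + κ * realSol V (-κ ^ 2) T)) (by positivity)
  have hi := (integrable_and_integral_inv_sq_add_sq hκ).1
  have hS := (sineSq_continuous hT hV hVnn)
  have R : Tendsto (fun κ' : ℝ => ∫ x : ℝ, sineSq V T x * (x ^ 2 + κ' ^ 2)⁻¹ * (x ^ 2 + κ ^ 2)⁻¹)
      (𝓝[≠] κ) (𝓝 (∫ x : ℝ, sineSq V T x * (x ^ 2 + κ ^ 2)⁻¹ * (x ^ 2 + κ ^ 2)⁻¹)) := by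
    have hnear : ∀ᶠ κ' in 𝓝[≠] κ, κ / 2 < κ' :=
      hid.eventually (lt_mem_nhds (by linarith))
    refine tendsto_integral_filter_of_dominated_convergence
      (fun x => ((κ / 2) ^ 2)⁻¹ * (x ^ 2 + κ ^ 2)⁻¹) ?_ ?_ (hi.const_mul _) ?_
    · filter_upwards [hnear] with κ' hκ'
      have : 0 < κ' := by linarith
      exact (hS.aestronglyMeasurable.mul
        (integrable_and_integral_inv_sq_add_sq this).1.aestronglyMeasurable).mul
          hi.aestronglyMeasurable
    · filter_upwards [hnear] with κ' hκ'
      refine Eventually.of_forall fun x => ?_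
      have h1 := sineSq_le_one (V := V) (T := T) x
      have h2 := sineSq_nonneg (V := V) (T := T) x
      have h3 : 0 < κ' := by linarith
      rw [Real.norm_eq_abs, abs_of_nonneg (by positivity)]
      gcongr
      calc _ ≤ 1 * (x ^ 2 + κ' ^ 2)⁻¹ := by gcongr
        _ ≤ _ := by
          rw [one_mul]
          gcongr
          nlinarith [sq_nonneg x]
    · refine Eventually.of_forall fun x => ?_
      refine ((Tendsto.inv₀ ((hid.pow 2).const_add _) (by positivity)).const_mul _).mul_const _
  have hL := L.congr' (f₂ := fun κ' : ℝ => 1 / Real.pi *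
      ∫ x : ℝ, sineSq V T x * (x ^ 2 + κ' ^ 2)⁻¹ * (x ^ 2 + κ ^ 2)⁻¹) (by
    filter_upwards [hid.eventually (lt_mem_nhds hκ), self_mem_nhdsWithin] with κ' h1 h2
    exact greenEnd_sub hT hV hVnn hκ h1 h2)
  have hfin := tendsto_nhds_unique hL (R.const_mul _)
  have e : ∫ x : ℝ, sineSq V T x * (x ^ 2 + κ ^ 2)⁻¹ * (x ^ 2 + κ ^ 2)⁻¹ =
      2 * ∫ x in Ioi (0 : ℝ), sineSq V T x / (x ^ 2 + κ ^ 2) ^ 2 := by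
    rw [← integral_comp_abs (f := fun x => sineSq V T x / (x ^ 2 + κ ^ 2) ^ 2)]
    refine integral_congr_ae (Eventually.of_forall fun x => ?_)
    have : sineSq V T |x| = sineSq V T x := by
      rcases abs_choice x with h | h <;> rw [h]
      exact sineSq_neg x
    simp only [this, sq_abs]
    rw [mul_assoc, ← mul_inv, div_eq_mul_inv, pow_two (x ^ 2 + κ ^ 2)]
  rw [e] at hfin
  rw [show (2 / Real.pi * ∫ x in Ioi (0 : ℝ), sineSq V T x / (x ^ 2 + κ ^ 2) ^ 2) =
    1 / Real.pi * (2 * ∫ x in Ioi (0 : ℝ), sineSq V T x / (x ^ 2 + κ ^ 2) ^ 2) by ring, ← hfin]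
  simp only [pow_two (realSol V _ _), two_mul, pow_two (realSolD V _ _ + _)]

end

section
open scoped ENNReal

/-- Lebesgue measure on the half-line. -/
noncomputable abbrev halfLine : Measure ℝ := (volume : Measure ℝ).restrict (Ioi 0)

/-- Schur's test for a symmetric kernel. -/
theorem lintegral_kernel_sq_le {α : Type*} [MeasurableSpace α] {μ : Measure α} [SFinite μ]
    {k : α → α → ℝ≥0∞} {M : ℝ≥0∞} {F : α → ℝ≥0∞} (hk : Measurable (Function.uncurry k))
    (hsymm : ∀ x y, k x y = k y x) (hM : ∀ x, ∫⁻ y, k x y ∂μ ≤ M) (hF : AEMeasurable F μ) :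
    ∫⁻ x, (∫⁻ y, k x y * F y ∂μ) ^ 2 ∂μ ≤ M ^ 2 * ∫⁻ y, F y ^ 2 ∂μ := by
  have hkx : ∀ x, Measurable (k x) := fun x => hk.of_uncurry_left
  have hx : ∀ x, (∫⁻ y, k x y * F y ∂μ) ^ 2 ≤ M * ∫⁻ y, k x y * F y ^ 2 ∂μ := by
    intro x
    have h1 := ENNReal.lintegral_mul_norm_pow_le (μ := μ) (hkx x).aemeasurable
      ((hkx x).aemeasurable.mul (hF.pow_const 2)) (p := 1 / 2) (q := 1 / 2) (by norm_num)
      (by norm_num) (by norm_num)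
    have h2 : ∀ y, k x y * F y = k x y ^ (1 / 2 : ℝ) * (k x y * F y ^ 2) ^ (1 / 2 : ℝ) := by
      intro y
      rw [← ENNReal.mul_rpow_of_nonneg _ _ (by norm_num), ← mul_assoc, ← pow_two, ← mul_pow,
        ← ENNReal.rpow_natCast, ← ENNReal.rpow_mul]
      norm_num
    have h3 : ∀ a : ℝ≥0∞, (a ^ (1 / 2 : ℝ)) ^ 2 = a := fun a => by
      rw [← ENNReal.rpow_natCast, ← ENNReal.rpow_mul]; norm_num
    calc (∫⁻ y, k x y * F y ∂μ) ^ 2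
        = (∫⁻ y, k x y ^ (1 / 2 : ℝ) * (k x y * F y ^ 2) ^ (1 / 2 : ℝ) ∂μ) ^ 2 := by
          simp_rw [← h2]
      _ ≤ ((∫⁻ y, k x y ∂μ) ^ (1 / 2 : ℝ) * (∫⁻ y, k x y * F y ^ 2 ∂μ) ^ (1 / 2 : ℝ)) ^ 2 := by
          gcongr
          exact h1
      _ = (∫⁻ y, k x y ∂μ) * ∫⁻ y, k x y * F y ^ 2 ∂μ := by rw [mul_pow, h3, h3]
      _ ≤ _ := by gcongr; exact hM x
  have hm : AEMeasurable (Function.uncurry fun x y => k x y * F y ^ 2) (μ.prod μ) :=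
    hk.aemeasurable.mul ((hF.pow_const 2).comp_quasiMeasurePreserving Measure.quasiMeasurePreserving_snd)
  calc ∫⁻ x, (∫⁻ y, k x y * F y ∂μ) ^ 2 ∂μ
      ≤ ∫⁻ x, M * ∫⁻ y, k x y * F y ^ 2 ∂μ ∂μ := lintegral_mono hx
    _ = M * ∫⁻ x, ∫⁻ y, k x y * F y ^ 2 ∂μ ∂μ := lintegral_const_mul'' _ hm.lintegral_prod_right'
    _ = M * ∫⁻ y, ∫⁻ x, k x y * F y ^ 2 ∂μ ∂μ := by rw [lintegral_lintegral_swap hm]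
    _ = M * ∫⁻ y, (∫⁻ x, k y x ∂μ) * F y ^ 2 ∂μ := by
      congr 1
      refine lintegral_congr fun y => ?_
      rw [← lintegral_mul_const _ (hkx y)]
      simp_rw [hsymm y]
    _ ≤ M * ∫⁻ y, M * F y ^ 2 ∂μ := by
      gcongr with y
      exact hM y
    _ = M ^ 2 * ∫⁻ y, F y ^ 2 ∂μ := by
      rw [lintegral_const_mul'' _ (hF.pow_const 2), pow_two, mul_assoc]

/-- An exponentially decaying continuous kernel on the half-line. -/
structure IsDecayingKernel (K : ℝ → ℝ → ℝ) (C κ : ℝ) : Prop where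
  continuousOn : ContinuousOn (Function.uncurry K) (Ioi 0 ×ˢ Ioi 0)
  decay_pos : 0 < κ
  bound : ∀ x > 0, ∀ y > 0, |K x y| ≤ C * Real.exp (-(κ * |x - y|))

/-- The majorant of an exponentially decaying kernel. -/
noncomputable def decayMajorant (C κ x y : ℝ) : ℝ≥0∞ :=
  ENNReal.ofReal (C * Real.exp (-(κ * |x - y|)))

theorem decayMajorant_measurable (C κ : ℝ) :
    Measurable (Function.uncurry (decayMajorant C κ)) := by
  unfold decayMajorant Function.uncurry
  fun_prop

theorem decayMajorant_symm (C κ x y : ℝ) : decayMajorant C κ x y = decayMajorant C κ y x := by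
  rw [decayMajorant, decayMajorant, abs_sub_comm]

theorem integrable_exp_neg_mul_abs {κ : ℝ} (hκ : 0 < κ) :
    Integrable fun x : ℝ => Real.exp (-(κ * |x|)) := by
  have h := exp_neg_integrableOn_Ioi 0 hκ
  have h2 := ((integrableOn_Ici_iff_integrableOn_Ioi (by simp)).2 h).congr_fun (g := fun x : ℝ =>
    Real.exp (-(κ * |x|))) (fun x hx => by
      simp only [abs_of_nonneg (show (0 : ℝ) ≤ x from hx)]; ring_nf) measurableSet_Ici
  rw [← integrableOn_univ, ← Iic_union_Ici (a := (0 : ℝ))]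
  refine IntegrableOn.union ?_ h2
  have h3 := (Measure.measurePreserving_neg (volume : Measure ℝ)).integrableOn_comp_preimage
    (Homeomorph.neg ℝ).measurableEmbedding (s := Ici 0) (f := fun x : ℝ => Real.exp (-(κ * |x|)))
  have h4 := h3.2 h2
  simpa [Function.comp_def] using h4

/-- The total mass of the majorant. -/
noncomputable def decayMass (C κ : ℝ) : ℝ≥0∞ :=
  ∫⁻ y : ℝ, ENNReal.ofReal (C * Real.exp (-(κ * |y|)))

theorem decayMass_lt_top (C : ℝ) {κ : ℝ} (hκ : 0 < κ) : decayMass C κ < ∞ := by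
  refine lt_of_le_of_lt ?_ ((integrable_exp_neg_mul_abs hκ).const_mul C).2
  exact lintegral_mono fun y => Real.ofReal_le_enorm _

theorem lintegral_decayMajorant_le (C κ x : ℝ) :
    ∫⁻ y, decayMajorant C κ x y ∂halfLine ≤ decayMass C κ := by
  refine (setLIntegral_le_lintegral _ _).trans (le_of_eq ?_)
  exact lintegral_sub_left_eq_self (fun z => ENNReal.ofReal (C * Real.exp (-(κ * |z|)))) x

theorem lintegral_decayMajorant_mul_le (C κ x : ℝ) {F : ℝ → ℝ≥0∞} :
    ∫⁻ y, decayMajorant C κ x y * F y ∂halfLine ≤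
      decayMass (C ^ 2) (2 * κ) + ∫⁻ y, F y ^ 2 ∂halfLine := by
  have h : ∀ y, decayMajorant C κ x y * F y ≤ decayMajorant (C ^ 2) (2 * κ) x y + F y ^ 2 := by
    intro y
    have h1 : decayMajorant C κ x y ^ 2 ≤ decayMajorant (C ^ 2) (2 * κ) x y := by
      rw [decayMajorant, decayMajorant]
      rcases le_total 0 C with hC | hC
      · rw [← ENNReal.ofReal_pow (by positivity), mul_pow, ← Real.exp_nat_mul]
        apply le_of_eq
        congr 3
        push_cast; ring
      · rw [ENNReal.ofReal_of_nonpos (mul_nonpos_of_nonpos_of_nonneg hC (Real.exp_pos _).le)]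
        simp
    refine le_trans ?_ (add_le_add_left h1 _)
    rcases le_total (decayMajorant C κ x y) (F y) with h2 | h2
    · exact (mul_le_mul_left h2 _).trans (by rw [← pow_two]; exact le_add_self)
    · exact (mul_le_mul_right h2 _).trans (by rw [← pow_two]; exact le_self_add)
  refine (lintegral_mono h).trans ?_
  rw [lintegral_add_left (decayMajorant_measurable _ _).of_uncurry_left]
  gcongr
  exact lintegral_decayMajorant_le _ _ x

theorem lintegral_enorm_sq_eq {f : ℝ → ℂ} {μ : Measure ℝ} :
    ∫⁻ y, ‖f y‖ₑ ^ 2 ∂μ = eLpNorm f 2 μ ^ 2 := by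
  have h := eLpNorm_nnreal_pow_eq_lintegral (μ := μ) (f := f) (p := 2) two_ne_zero
  norm_num at h
  exact_mod_cast h.symm

theorem lintegral_enorm_sq_lt_top (f : L2On (Ioi 0)) : ∫⁻ y, ‖f y‖ₑ ^ 2 ∂halfLine < ∞ := by
  rw [lintegral_enorm_sq_eq]
  exact ENNReal.pow_lt_top (Lp.memLp f).2

namespace IsDecayingKernel
variable {K : ℝ → ℝ → ℝ} {C κ : ℝ}

theorem aestronglyMeasurable (hK : IsDecayingKernel K C κ) :
    AEStronglyMeasurable (Function.uncurry K) (halfLine.prod halfLine) := by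
  rw [Measure.prod_restrict]
  exact hK.continuousOn.aestronglyMeasurable (measurableSet_Ioi.prod measurableSet_Ioi)

theorem aestronglyMeasurable_row (hK : IsDecayingKernel K C κ) {x : ℝ} (hx : 0 < x) :
    AEStronglyMeasurable (K x) halfLine := by
  refine ContinuousOn.aestronglyMeasurable (fun y hy => ?_) measurableSet_Ioi
  exact (hK.continuousOn (x, y) ⟨hx, hy⟩).comp (f := fun y => (x, y)) (by fun_prop)
    fun z hz => ⟨hx, hz⟩

theorem swap (hK : IsDecayingKernel K C κ) : IsDecayingKernel (fun x y => K y x) C κ :=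
  ⟨hK.continuousOn.comp continuous_swap.continuousOn fun p hp => ⟨hp.2, hp.1⟩, hK.decay_pos,
    fun x hx y hy => by rw [abs_sub_comm]; exact hK.bound y hy x hx⟩

theorem enorm_le (hK : IsDecayingKernel K C κ) {x y : ℝ} (hx : 0 < x) (hy : 0 < y) :
    ‖(K x y : ℂ)‖ₑ ≤ decayMajorant C κ x y := by
  rw [← ofReal_norm, Complex.norm_real]
  exact ENNReal.ofReal_le_ofReal (hK.bound x hx y hy)

theorem lintegral_enorm_mul_le (hK : IsDecayingKernel K C κ) (f : ℝ → ℂ) {x : ℝ} (hx : 0 < x) :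
    ∫⁻ y, ‖(K x y : ℂ) * f y‖ₑ ∂halfLine ≤ ∫⁻ y, decayMajorant C κ x y * ‖f y‖ₑ ∂halfLine := by
  refine lintegral_mono_ae ?_
  filter_upwards [ae_restrict_mem measurableSet_Ioi] with y hy
  rw [enorm_mul]
  gcongr
  exact hK.enorm_le hx hy

theorem integrable_mul (hK : IsDecayingKernel K C κ) (f : L2On (Ioi 0)) {x : ℝ} (hx : 0 < x) :
    Integrable (fun y => (K x y : ℂ) * f y) halfLine := by
  refine ⟨((Complex.measurable_ofReal.comp_aemeasurable
    (hK.aestronglyMeasurable_row hx).aemeasurable).aestronglyMeasurable).mul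
      (Lp.aestronglyMeasurable f), ?_⟩
  refine ((hK.lintegral_enorm_mul_le f hx).trans
    (lintegral_decayMajorant_mul_le C κ x)).trans_lt ?_
  exact ENNReal.add_lt_top.2 ⟨decayMass_lt_top _ (by linarith [hK.decay_pos]),
    lintegral_enorm_sq_lt_top f⟩

/-- Action of the kernel on a function. -/
noncomputable def apply (_ : IsDecayingKernel K C κ) (f : ℝ → ℂ) (x : ℝ) : ℂ :=
  ∫ y in Ioi (0 : ℝ), (K x y : ℂ) * f y

theorem aestronglyMeasurable_prod (hK : IsDecayingKernel K C κ) {a f : ℝ → ℂ}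
    (ha : AEStronglyMeasurable a halfLine) (hf : AEStronglyMeasurable f halfLine) :
    AEStronglyMeasurable (fun p : ℝ × ℝ => a p.1 * ((K p.1 p.2 : ℂ) * f p.2))
      (halfLine.prod halfLine) :=
  (ha.comp_quasiMeasurePreserving Measure.quasiMeasurePreserving_fst).mul
    ((Complex.measurable_ofReal.comp_aemeasurable
      hK.aestronglyMeasurable.aemeasurable).aestronglyMeasurable.mul
    (hf.comp_quasiMeasurePreserving Measure.quasiMeasurePreserving_snd))

theorem apply_aestronglyMeasurable (hK : IsDecayingKernel K C κ) {f : ℝ → ℂ}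
    (hf : AEStronglyMeasurable f halfLine) : AEStronglyMeasurable (hK.apply f) halfLine := by
  have h := hK.aestronglyMeasurable_prod (a := fun _ => 1) aestronglyMeasurable_const hf
  simp only [one_mul] at h
  exact h.integral_prod_right'

theorem eLpNorm_apply_le (hK : IsDecayingKernel K C κ) (f : L2On (Ioi 0)) :
    eLpNorm (hK.apply f) 2 halfLine ≤ decayMass C κ * eLpNorm f 2 halfLine := by
  have h : eLpNorm (hK.apply f) 2 halfLine ^ 2 ≤
      (decayMass C κ * eLpNorm f 2 halfLine) ^ 2 := by
    rw [mul_pow, ← lintegral_enorm_sq_eq, ← lintegral_enorm_sq_eq]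
    refine le_trans ?_ (lintegral_kernel_sq_le (decayMajorant_measurable C κ)
      (decayMajorant_symm C κ) (lintegral_decayMajorant_le C κ)
      (Lp.aestronglyMeasurable f).enorm)
    refine lintegral_mono_ae ?_
    filter_upwards [ae_restrict_mem measurableSet_Ioi] with x hx
    gcongr
    exact (enorm_integral_le_lintegral_enorm _).trans (hK.lintegral_enorm_mul_le f hx)
  exact (ENNReal.pow_le_pow_left_iff two_ne_zero).1 h

theorem memLp_apply (hK : IsDecayingKernel K C κ) (f : L2On (Ioi 0)) :
    MemLp (hK.apply f) 2 halfLine :=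
  ⟨hK.apply_aestronglyMeasurable (Lp.aestronglyMeasurable f), (hK.eLpNorm_apply_le f).trans_lt
    (ENNReal.mul_lt_top (decayMass_lt_top C hK.decay_pos) (Lp.memLp f).2)⟩

/-- The bounded operator with a given exponentially decaying kernel. -/
noncomputable def toCLM (hK : IsDecayingKernel K C κ) : L2On (Ioi 0) →L[ℂ] L2On (Ioi 0) :=
  LinearMap.mkContinuous
    { toFun := fun f => (hK.memLp_apply f).toLp _
      map_add' := fun f g => by
        rw [← MemLp.toLp_add]
        refine MemLp.toLp_congr _ _ ?_
        filter_upwards [ae_restrict_mem measurableSet_Ioi] with x hx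
        rw [Pi.add_apply, apply, apply, apply,
          ← integral_add (hK.integrable_mul f hx) (hK.integrable_mul g hx)]
        refine integral_congr_ae ?_
        filter_upwards [Lp.coeFn_add f g] with y hy
        rw [hy, Pi.add_apply, mul_add]
      map_smul' := fun c f => by
        rw [RingHom.id_apply, ← MemLp.toLp_const_smul]
        refine MemLp.toLp_congr _ _ (Eventually.of_forall fun x => ?_)
        rw [Pi.smul_apply, apply, apply, smul_eq_mul, ← integral_const_mul]
        refine integral_congr_ae ?_
        filter_upwards [Lp.coeFn_smul c f] with y hy
        rw [hy, Pi.smul_apply, smul_eq_mul]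
        ring }
    (decayMass C κ).toReal fun f => by
      simp only [LinearMap.coe_mk, AddHom.coe_mk, Lp.norm_toLp]
      rw [Lp.norm_def, ← ENNReal.toReal_mul]
      exact ENNReal.toReal_mono
        (ENNReal.mul_lt_top (decayMass_lt_top C hK.decay_pos) (Lp.memLp f).2).ne
        (hK.eLpNorm_apply_le f)

theorem coeFn_toCLM (hK : IsDecayingKernel K C κ) (f : L2On (Ioi 0)) :
    hK.toCLM f =ᵐ[halfLine] hK.apply f := (hK.memLp_apply f).coeFn_toLp

theorem integrable_prod (hK : IsDecayingKernel K C κ) {a : ℝ → ℂ} (ha : Integrable a halfLine)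
    (f : L2On (Ioi 0)) : Integrable (fun p : ℝ × ℝ => a p.1 * ((K p.1 p.2 : ℂ) * f p.2))
      (halfLine.prod halfLine) := by
  have hm := hK.aestronglyMeasurable_prod ha.1 (Lp.aestronglyMeasurable f)
  refine ⟨hm, ?_⟩
  set B := decayMass (C ^ 2) (2 * κ) + ∫⁻ y, ‖f y‖ₑ ^ 2 ∂halfLine with hB
  have hBt : B < ∞ := ENNReal.add_lt_top.2 ⟨decayMass_lt_top _ (by linarith [hK.decay_pos]),
    lintegral_enorm_sq_lt_top f⟩
  rw [HasFiniteIntegral, lintegral_prod _ hm.enorm]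
  calc _ ≤ ∫⁻ x, ‖a x‖ₑ * B ∂halfLine := by
        refine lintegral_mono_ae ?_
        filter_upwards [ae_restrict_mem measurableSet_Ioi] with x hx
        simp only [enorm_mul (a x)]
        rw [lintegral_const_mul' _ _ enorm_ne_top]
        gcongr
        exact (hK.lintegral_enorm_mul_le f hx).trans
          (lintegral_decayMajorant_mul_le C κ x)
    _ = (∫⁻ x, ‖a x‖ₑ ∂halfLine) * B := lintegral_mul_const' _ _ hBt.ne
    _ < ∞ := ENNReal.mul_lt_top ha.2 hBt

/-- Fubini's theorem for an exponentially decaying kernel. -/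
theorem integral_mul_apply (hK : IsDecayingKernel K C κ) {a : ℝ → ℂ} (ha : Integrable a halfLine)
    (f : L2On (Ioi 0)) : ∫ x in Ioi (0 : ℝ), a x * hK.apply f x =
      ∫ y in Ioi (0 : ℝ), (∫ x in Ioi (0 : ℝ), a x * (K x y : ℂ)) * f y := by
  have h := integral_integral_swap (f := fun x y => a x * ((K x y : ℂ) * f y))
    (hK.integrable_prod ha f)
  simp only [integral_const_mul] at h
  rw [show (∫ x in Ioi (0 : ℝ), a x * hK.apply f x) =
    ∫ x in Ioi (0 : ℝ), a x * ∫ y in Ioi (0 : ℝ), (K x y : ℂ) * f y from rfl, h]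
  simp only [← integral_mul_const, mul_assoc]

end IsDecayingKernel
end

section
variable {V φ dφ ψ dψ : ℝ → ℝ} {κ : ℝ}

theorem HasACDeriv.hasDerivAt_of_continuousOn {u v : ℝ → ℂ} {b : ℝ} (h : HasACDeriv u v 0 b)
    (hc : ContinuousOn v (Icc 0 b)) {x : ℝ} (hx : x ∈ Ioo 0 b) : HasDerivAt u (v x) x := by
  have hsub : ∀ y ∈ Icc 0 b, uIcc 0 y ⊆ Icc 0 b := fun y hy => by
    rw [uIcc_of_le hy.1]; exact Icc_subset_Icc le_rfl hy.2
  have hii : ∀ y ∈ Icc 0 b, IntervalIntegrable v volume 0 y := fun y hy =>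
    (hc.mono (hsub y hy)).intervalIntegrable
  have h1 : ∀ y ∈ Icc 0 b, u y = u 0 + ∫ t in (0 : ℝ)..y, v t := by
    intro y hy
    rw [(h.mono (by rw [uIcc_of_le (hy.1.trans hy.2)]; exact hsub y hy)).integral_eq_sub (hii y hy)]
    ring
  have h3 : HasDerivAt (fun y => u 0 + ∫ t in (0 : ℝ)..y, v t) (v x) x := by
    refine HasDerivAt.const_add _ (intervalIntegral.integral_hasDerivAt_right ?_ ?_ ?_)
    · exact hii x (Ioo_subset_Icc_self hx)
    · exact (hc.mono Ioo_subset_Icc_self).stronglyMeasurableAtFilter isOpen_Ioo x hx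
    · exact hc.continuousAt (Icc_mem_nhds hx.1 hx.2)
  refine h3.congr_of_eventuallyEq ?_
  filter_upwards [Icc_mem_nhds hx.1 hx.2] with y hy using h1 y hy

theorem setIntegral_Ioi_eq_add {E : Type*} [NormedAddCommGroup E] [NormedSpace ℝ E] {F : ℝ → E}
    {a x : ℝ} (hx : a ≤ x) (hF : IntegrableOn F (Ioi a)) :
    ∫ y in Ioi a, F y = (∫ y in a..x, F y) + ∫ y in Ioi x, F y := by
  rw [← Ioc_union_Ioi_eq_Ioi hx, setIntegral_union (Ioc_disjoint_Ioi le_rfl) measurableSet_Ioi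
    (hF.mono_set Ioc_subset_Ioi_self) (hF.mono_set (Ioi_subset_Ioi hx)),
    ← intervalIntegral.integral_of_le hx]

/-- `φ` is the regular and `ψ` the decaying solution of `-u'' + V u = -κ² u` on the half-line,
with Wronskian one. -/
structure IsGreenPair (V : ℝ → ℝ) (κ : ℝ) (φ dφ ψ dψ : ℝ → ℝ) : Prop where
  pos : 0 < κ
  fst : ∀ b, 0 ≤ b → HasACDeriv φ dφ 0 b
  fst_deriv : ∀ b, 0 ≤ b → HasACDeriv dφ (fun x => (V x + κ ^ 2) * φ x) 0 b
  snd : ∀ b, 0 ≤ b → HasACDeriv ψ dψ 0 b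
  snd_deriv : ∀ b, 0 ≤ b → HasACDeriv dψ (fun x => (V x + κ ^ 2) * ψ x) 0 b
  fst_zero : φ 0 = 0
  le_fst : ∀ x, 0 ≤ x → x ≤ φ x
  wronskian : ∀ x, 0 ≤ x → dφ x * ψ x - φ x * dψ x = 1
  bound : ∀ x y, 0 ≤ x → x ≤ y → |φ x * ψ y| ≤ 1 / (2 * κ) * Real.exp (-(κ * (y - x)))

/-- The Green's function `φ(x ∧ y) ψ(x ∨ y)`. -/
noncomputable def greenKernel (φ ψ : ℝ → ℝ) (x y : ℝ) : ℝ := φ (min x y) * ψ (max x y)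

namespace IsGreenPair

theorem isDecayingKernel (h : IsGreenPair V κ φ dφ ψ dψ) :
    IsDecayingKernel (greenKernel φ ψ) (1 / (2 * κ)) κ := by
  refine ⟨?_, h.pos, fun x hx y hy => ?_⟩
  · unfold greenKernel Function.uncurry
    refine ((HasACDeriv.continuousOn_Ici h.fst).comp (by fun_prop) fun p hp => ?_).mul
      ((HasACDeriv.continuousOn_Ici h.snd).comp (by fun_prop) fun p hp => ?_)
    · exact le_min (mem_Ioi.1 hp.1).le (mem_Ioi.1 hp.2).le
    · exact le_max_of_le_left (mem_Ioi.1 hp.1).le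
  · have h1 := h.bound (min x y) (max x y) (le_min hx.le hy.le) min_le_max
    rwa [max_sub_min_eq_abs' x y] at h1

section Apply
variable {f : L2On (Ioi 0)}

theorem _root_.intervalIntegrable_coeFn_L2 (f : L2On (Ioi 0)) {b : ℝ} (hb : 0 ≤ b) :
    IntervalIntegrable f volume 0 b := by
  rw [intervalIntegrable_iff_integrableOn_Ioc_of_le hb]
  have h : MemLp f 2 ((volume : Measure ℝ).restrict (Ioc 0 b)) :=
    (Lp.memLp f).mono_measure (Measure.restrict_mono Ioc_subset_Ioi_self le_rfl)
  exact h.integrable (by norm_num)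

theorem intervalIntegrable_mul {g dg : ℝ → ℝ} (hg : ∀ b, 0 ≤ b → HasACDeriv g dg 0 b)
    (f : L2On (Ioi 0)) {b : ℝ} (hb : 0 ≤ b) :
    IntervalIntegrable (fun y => (g y : ℂ) * f y) volume 0 b :=
  (intervalIntegrable_coeFn_L2 f hb).continuousOn_mul (hg b hb).ofReal.continuousOn

theorem integrable_snd_mul (h : IsGreenPair V κ φ dφ ψ dψ) (f : L2On (Ioi 0)) :
    IntegrableOn (fun y => (ψ y : ℂ) * f y) (Ioi 0) := by
  refine IntegrableOn.mono_set (t := Ioc 0 1 ∪ Ioi 1) (IntegrableOn.union ?_ ?_)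
    (Ioc_union_Ioi_eq_Ioi zero_le_one).ge
  · exact (intervalIntegrable_iff_integrableOn_Ioc_of_le zero_le_one).1
      (intervalIntegrable_mul h.snd f zero_le_one)
  · have h1 : IntegrableOn (fun y => (greenKernel φ ψ 1 y : ℂ) * f y) (Ioi 1) :=
      (h.isDecayingKernel.integrable_mul f one_pos).mono_measure
        (Measure.restrict_mono (Ioi_subset_Ioi zero_le_one) le_rfl)
    have hφ : (φ 1 : ℂ) ≠ 0 := by
      have := h.le_fst 1 zero_le_one
      rw [Complex.ofReal_ne_zero]; linarith
    refine IntegrableOn.congr_fun (h1.const_mul ((φ 1 : ℂ)⁻¹)) (fun y hy => ?_) measurableSet_Ioi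
    simp only [greenKernel, min_eq_left (mem_Ioi.1 hy).le, max_eq_right (mem_Ioi.1 hy).le]
    push_cast
    field_simp

/-- The solution of `-u'' + V u + κ² u = f` with `u(0) = 0`. -/
noncomputable def _root_.greenSolution (φ ψ a b : ℝ → ℝ) (f : ℝ → ℂ) (x : ℝ) : ℂ :=
  b x * (∫ y in (0 : ℝ)..x, (φ y : ℂ) * f y) +
    a x * ((∫ y in Ioi (0 : ℝ), (ψ y : ℂ) * f y) - ∫ y in (0 : ℝ)..x, (ψ y : ℂ) * f y)

theorem apply_eq (h : IsGreenPair V κ φ dφ ψ dψ) (f : L2On (Ioi 0)) {x : ℝ} (hx : 0 < x) :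
    h.isDecayingKernel.apply f x = greenSolution φ ψ φ ψ f x := by
  have h0 := h.integrable_snd_mul f
  have hi := h.isDecayingKernel.integrable_mul f hx
  rw [IsDecayingKernel.apply, greenSolution, setIntegral_Ioi_eq_add hx.le hi,
    setIntegral_Ioi_eq_add hx.le h0, add_sub_cancel_left]
  congr 1
  · rw [← intervalIntegral.integral_const_mul]
    refine intervalIntegral.integral_congr fun y hy => ?_
    rw [uIcc_of_le hx.le] at hy
    simp only [greenKernel, min_eq_right hy.2, max_eq_left hy.2]
    push_cast; ring
  · rw [← integral_const_mul]
    refine setIntegral_congr_fun measurableSet_Ioi fun y hy => ?_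
    simp only [greenKernel, min_eq_left (mem_Ioi.1 hy).le, max_eq_right (mem_Ioi.1 hy).le]
    push_cast; ring

theorem greenSolution_hasACDeriv (h : IsGreenPair V κ φ dφ ψ dψ) (f : L2On (Ioi 0)) {b : ℝ}
    (hb : 0 ≤ b) : HasACDeriv (greenSolution φ ψ φ ψ f) (greenSolution φ ψ dφ dψ f) 0 b := by
  have hP := HasACDeriv.integral (intervalIntegrable_mul h.fst f hb) left_mem_uIcc
  have hQ := HasACDeriv.integral (intervalIntegrable_mul h.snd f hb) left_mem_uIcc
  refine ((((h.snd b hb).ofReal).mul hP).add (((h.fst b hb).ofReal).mul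
    ((HasACDeriv.const _).sub hQ))).congr_deriv (Eventually.of_forall fun x _ => ?_)
  simp only [greenSolution]
  ring

theorem greenSolution_deriv_hasACDeriv (h : IsGreenPair V κ φ dφ ψ dψ) (f : L2On (Ioi 0)) {b : ℝ}
    (hb : 0 ≤ b) : HasACDeriv (greenSolution φ ψ dφ dψ f)
      (fun x => (V x : ℂ) * greenSolution φ ψ φ ψ f x -
        (f x - (κ : ℂ) ^ 2 * greenSolution φ ψ φ ψ f x)) 0 b := by
  have hP := HasACDeriv.integral (intervalIntegrable_mul h.fst f hb) left_mem_uIcc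
  have hQ := HasACDeriv.integral (intervalIntegrable_mul h.snd f hb) left_mem_uIcc
  refine ((((h.snd_deriv b hb).ofReal).mul hP).add (((h.fst_deriv b hb).ofReal).mul
    ((HasACDeriv.const _).sub hQ))).congr_deriv (Eventually.of_forall fun x hx => ?_)
  rw [uIcc_of_le hb] at hx
  have hW : (dφ x : ℂ) * ψ x - φ x * dψ x = 1 := by exact_mod_cast h.wronskian x hx.1
  simp only [greenSolution]
  push_cast
  linear_combination (-f x) * hW

theorem mem_dirichletGraph (h : IsGreenPair V κ φ dφ ψ dψ) (f : L2On (Ioi 0)) :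
    (h.isDecayingKernel.toCLM f, f - (κ : ℂ) ^ 2 • h.isDecayingKernel.toCLM f) ∈
      dirichletGraph V (Ioi 0) := by
  have hcl : closure (Ioi (0 : ℝ)) = Ici 0 := closure_Ioi 0
  have hfr : frontier (Ioi (0 : ℝ)) = {0} := frontier_Ioi
  have hu := fun b (hb : 0 ≤ b) => h.greenSolution_hasACDeriv f hb
  have hv := fun b (hb : 0 ≤ b) => h.greenSolution_deriv_hasACDeriv f hb
  have hae : h.isDecayingKernel.toCLM f =ᵐ[halfLine] greenSolution φ ψ φ ψ f := by
    filter_upwards [h.isDecayingKernel.coeFn_toCLM f, ae_restrict_mem measurableSet_Ioi]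
      with x hx hx0
    rw [hx, h.apply_eq f hx0]
  have hsub : ∀ {a b : ℝ}, a ∈ Ici (0 : ℝ) → b ∈ Ici (0 : ℝ) → uIcc a b ⊆ uIcc 0 (max a b) := by
    intro a b ha hb
    rw [uIcc_of_le (le_max_of_le_left ha)]
    exact Icc_subset_Icc (le_min ha hb) le_rfl
  refine ⟨greenSolution φ ψ φ ψ f, greenSolution φ ψ dφ dψ f, ⟨?_, ?_, ?_, ?_, ?_⟩, hae⟩
  · intro a ha b hb
    rw [hcl] at ha hb
    exact ((hu _ (le_max_of_le_left ha)).mono (hsub ha hb)).ac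
  · intro a ha b hb
    rw [hcl] at ha hb
    exact ((hv _ (le_max_of_le_left ha)).mono (hsub ha hb)).ac
  · intro x hx
    rw [hfr, mem_singleton_iff] at hx
    simp [hx, greenSolution, h.fst_zero]
  · intro x hx
    have hx' : (0 : ℝ) ≤ x + 1 := add_nonneg (le_of_lt hx) zero_le_one
    have hc := (hv (x + 1) hx').continuousOn
    rw [uIcc_of_le hx'] at hc
    exact (hu (x + 1) hx').hasDerivAt_of_continuousOn hc ⟨hx, by linarith⟩
  · have hs := Lp.coeFn_sub f ((κ : ℂ) ^ 2 • h.isDecayingKernel.toCLM f)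
    have hm := Lp.coeFn_smul ((κ : ℂ) ^ 2) (h.isDecayingKernel.toCLM f)
    filter_upwards [HasACDeriv.ae_Ioi hv, hae, hs, hm] with x h1 h2 h3 h4
    refine h1.congr_deriv ?_
    rw [h3, Pi.sub_apply, h4, Pi.smul_apply, h2, smul_eq_mul]

end Apply

end IsGreenPair

/-- A square integrable solution with `u(0) = 0` at negative energy vanishes. -/
theorem IsShortRange.eq_zero_of_mem_dirichletGraph (hV : IsShortRange V) (κ : ℝ)
    {d : L2On (Ioi 0)} (hd : (d, -((κ : ℂ) ^ 2 • d)) ∈ dirichletGraph V (Ioi 0)) : d = 0 := by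
  obtain ⟨u, v, h, hu⟩ := hd
  have hcl : closure (Ioi (0 : ℝ)) = Ici 0 := closure_Ioi 0
  simp only at h hu
  have hsol : ∀ b, 0 ≤ b → IsLinSol (fun x => (V x : ℂ) - ((-κ ^ 2 : ℝ) : ℂ)) u v b := by
    intro b hb
    have h0 : (0 : ℝ) ∈ closure (Ioi (0 : ℝ)) := by rw [hcl]; exact self_mem_Ici
    have hb' : b ∈ closure (Ioi (0 : ℝ)) := by rw [hcl]; exact hb
    have hsub : ∀ {p : ℝ → Prop}, (∀ᵐ x ∂halfLine, p x) → ∀ᵐ x, x ∈ uIcc 0 b → p x :=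
      fun hp => ae_uIcc_of_ae_restrict_Ioo hb
        (ae_restrict_of_ae_restrict_of_subset Ioo_subset_Ioi_self hp)
    refine ⟨⟨h.ac_fst 0 h0 b hb', hsub ?_⟩, ⟨h.ac_snd 0 h0 b hb', hsub ?_⟩⟩
    · filter_upwards [ae_restrict_mem measurableSet_Ioi] with x hx using h.deriv_fst x hx
    · filter_upwards [h.deriv_snd, hu, Lp.coeFn_smul ((κ : ℂ) ^ 2) d,
        Lp.coeFn_neg ((κ : ℂ) ^ 2 • d)] with x h1 h2 h3 h4
      refine h1.congr_deriv ?_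
      rw [h4, Pi.neg_apply, h3, Pi.smul_apply, h2, smul_eq_mul]
      push_cast
      ring
  have hu0 : u 0 = 0 := h.boundary 0 (by rw [frontier_Ioi]; rfl)
  have key : ∀ x, 0 ≤ x → u x = v 0 * regSol V ((-κ ^ 2 : ℝ) : ℂ) x := fun x hx =>
    ((hsol x hx).eq_regSol hx (hV.intervalIntegrable 0 x) hu0 ⟨hx, le_rfl⟩).1
  by_cases hv0 : v 0 = 0
  · refine (Lp.eq_zero_iff_ae_eq_zero).2 ?_
    filter_upwards [hu, ae_restrict_mem measurableSet_Ioi] with x h1 h2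
    rw [h1, key x (le_of_lt h2), hv0, zero_mul]; rfl
  · exfalso
    have hm : MemLp (fun _ : ℝ => ‖v 0‖) 2 ((volume : Measure ℝ).restrict (Ioi 1)) := by
      refine ((Lp.memLp d).mono_measure
        (Measure.restrict_mono (Ioi_subset_Ioi zero_le_one) le_rfl)).mono
        aestronglyMeasurable_const ?_
      filter_upwards [ae_restrict_of_ae_restrict_of_subset (Ioi_subset_Ioi zero_le_one) hu,
        ae_restrict_mem measurableSet_Ioi] with x h1 hx
      have hx0 : 0 ≤ x := zero_le_one.trans (le_of_lt hx)
      have h2 := (realSol_ge hx0 (hV.intervalIntegrable 0 x) hV.nonneg (s := -κ ^ 2)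
        (by nlinarith [sq_nonneg κ])).1 x ⟨hx0, le_rfl⟩
      rw [norm_norm, h1, key x hx0, (regSol_ofReal hx0 (hV.intervalIntegrable 0 x) _).1, norm_mul,
        Complex.norm_real, Real.norm_eq_abs, abs_of_nonneg (hx0.trans h2)]
      have : 1 ≤ realSol V (-κ ^ 2) x := (le_of_lt hx).trans h2
      exact le_mul_of_one_le_right (norm_nonneg _) this
    rw [memLp_const_iff (by norm_num) (by norm_num)] at hm
    simp [hv0] at hm

theorem IsGreenPair.isResolventAt (hV : IsShortRange V) (h : IsGreenPair V κ φ dφ ψ dψ) {s : ℝ}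
    (hs : s = κ ^ 2) :
    IsResolventAt (dirichletSchrodinger V (Ioi 0)) (-(s : ℂ)) h.isDecayingKernel.toCLM := by
  have hgr := dirichletSchrodinger_graph V (isOpen_Ioi (a := (0 : ℝ)))
  have hs' : (s : ℂ) = (κ : ℂ) ^ 2 := by rw [hs]; push_cast; ring
  set A := dirichletSchrodinger V (Ioi 0)
  set R := h.isDecayingKernel.toCLM
  have hR : ∀ f, ∃ hf : R f ∈ A.domain, A ⟨R f, hf⟩ = f - (κ : ℂ) ^ 2 • R f := by
    intro f
    have h1 := h.mem_dirichletGraph f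
    rw [← hgr, LinearPMap.mem_graph_iff] at h1
    obtain ⟨y, hy1, hy2⟩ := h1
    simp only at hy1 hy2
    refine ⟨hy1 ▸ y.2, ?_⟩
    rw [← hy2]
    congr 1
    exact Subtype.ext hy1.symm
  refine ⟨fun f => ?_, fun f => ?_⟩
  · obtain ⟨hf, h1⟩ := hR f
    refine ⟨hf, ?_⟩
    rw [h1, hs', neg_smul]
    abel
  · set g := A f - -(s : ℂ) • (f : L2On (Ioi 0)) with hg
    have h1 : (R g, g - (κ : ℂ) ^ 2 • R g) ∈ dirichletGraph V (Ioi 0) := h.mem_dirichletGraph g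
    have h2 : ((f : L2On (Ioi 0)), A f) ∈ dirichletGraph V (Ioi 0) := by
      rw [← hgr]; exact LinearPMap.mem_graph A f
    have h3 := (dirichletGraph V (Ioi 0)).sub_mem h1 h2
    have h4 : (R g - f : L2On (Ioi 0)) = 0 := by
      refine hV.eq_zero_of_mem_dirichletGraph κ ?_
      convert h3 using 1
      refine Prod.ext rfl ?_
      simp only [Prod.snd_sub, hg, hs', smul_sub, neg_smul]
      abel
    exact sub_eq_zero.1 h4

end

section
variable {V : ℝ → ℝ} {κ : ℝ}

theorem isGreenPair_zero (hκ : 0 < κ) : IsGreenPair (fun _ => 0) κ (fun x => Real.sinh (κ * x) / κ)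
    (fun x => Real.cosh (κ * x)) (fun x => Real.exp (-(κ * x)))
    (fun x => -κ * Real.exp (-(κ * x))) := by
  have hk : ∀ x : ℝ, HasDerivAt (fun x => κ * x) κ x := fun x => by
    simpa using (hasDerivAt_id x).const_mul κ
  refine ⟨hκ, fun b _ => ?_, fun b _ => ?_, fun b _ => ?_, fun b _ => ?_, by simp, fun x hx => ?_,
    fun x _ => ?_, fun x y hx hxy => ?_⟩
  · refine HasACDeriv.of_hasDerivAt (fun x _ => ?_) (by fun_prop)
    refine ((hk x).sinh.div_const κ).congr_deriv ?_
    field_simp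
  · refine HasACDeriv.of_hasDerivAt (fun x _ => ?_) (by fun_prop)
    refine (hk x).cosh.congr_deriv ?_
    field_simp
    ring
  · refine HasACDeriv.of_hasDerivAt (fun x _ => ?_) (by fun_prop)
    refine (hk x).neg.exp.congr_deriv ?_
    simp only [Pi.neg_apply]
    ring
  · refine HasACDeriv.of_hasDerivAt (fun x _ => ?_) (by fun_prop)
    refine ((hk x).neg.exp.const_mul (-κ)).congr_deriv ?_
    simp only [Pi.neg_apply]
    ring
  · rw [le_div_iff₀ hκ, mul_comm]
    exact Real.self_le_sinh_iff.2 (by positivity)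
  · have h1 : Real.cosh (κ * x) + Real.sinh (κ * x) = Real.exp (κ * x) := Real.cosh_add_sinh _
    have h2 : Real.exp (κ * x) * Real.exp (-(κ * x)) = 1 := by rw [← Real.exp_add]; simp
    rw [← h2, ← h1]
    field_simp
    ring
  · have h1 : 0 ≤ Real.sinh (κ * x) := Real.sinh_nonneg_iff.2 (by positivity)
    rw [abs_of_nonneg (by positivity), show -(κ * (y - x)) = κ * x + -(κ * y) by ring, Real.exp_add,
      ← mul_assoc]
    refine mul_le_mul_of_nonneg_right ?_ (Real.exp_pos _).le
    rw [Real.sinh_eq, div_mul_eq_mul_div, one_mul, div_div]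
    gcongr
    linarith [Real.exp_pos (-(κ * x))]

namespace IsShortRange

theorem expSol (hV : IsShortRange V) (κ : ℝ) {b : ℝ} (hb : 0 ≤ b) :
    HasACDeriv (realSol V (-κ ^ 2)) (realSolD V (-κ ^ 2)) 0 b ∧
    HasACDeriv (realSolD V (-κ ^ 2)) (fun x => (V x + κ ^ 2) * realSol V (-κ ^ 2) x) 0 b :=
  ⟨realSol_hasACDeriv hb (hV.intervalIntegrable 0 b) _,
    (realSolD_hasACDeriv hb (hV.intervalIntegrable 0 b) _).congr_deriv
      (Eventually.of_forall fun x _ => by ring)⟩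

theorem le_expSol (hV : IsShortRange V) (κ : ℝ) {x : ℝ} (hx : 0 ≤ x) :
    x ≤ realSol V (-κ ^ 2) x ∧ 1 ≤ realSolD V (-κ ^ 2) x := by
  have h := realSol_ge hx (hV.intervalIntegrable 0 x) hV.nonneg (s := -κ ^ 2)
    (by nlinarith [sq_nonneg κ])
  exact ⟨h.1 x ⟨hx, le_rfl⟩, h.2 x ⟨hx, le_rfl⟩⟩

theorem expSol_lt (hV : IsShortRange V) (κ : ℝ) {x : ℝ} (hx : 0 ≤ x) :
    κ * realSol V (-κ ^ 2) x < realSolD V (-κ ^ 2) x := by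
  obtain ⟨h1, h2⟩ := hV.expSol κ hx
  have hF := (h2.sub ((HasACDeriv.const κ).mul h1)).mul
    ((HasACDeriv.const κ).mul HasACDeriv.id).exp
  have h3 := hF.le_of_nonneg hx (Eventually.of_forall fun t ht => by
    have h4 : 0 ≤ V t * realSol V (-κ ^ 2) t * Real.exp (κ * t) :=
      mul_nonneg (mul_nonneg (hV.nonneg t) (ht.1.trans (hV.le_expSol κ ht.1).1)) (Real.exp_pos _).le
    refine h4.trans (le_of_eq ?_)
    ring)
  simp only [realSolD_zero, realSol_zero, mul_zero, sub_zero, Real.exp_zero, mul_one] at h3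
  have h5 := Real.exp_pos (κ * x)
  by_contra! h
  nlinarith

theorem expSol_growth (hV : IsShortRange V) (κ : ℝ) {x y : ℝ} (hx : 0 ≤ x) (hxy : x ≤ y) :
    realSol V (-κ ^ 2) x ≤ realSol V (-κ ^ 2) y * Real.exp (-(κ * (y - x))) := by
  have h1 := ((hV.expSol κ (hx.trans hxy)).1.mul
    ((HasACDeriv.const (-κ)).mul HasACDeriv.id).exp).mono (c := x) (d := y) (by
      rw [uIcc_of_le hxy, uIcc_of_le (hx.trans hxy)]; exact Icc_subset_Icc hx le_rfl)
  have h2 := h1.le_of_nonneg hxy (Eventually.of_forall fun t ht => by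
    have h3 := hV.expSol_lt κ (hx.trans ht.1)
    have h4 : 0 ≤ (realSolD V (-κ ^ 2) t - κ * realSol V (-κ ^ 2) t) * Real.exp (-κ * t) :=
      mul_nonneg (by linarith) (Real.exp_pos _).le
    refine h4.trans (le_of_eq ?_)
    ring)
  have h3 := mul_le_mul_of_nonneg_right h2 (Real.exp_pos (κ * x)).le
  rw [mul_assoc, mul_assoc, ← Real.exp_add, ← Real.exp_add] at h3
  rwa [show -κ * x + κ * x = 0 by ring, Real.exp_zero, mul_one,
    show -κ * y + κ * x = -(κ * (y - x)) by ring] at h3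

theorem exists_isGreenPair (hV : IsShortRange V) (hκ : 0 < κ) : ∃ ψ dψ : ℝ → ℝ,
    IsGreenPair V κ (realSol V (-κ ^ 2)) (realSolD V (-κ ^ 2)) ψ dψ := by
  set φ := realSol V (-κ ^ 2) with hφ
  set dφ := realSolD V (-κ ^ 2) with hdφ
  set χ : ℝ → ℝ := fun x => (linSol (fun t => (V t : ℂ) - ((-κ ^ 2 : ℝ) : ℂ)) (1, 0) x).1.re with hχ
  set dχ : ℝ → ℝ := fun x => (linSol (fun t => (V t : ℂ) - ((-κ ^ 2 : ℝ) : ℂ)) (1, 0) x).2.re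
    with hdχ
  have hsol := fun b (hb : 0 ≤ b) => linSol_isLinSol (y := (1, 0)) hb
    (intervalIntegrable_coeff (hV.intervalIntegrable 0 b) ((-κ ^ 2 : ℝ) : ℂ))
  have hχ1 : ∀ b, 0 ≤ b → HasACDeriv χ dχ 0 b := fun b hb => (hsol b hb).fst.re
  have hχ2 : ∀ b, 0 ≤ b → HasACDeriv dχ (fun x => (V x + κ ^ 2) * χ x) 0 b := fun b hb =>
    (hsol b hb).snd.re.congr_deriv (Eventually.of_forall fun x _ => by
      have : (V x : ℂ) - ((-κ ^ 2 : ℝ) : ℂ) = ((V x + κ ^ 2 : ℝ) : ℂ) := by push_cast; ring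
      simp only [this, Complex.re_ofReal_mul, hχ])
  have hφ1 : ∀ b, 0 ≤ b → HasACDeriv φ dφ 0 b := fun b hb => (hV.expSol κ hb).1
  have hφ2 : ∀ b, 0 ≤ b → HasACDeriv dφ (fun x => (V x + κ ^ 2) * φ x) 0 b := fun b hb => (hV.expSol κ hb).2
  have hle := fun x (hx : 0 ≤ x) => (hV.le_expSol κ hx).1
  have hpos : ∀ x, 0 < x → 0 < φ x := fun x hx => hx.trans_le (hle x hx.le)
  have hW : ∀ x, 0 ≤ x → dφ x * χ x - φ x * dχ x = 1 := by
    intro x hx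
    have h := ((hφ2 x hx).mul (hχ1 x hx)).sub ((hφ1 x hx).mul (hχ2 x hx))
    have h1 := h.integral_eq_sub h.intervalIntegrable
    have h2 : (∫ t in (0 : ℝ)..x, ((V t + κ ^ 2) * φ t * χ t + dφ t * dχ t -
        (dφ t * dχ t + φ t * ((V t + κ ^ 2) * χ t)))) = 0 := by
      rw [intervalIntegral.integral_congr (g := fun _ => (0 : ℝ)) fun t _ => by ring]
      exact intervalIntegral.integral_zero
    have e0 : dφ 0 = 1 := realSolD_zero _
    have e1 : φ 0 = 0 := realSol_zero _
    have e2 : χ 0 = 1 := by simp [hχ, linSol_zero]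
    have h3 := h1.symm.trans h2
    rw [e0, e1, e2] at h3
    linarith
  have hd1 : ∀ x, 0 < x → HasDerivAt φ (dφ x) x := fun x hx =>
    realSol_hasDerivAt (hV.intervalIntegrable 0 (x + 1)) _ ⟨hx, by linarith⟩
  have hd2 : ∀ x, 0 < x → HasDerivAt χ (dχ x) x := fun x hx =>
    Complex.reCLM.hasFDerivAt.comp_hasDerivAt x
      ((hsol (x + 1) (by linarith)).hasDerivAt ⟨hx, by linarith⟩)
  set q : ℝ → ℝ := fun x => χ x / φ x with hq
  set r : ℝ → ℝ := fun x => q x - 1 / (2 * κ) * (φ x ^ 2)⁻¹ with hr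
  have hdq : ∀ x, 0 < x → HasDerivAt q (-(φ x ^ 2)⁻¹) x := by
    intro x hx
    refine ((hd2 x hx).div (hd1 x hx) (hpos x hx).ne').congr_deriv ?_
    rw [inv_eq_one_div, ← neg_div]
    congr 1
    linarith [hW x hx.le]
  have hdr : ∀ x, 0 < x → HasDerivAt r ((dφ x - κ * φ x) / (κ * φ x ^ 3)) x := by
    intro x hx
    have h0 := hpos x hx
    refine ((hdq x hx).sub ((((hd1 x hx).pow 2).inv (pow_ne_zero 2 h0.ne')).const_mul
      (1 / (2 * κ)))).congr_deriv ?_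
    simp only [Pi.pow_apply]
    push_cast
    field_simp
    ring
  have hqa : AntitoneOn q (Ioi 0) := by
    refine antitoneOn_of_deriv_nonpos (convex_Ioi 0)
      (fun x hx => (hdq x hx).continuousAt.continuousWithinAt) ?_ ?_
    · rw [interior_Ioi]
      exact fun x hx => (hdq x hx).differentiableAt.differentiableWithinAt
    · rw [interior_Ioi]
      intro x hx
      rw [(hdq x hx).deriv]
      have := hpos x hx
      exact neg_nonpos.2 (by positivity)
  have hrm : MonotoneOn r (Ioi 0) := by
    refine monotoneOn_of_deriv_nonneg (convex_Ioi 0)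
      (fun x hx => (hdr x hx).continuousAt.continuousWithinAt) ?_ ?_
    · rw [interior_Ioi]
      exact fun x hx => (hdr x hx).differentiableAt.differentiableWithinAt
    · rw [interior_Ioi]
      intro x hx
      rw [(hdr x hx).deriv]
      have h1 := hpos x hx
      have h2 := hV.expSol_lt κ (le_of_lt (mem_Ioi.1 hx))
      exact div_nonneg (by linarith) (by positivity)
  have hrq : ∀ x ∈ Ioi (0 : ℝ), ∀ y ∈ Ioi (0 : ℝ), r x ≤ q y := by
    intro x hx y hy
    have hm : max x y ∈ Ioi (0 : ℝ) := mem_Ioi.2 (lt_max_of_lt_left hx)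
    refine (hrm hx hm (le_max_left x y)).trans (le_trans ?_ (hqa hy hm (le_max_right x y)))
    have := hpos _ hm
    exact sub_le_self _ (by positivity)
  set c := sSup (r '' Ioi 0) with hc
  have hbdd : BddAbove (r '' Ioi 0) := ⟨q 1, by
    rintro _ ⟨x, hx, rfl⟩
    exact hrq x hx 1 (mem_Ioi.2 one_pos)⟩
  have hrc : ∀ x, 0 < x → r x ≤ c := fun x hx => le_csSup hbdd ⟨x, hx, rfl⟩
  have hcq : ∀ x, 0 < x → c ≤ q x := fun x hx => csSup_le ⟨r 1, 1, mem_Ioi.2 one_pos, rfl⟩ (by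
    rintro _ ⟨y, hy, rfl⟩
    exact hrq y hy x hx)
  refine ⟨fun x => χ x - c * φ x, fun x => dχ x - c * dφ x, hκ, hφ1, hφ2, fun b hb => ?_,
    fun b hb => ?_, realSol_zero _, hle, fun x hx => ?_, fun x y hx hxy => ?_⟩
  · refine ((hχ1 b hb).sub ((HasACDeriv.const c).mul (hφ1 b hb))).congr_deriv
      (Eventually.of_forall fun x _ => by ring)
  · refine ((hχ2 b hb).sub ((HasACDeriv.const c).mul (hφ2 b hb))).congr_deriv
      (Eventually.of_forall fun x _ => by ring)
  · linear_combination hW x hx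
  · rcases hx.eq_or_lt with rfl | hx0
    · rw [show φ 0 = 0 from realSol_zero _, zero_mul, abs_zero]
      positivity
    · have hy0 := hx0.trans_le hxy
      have h1 := hpos y hy0
      have h0 := hpos x hx0
      have e : χ y - c * φ y = (q y - c) * φ y := by rw [hq]; field_simp
      have h2 : 0 ≤ q y - c := sub_nonneg.2 (hcq y hy0)
      have h3 : q y - c ≤ 1 / (2 * κ) * (φ y ^ 2)⁻¹ := by
        have := hrc y hy0
        simp only [hr] at this
        linarith
      have h4 := hV.expSol_growth κ hx hxy
      rw [e, abs_of_nonneg (by positivity)]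
      calc φ x * ((q y - c) * φ y)
          ≤ (φ y * Real.exp (-(κ * (y - x)))) * ((1 / (2 * κ) * (φ y ^ 2)⁻¹) * φ y) := by
            gcongr
        _ = _ := by field_simp

/-- The normalization `φ' + κ φ` of the regular solution. -/
noncomputable def _root_.expForm (V : ℝ → ℝ) (κ T : ℝ) : ℝ :=
  realSolD V (-κ ^ 2) T + κ * realSol V (-κ ^ 2) T

theorem expForm_hasACDeriv (hV : IsShortRange V) (κ : ℝ) {b : ℝ} (hb : 0 ≤ b) :
    HasACDeriv (expForm V κ) (fun x => V x * realSol V (-κ ^ 2) x + κ * expForm V κ x) 0 b :=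
  ((hV.expSol κ hb).2.add ((HasACDeriv.const κ).mul (hV.expSol κ hb).1)).congr_deriv
    (Eventually.of_forall fun x _ => by rw [expForm]; ring)

theorem one_le_expForm (hV : IsShortRange V) (hκ : 0 < κ) {x : ℝ} (hx : 0 ≤ x) :
    1 ≤ expForm V κ x := by
  have h := hV.le_expSol κ hx
  have : 0 ≤ κ * realSol V (-κ ^ 2) x := mul_nonneg hκ.le (hx.trans h.1)
  rw [expForm]; linarith [h.2]

theorem two_mul_le_expForm (hV : IsShortRange V) (κ : ℝ) {x : ℝ} (hx : 0 ≤ x) :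
    2 * κ * realSol V (-κ ^ 2) x ≤ expForm V κ x := by
  have h := hV.expSol_lt κ hx
  rw [expForm]; linarith

/-- The Green's function, with one argument at `T`, of the potential truncated at `T`. -/
noncomputable def _root_.truncatedGreen (V : ℝ → ℝ) (κ T x : ℝ) : ℝ :=
  realSol V (-κ ^ 2) (min x T) * (Real.exp (κ * T) * Real.exp (-(κ * max x T))) / expForm V κ T

theorem truncatedGreen_isDecayingKernel (hV : IsShortRange V) (hκ : 0 < κ) :
    IsDecayingKernel (truncatedGreen V κ) (1 / (2 * κ)) κ := by
  refine ⟨?_, hκ, fun T hT x hx => ?_⟩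
  · unfold truncatedGreen Function.uncurry
    refine ContinuousOn.div (ContinuousOn.mul ((HasACDeriv.continuousOn_Ici fun b hb =>
      (hV.expSol κ hb).1).comp (by fun_prop) fun p hp => ?_) (by fun_prop))
      ((HasACDeriv.continuousOn_Ici fun b hb => hV.expForm_hasACDeriv κ hb).comp (by fun_prop)
        fun p hp => (mem_Ioi.1 hp.1).le) fun p hp => ?_
    · exact le_min (mem_Ioi.1 hp.2).le (mem_Ioi.1 hp.1).le
    · have := hV.one_le_expForm hκ (mem_Ioi.1 hp.1).le
      exact (by linarith : (0 : ℝ) < _).ne'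
  · have hw := hV.one_le_expForm hκ hT.le
    have hw' := hV.two_mul_le_expForm κ hT.le
    have hm : 0 ≤ min x T := le_min hx.le hT.le
    have hφ : 0 ≤ realSol V (-κ ^ 2) (min x T) := hm.trans (hV.le_expSol κ hm).1
    rw [truncatedGreen, abs_of_nonneg (by positivity), div_le_iff₀ (by linarith), ← Real.exp_add]
    have h1 := hV.expSol_growth κ hm (min_le_right x T)
    have h2 : Real.exp (-(κ * |T - x|)) = Real.exp (-(κ * (T - min x T))) *
        Real.exp (κ * T + -(κ * max x T)) := by
      rw [← Real.exp_add]
      congr 1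
      rcases le_total x T with h | h
      · rw [min_eq_left h, max_eq_right h, abs_of_nonneg (by linarith)]; ring
      · rw [min_eq_right h, max_eq_left h, abs_of_nonpos (by linarith)]; ring
    rw [h2]
    calc _ ≤ realSol V (-κ ^ 2) T * Real.exp (-(κ * (T - min x T))) *
          Real.exp (κ * T + -(κ * max x T)) := by gcongr
      _ = 1 / (2 * κ) * (Real.exp (-(κ * (T - min x T))) * Real.exp (κ * T + -(κ * max x T))) *
          (2 * κ * realSol V (-κ ^ 2) T) := by field_simp
      _ ≤ _ := by gcongr

theorem abs_truncatedGreen_le (hV : IsShortRange V) (hκ : 0 < κ) {T x : ℝ} (hT : 0 < T)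
    (hx : 0 < x) : |truncatedGreen V κ T x| ≤ 1 / (2 * κ) := by
  refine ((hV.truncatedGreen_isDecayingKernel hκ).bound T hT x hx).trans ?_
  refine mul_le_of_le_one_right (by positivity) (Real.exp_le_one_iff.2 ?_)
  exact neg_nonpos.2 (by positivity)

theorem integrable_mul_truncatedGreen (hV : IsShortRange V) (hκ : 0 < κ) {x : ℝ} (hx : 0 < x) :
    IntegrableOn (fun T => V T * truncatedGreen V κ T x) (Ioi 0) := by
  refine hV.integrable.integrableOn.mul_bdd (c := 1 / (2 * κ))
    ((hV.truncatedGreen_isDecayingKernel hκ).swap.aestronglyMeasurable_row hx) ?_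
  filter_upwards [ae_restrict_mem measurableSet_Ioi] with T hT
  exact hV.abs_truncatedGreen_le hκ hT hx

end IsShortRange
end

section
variable {V : ℝ → ℝ} {κ : ℝ} {ψ dψ : ℝ → ℝ}

theorem HasACDeriv.exp_mul (κ a b : ℝ) :
    HasACDeriv (fun T => Real.exp (κ * T)) (fun T => κ * Real.exp (κ * T)) a b :=
  ((HasACDeriv.const κ).mul HasACDeriv.id).exp.congr_deriv (Eventually.of_forall fun x _ => by ring)

theorem uIcc_subset_of_le {x y : ℝ} (hx : 0 ≤ x) (hxy : x ≤ y) : uIcc x y ⊆ uIcc 0 y := by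
  rw [uIcc_of_le hxy, uIcc_of_le (hx.trans hxy)]; exact Icc_subset_Icc hx le_rfl

namespace IsShortRange

theorem expForm_inv_hasACDeriv (hV : IsShortRange V) (hκ : 0 < κ) {a b : ℝ} (ha : 0 ≤ a)
    (hab : a ≤ b) : HasACDeriv (fun T => (expForm V κ T)⁻¹)
      (fun T => -(V T * realSol V (-κ ^ 2) T + κ * expForm V κ T) / expForm V κ T ^ 2) a b :=
  ((hV.expForm_hasACDeriv κ (ha.trans hab)).mono (uIcc_subset_of_le ha hab)).inv fun x hx => by
    rw [uIcc_of_le hab] at hx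
    linarith [hV.one_le_expForm hκ (ha.trans hx.1)]

/-- Integral over the truncation points to the left of both arguments. -/
theorem integral_truncatedGreen_left (hV : IsShortRange V) (hκ : 0 < κ) {x y : ℝ} (hx : 0 ≤ x)
    (hxy : x ≤ y) : ∫ T in (0 : ℝ)..x, V T * truncatedGreen V κ T x * truncatedGreen V κ T y =
      Real.sinh (κ * x) / κ * Real.exp (-(κ * y)) -
        realSol V (-κ ^ 2) x * Real.exp (κ * x) * Real.exp (-(κ * y)) / expForm V κ x := by
  have hw := fun T (hT : 0 ≤ T) => (zero_lt_one.trans_le (hV.one_le_expForm hκ hT)).ne'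
  have hE := HasACDeriv.exp_mul κ 0 x
  have hI := hV.expForm_inv_hasACDeriv hκ le_rfl hx
  have hF := (HasACDeriv.const (Real.exp (-(κ * x)) * Real.exp (-(κ * y)))).mul ((hE.mul hE).mul
    ((HasACDeriv.const (1 / (2 * κ))).sub ((hV.expSol κ hx).1.mul hI)))
  have hF2 := hF.congr_deriv (g := fun T => V T * truncatedGreen V κ T x * truncatedGreen V κ T y)
    (Eventually.of_forall fun T hT => by
      rw [uIcc_of_le hx] at hT
      have h0 := hw T hT.1
      simp only [truncatedGreen, min_eq_right hT.2, max_eq_left hT.2, min_eq_right (hT.2.trans hxy),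
        max_eq_left (hT.2.trans hxy)]
      have e : realSolD V (-κ ^ 2) T = expForm V κ T - κ * realSol V (-κ ^ 2) T := by
        rw [expForm]; ring
      rw [e]
      field_simp
      ring)
  rw [hF2.integral_eq_sub hF2.intervalIntegrable]
  have h1 := hw x hx
  have h2 : Real.exp (κ * x) * Real.exp (-(κ * x)) = 1 := by rw [← Real.exp_add]; simp
  simp only [realSol_zero, mul_zero, Real.exp_zero, Real.sinh_eq]
  have h3 : Real.exp (-(κ * x)) = (Real.exp (κ * x))⁻¹ := by rw [Real.exp_neg]
  rw [h3]
  have h4 := (Real.exp_pos (κ * x)).ne'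
  field_simp
  ring

/-- Integral over the truncation points between the arguments. -/
theorem integral_truncatedGreen_middle (hV : IsShortRange V) (hκ : 0 < κ) {x y : ℝ} (hx : 0 ≤ x)
    (hxy : x ≤ y) : ∫ T in x..y, V T * truncatedGreen V κ T x * truncatedGreen V κ T y =
      realSol V (-κ ^ 2) x * Real.exp (κ * x) * Real.exp (-(κ * y)) / expForm V κ x -
        realSol V (-κ ^ 2) x / expForm V κ y := by
  have hw := fun T (hT : 0 ≤ T) => (zero_lt_one.trans_le (hV.one_le_expForm hκ hT)).ne'
  have hF := (HasACDeriv.const (-(realSol V (-κ ^ 2) x * Real.exp (-(κ * y))))).mul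
    ((HasACDeriv.exp_mul κ x y).mul (hV.expForm_inv_hasACDeriv hκ hx hxy))
  have hF2 := hF.congr_deriv (g := fun T => V T * truncatedGreen V κ T x * truncatedGreen V κ T y)
    (Eventually.of_forall fun T hT => by
      rw [uIcc_of_le hxy] at hT
      have h0 := hw T (hx.trans hT.1)
      have h3 : Real.exp (-(κ * T)) = (Real.exp (κ * T))⁻¹ := by rw [Real.exp_neg]
      have h4 := (Real.exp_pos (κ * T)).ne'
      simp only [truncatedGreen, min_eq_left hT.1, max_eq_right hT.1, min_eq_right hT.2,
        max_eq_left hT.2, h3]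
      field_simp
      ring)
  rw [hF2.integral_eq_sub hF2.intervalIntegrable]
  have h1 := hw x hx
  have h2 := hw y (hx.trans hxy)
  have h3 : Real.exp (-(κ * y)) = (Real.exp (κ * y))⁻¹ := by rw [Real.exp_neg]
  rw [h3]
  have h4 := (Real.exp_pos (κ * y)).ne'
  field_simp
  ring

end IsShortRange

theorem IsGreenPair.tendsto_form_div
    (h : IsGreenPair V κ (realSol V (-κ ^ 2)) (realSolD V (-κ ^ 2)) ψ dψ)
    (hV : IsShortRange V) :
    Tendsto (fun b => (dψ b + κ * ψ b) * (expForm V κ b)⁻¹) atTop (𝓝 0) := by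
  have hκ := h.pos
  have hlim : Tendsto (fun b : ℝ => (1 / (2 * κ) + 1) * b⁻¹) atTop (𝓝 0) := by
    simpa using tendsto_inv_atTop_zero.const_mul (1 / (2 * κ) + 1)
  refine squeeze_zero_norm' ?_ hlim
  filter_upwards [eventually_ge_atTop 1] with b hb
  have hb0 : 0 ≤ b := zero_le_one.trans hb
  have h1 := hV.one_le_expForm hκ hb0
  have h2 := h.le_fst b hb0
  have h3 := h.wronskian b hb0
  have h4 := h.bound b b hb0 le_rfl
  rw [sub_self, mul_zero, neg_zero, Real.exp_zero, mul_one] at h4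
  set φ := realSol V (-κ ^ 2) b
  set w := expForm V κ b with hw
  have hφ : 0 < φ := by linarith
  have e : (dψ b + κ * ψ b) * w⁻¹ = (φ * ψ b) * (φ⁻¹ * φ⁻¹) - φ⁻¹ * w⁻¹ := by
    have : realSolD V (-κ ^ 2) b = w - κ * φ := by rw [hw, expForm]; ring
    rw [this] at h3
    field_simp
    linear_combination -h3
  have h5 : φ⁻¹ ≤ b⁻¹ := by gcongr
  have h6 : w⁻¹ ≤ 1 := inv_le_one_of_one_le₀ h1
  have h7 : φ⁻¹ ≤ 1 := inv_le_one_of_one_le₀ (hb.trans h2)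
  rw [e]
  refine (norm_sub_le _ _).trans ?_
  rw [norm_mul, Real.norm_eq_abs, Real.norm_eq_abs, Real.norm_eq_abs,
    abs_of_nonneg (by positivity : 0 ≤ φ⁻¹ * φ⁻¹), abs_of_nonneg (by positivity : 0 ≤ φ⁻¹ * w⁻¹),
    add_mul]
  refine add_le_add (mul_le_mul h4 ?_ (by positivity) (by positivity)) ?_
  · calc φ⁻¹ * φ⁻¹ ≤ b⁻¹ * 1 := by gcongr
      _ = b⁻¹ := mul_one _
  · calc φ⁻¹ * w⁻¹ ≤ b⁻¹ * 1 := by gcongr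
      _ = _ := by rw [mul_one, one_mul]

/-- Integral over the truncation points to the right of both arguments. -/
theorem IsGreenPair.integral_truncatedGreen_right
    (h : IsGreenPair V κ (realSol V (-κ ^ 2)) (realSolD V (-κ ^ 2)) ψ dψ)
    (hV : IsShortRange V) {x y : ℝ} (hx : 0 < x) (hxy : x ≤ y)
    (hint : IntegrableOn (fun T => V T * truncatedGreen V κ T x * truncatedGreen V κ T y) (Ioi y)) :
    ∫ T in Ioi y, V T * truncatedGreen V κ T x * truncatedGreen V κ T y =
      realSol V (-κ ^ 2) x / expForm V κ y - realSol V (-κ ^ 2) x * ψ y := by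
  have hκ := h.pos
  have hy : 0 < y := hx.trans_le hxy
  have hw := fun T (hT : 0 ≤ T) => (zero_lt_one.trans_le (hV.one_le_expForm hκ hT)).ne'
  have hval : ∀ b, y ≤ b → ∫ T in y..b, V T * truncatedGreen V κ T x * truncatedGreen V κ T y =
      realSol V (-κ ^ 2) x * realSol V (-κ ^ 2) y * ((dψ b + κ * ψ b) * (expForm V κ b)⁻¹) -
      realSol V (-κ ^ 2) x * realSol V (-κ ^ 2) y * ((dψ y + κ * ψ y) * (expForm V κ y)⁻¹) := by
    intro b hb
    have hs := uIcc_subset_of_le hy.le hb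
    have hb0 := hy.le.trans hb
    have hF := (HasACDeriv.const (realSol V (-κ ^ 2) x * realSol V (-κ ^ 2) y)).mul
      ((((h.snd_deriv b hb0).mono hs).add ((HasACDeriv.const κ).mul ((h.snd b hb0).mono hs))).mul
        (hV.expForm_inv_hasACDeriv hκ hy.le hb))
    have hF2 := hF.congr_deriv
      (g := fun T => V T * truncatedGreen V κ T x * truncatedGreen V κ T y)
      (Eventually.of_forall fun T hT => by
        rw [uIcc_of_le hb] at hT
        have h0 := hw T (hy.le.trans hT.1)
        have h3 : Real.exp (-(κ * T)) = (Real.exp (κ * T))⁻¹ := by rw [Real.exp_neg]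
        have h4 := (Real.exp_pos (κ * T)).ne'
        have hW := h.wronskian T (hy.le.trans hT.1)
        have e : realSolD V (-κ ^ 2) T = expForm V κ T - κ * realSol V (-κ ^ 2) T := by
          rw [expForm]; ring
        rw [e] at hW
        simp only [truncatedGreen, min_eq_left hT.1, max_eq_right hT.1,
          min_eq_left (hxy.trans hT.1), max_eq_right (hxy.trans hT.1), h3]
        field_simp
        linear_combination realSol V (-κ ^ 2) x * realSol V (-κ ^ 2) y * V T * hW)
    rw [hF2.integral_eq_sub hF2.intervalIntegrable]
  have hlim := intervalIntegral_tendsto_integral_Ioi y hint tendsto_id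
  have hlim2 := ((h.tendsto_form_div hV).const_mul
    (realSol V (-κ ^ 2) x * realSol V (-κ ^ 2) y)).sub_const
    (realSol V (-κ ^ 2) x * realSol V (-κ ^ 2) y * ((dψ y + κ * ψ y) * (expForm V κ y)⁻¹))
  have h1 := tendsto_nhds_unique hlim (hlim2.congr' (by
    filter_upwards [eventually_ge_atTop y] with b hb using (hval b hb).symm))
  rw [h1]
  have h0 := hw y hy.le
  have hW := h.wronskian y hy.le
  have e : realSolD V (-κ ^ 2) y = expForm V κ y - κ * realSol V (-κ ^ 2) y := by
    rw [expForm]; ring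
  rw [e] at hW
  field_simp
  linear_combination realSol V (-κ ^ 2) x * hW

theorem IsGreenPair.integral_truncatedGreen
    (h : IsGreenPair V κ (realSol V (-κ ^ 2)) (realSolD V (-κ ^ 2)) ψ dψ)
    (hV : IsShortRange V) {x y : ℝ} (hx : 0 < x) (hy : 0 < y) :
    ∫ T in Ioi (0 : ℝ), V T * truncatedGreen V κ T x * truncatedGreen V κ T y =
      greenKernel (fun x => Real.sinh (κ * x) / κ) (fun x => Real.exp (-(κ * x))) x y -
        greenKernel (realSol V (-κ ^ 2)) ψ x y := by
  have hκ := h.pos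
  wlog hxy : x ≤ y generalizing x y
  · have := this hy hx (le_of_not_ge hxy)
    rw [greenKernel, greenKernel, min_comm, max_comm]
    rw [greenKernel, greenKernel] at this
    rw [← this]
    congr 1
    ext T
    ring
  have hint : IntegrableOn (fun T => V T * truncatedGreen V κ T x * truncatedGreen V κ T y)
      (Ioi 0) := by
    refine (hV.integrable_mul_truncatedGreen hκ hx).mul_bdd (c := 1 / (2 * κ))
      ((hV.truncatedGreen_isDecayingKernel hκ).swap.aestronglyMeasurable_row hy) ?_
    filter_upwards [ae_restrict_mem measurableSet_Ioi] with T hT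
    exact hV.abs_truncatedGreen_le hκ hT hy
  rw [setIntegral_Ioi_eq_add hx.le hint,
    setIntegral_Ioi_eq_add hxy (hint.mono_set (Ioi_subset_Ioi hx.le)),
    h.integral_truncatedGreen_right hV hx hxy (hint.mono_set (Ioi_subset_Ioi hy.le)),
    hV.integral_truncatedGreen_left hκ hx.le hxy, hV.integral_truncatedGreen_middle hκ hx.le hxy,
    greenKernel, greenKernel, min_eq_left hxy, max_eq_right hxy]
  ring

end

section
open scoped ENNReal

theorem Orthonormal.countable {ι H : Type*} [NormedAddCommGroup H] [InnerProductSpace ℂ H]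
    [TopologicalSpace.SeparableSpace H] {b : ι → H} (hb : Orthonormal ℂ b) : Countable ι := by
  refine Pairwise.countable_of_isOpen_disjoint (s := fun i => Metric.ball (b i) (1 / 2)) ?_
    (fun i => Metric.isOpen_ball) (fun i => Metric.nonempty_ball.2 (by norm_num))
  intro i j hij
  refine Set.disjoint_left.2 fun x hi hj => ?_
  have h1 : dist (b i) (b j) < 1 := by
    have := dist_triangle_left (b i) (b j) x
    rw [Metric.mem_ball] at hi hj
    linarith
  have h2 : ‖b i - b j‖ ^ 2 = 2 := by
    rw [@norm_sub_sq ℂ, hb.1 i, hb.1 j, hb.2 hij]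
    norm_num
  rw [dist_eq_norm] at h1
  nlinarith [norm_nonneg (b i - b j)]

namespace IsDecayingKernel
variable {K : ℝ → ℝ → ℝ} {C κ : ℝ}

theorem exists_norm_apply_le (hK : IsDecayingKernel K C κ) (f : L2On (Ioi 0)) :
    ∃ B, ∀ x > 0, ‖hK.apply f x‖ ≤ B := by
  set B := decayMass (C ^ 2) (2 * κ) + ∫⁻ y, ‖f y‖ₑ ^ 2 ∂halfLine with hB
  have hBt : B < ∞ := ENNReal.add_lt_top.2 ⟨decayMass_lt_top _ (by linarith [hK.decay_pos]),
    lintegral_enorm_sq_lt_top f⟩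
  refine ⟨B.toReal, fun x hx => ?_⟩
  have h : ‖hK.apply f x‖ₑ ≤ B := (enorm_integral_le_lintegral_enorm _).trans
    ((hK.lintegral_enorm_mul_le f hx).trans (lintegral_decayMajorant_mul_le C κ x))
  rw [← toReal_enorm]
  exact ENNReal.toReal_mono hBt.ne h

theorem row_bound (hK : IsDecayingKernel K C κ) {x : ℝ} (hx : 0 < x) :
    eLpNorm (fun y => (K x y : ℂ)) 2 halfLine ^ 2 ≤ decayMass (C ^ 2) (2 * κ) := by
  rw [← lintegral_enorm_sq_eq]
  refine le_trans (lintegral_mono_ae ?_) (lintegral_decayMajorant_le (C ^ 2) (2 * κ) x)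
  filter_upwards [ae_restrict_mem measurableSet_Ioi] with y hy
  have h1 := hK.bound x hx y hy
  rw [← ofReal_norm, Complex.norm_real, ← ENNReal.ofReal_pow (norm_nonneg _), decayMajorant]
  refine ENNReal.ofReal_le_ofReal ?_
  calc ‖K x y‖ ^ 2 ≤ (C * Real.exp (-(κ * |x - y|))) ^ 2 := by
        gcongr
        exact h1
    _ = _ := by
        rw [mul_pow, ← Real.exp_nat_mul]
        congr 2
        push_cast; ring

theorem memLp_row (hK : IsDecayingKernel K C κ) {x : ℝ} (hx : 0 < x) :
    MemLp (fun y => (K x y : ℂ)) 2 halfLine := by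
  refine ⟨(Complex.measurable_ofReal.comp_aemeasurable
    (hK.aestronglyMeasurable_row hx).aemeasurable).aestronglyMeasurable, ?_⟩
  have h := (hK.row_bound hx).trans_lt (decayMass_lt_top (C ^ 2) (by linarith [hK.decay_pos]))
  by_contra h1
  rw [not_lt_top_iff.1 h1] at h
  simp at h

/-- A row of the kernel as an element of `L²`. -/
noncomputable def row (hK : IsDecayingKernel K C κ) {x : ℝ} (hx : 0 < x) : L2On (Ioi 0) :=
  (hK.memLp_row hx).toLp _

theorem inner_row (hK : IsDecayingKernel K C κ) {x : ℝ} (hx : 0 < x) (f : L2On (Ioi 0)) :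
    inner ℂ (hK.row hx) f = hK.apply f x := by
  rw [L2.inner_def]
  refine integral_congr_ae ?_
  filter_upwards [(hK.memLp_row hx).coeFn_toLp] with y hy
  rw [row, hy, RCLike.inner_apply, Complex.conj_ofReal, mul_comm]

theorem norm_row_sq (hK : IsDecayingKernel K C κ) {x : ℝ} (hx : 0 < x) :
    ‖hK.row hx‖ ^ 2 = ∫ y in Ioi (0 : ℝ), K x y ^ 2 := by
  have h := hK.inner_row hx (hK.row hx)
  rw [inner_self_eq_norm_sq_to_K, apply] at h
  have h2 : (∫ y in Ioi (0 : ℝ), (K x y : ℂ) * hK.row hx y) =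
      ((∫ y in Ioi (0 : ℝ), K x y ^ 2 : ℝ) : ℂ) := by
    rw [← integral_complex_ofReal]
    refine integral_congr_ae ?_
    filter_upwards [(hK.memLp_row hx).coeFn_toLp] with y hy
    rw [row, hy]
    push_cast; ring
  rw [h2] at h
  exact Complex.ofReal_injective (by push_cast at h ⊢; exact h)

theorem norm_row_sq_le (hK : IsDecayingKernel K C κ) {x : ℝ} (hx : 0 < x) :
    ‖hK.row hx‖ ^ 2 ≤ (decayMass (C ^ 2) (2 * κ)).toReal := by
  rw [row, Lp.norm_toLp, ← ENNReal.toReal_pow]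
  exact ENNReal.toReal_mono (decayMass_lt_top _ (by linarith [hK.decay_pos])).ne (hK.row_bound hx)

theorem apply_star (hK : IsDecayingKernel K C κ) (f : L2On (Ioi 0)) (x : ℝ) :
    hK.apply (star f : L2On (Ioi 0)) x = starRingEnd ℂ (hK.apply f x) := by
  rw [apply, apply, ← integral_conj]
  refine integral_congr_ae ?_
  filter_upwards [Lp.coeFn_star f] with y hy
  rw [hy, Pi.star_apply, map_mul, Complex.conj_ofReal]
  rfl

theorem integrable_mul_apply (hK : IsDecayingKernel K C κ) {a : ℝ → ℂ} (ha : Integrable a halfLine)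
    (f : L2On (Ioi 0)) : Integrable (fun x => a x * hK.apply f x) halfLine := by
  obtain ⟨B, hB⟩ := hK.exists_norm_apply_le f
  refine ha.mul_bdd (c := B) (hK.apply_aestronglyMeasurable (Lp.aestronglyMeasurable f)) ?_
  filter_upwards [ae_restrict_mem measurableSet_Ioi] with x hx using hB x hx

variable {ι : Type*} {v : ℝ → ℝ}

/-- The trace of the positive operator `∫ v(T) |K(T,·)⟩⟨K(T,·)| dT`. -/
theorem hasSum_integral_norm_apply_sq (hK : IsDecayingKernel K C κ) (hv : Integrable v)
    (hv0 : ∀ x, 0 ≤ v x) (b : HilbertBasis ι ℂ (L2On (Ioi 0))) :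
    HasSum (fun i => ∫ x in Ioi (0 : ℝ), v x * ‖hK.apply (b i) x‖ ^ 2)
      (∫ x in Ioi (0 : ℝ), v x * ∫ y in Ioi (0 : ℝ), K x y ^ 2) := by
  have : Fact ((2 : ℝ≥0∞) ≠ ∞) := ⟨by norm_num⟩
  have : Countable ι := b.orthonormal.countable
  have hpars : ∀ x (hx : 0 < x), HasSum (fun i => ‖hK.apply (b i) x‖ ^ 2) (‖hK.row hx‖ ^ 2) := by
    intro x hx
    have h := b.hasSum_inner_mul_inner (hK.row hx) (hK.row hx)
    have e : ∀ i, inner ℂ (hK.row hx) (b i) * inner ℂ (b i) (hK.row hx) =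
        ((‖hK.apply (b i) x‖ ^ 2 : ℝ) : ℂ) := by
      intro i
      rw [← inner_conj_symm (b i) (hK.row hx), hK.inner_row hx, Complex.mul_conj,
        Complex.normSq_eq_norm_sq]
    simp only [e] at h
    rw [inner_self_eq_norm_sq_to_K] at h
    exact Complex.hasSum_ofReal.1 (by push_cast at h ⊢; exact h)
  have hint : ∀ i, Integrable (fun x => v x * ‖hK.apply (b i) x‖ ^ 2) halfLine := by
    intro i
    obtain ⟨B, hB⟩ := hK.exists_norm_apply_le (b i)
    refine hv.integrableOn.mul_bdd (c := B ^ 2)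
      ((hK.apply_aestronglyMeasurable (Lp.aestronglyMeasurable (b i))).norm.pow 2) ?_
    filter_upwards [ae_restrict_mem measurableSet_Ioi] with x hx
    rw [norm_pow, norm_norm]
    gcongr
    exact hB x hx
  have hsum : Summable fun i => ∫ x in Ioi (0 : ℝ), ‖v x * ‖hK.apply (b i) x‖ ^ 2‖ := by
    refine summable_of_sum_le (c := ∫ x in Ioi (0 : ℝ),
      v x * (decayMass (C ^ 2) (2 * κ)).toReal) (fun i => integral_nonneg fun x => norm_nonneg _)
      fun s => ?_
    rw [← integral_finsetSum _ fun i _ => (hint i).norm]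
    refine integral_mono_ae (integrable_finsetSum _ fun i _ => (hint i).norm)
      (hv.integrableOn.mul_const _) ?_
    filter_upwards [ae_restrict_mem measurableSet_Ioi] with x hx
    have h1 : ∀ i, ‖v x * ‖hK.apply (b i) x‖ ^ 2‖ = v x * ‖hK.apply (b i) x‖ ^ 2 := fun i => by
      rw [Real.norm_eq_abs, abs_of_nonneg (mul_nonneg (hv0 x) (sq_nonneg _))]
    simp only [h1]
    rw [← Finset.mul_sum]
    refine mul_le_mul_of_nonneg_left ?_ (hv0 x)
    exact (sum_le_hasSum s (fun i _ => sq_nonneg _) (hpars x hx)).trans (hK.norm_row_sq_le hx)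
  have h := hasSum_integral_of_summable_integral_norm hint hsum
  have e : (∫ x in Ioi (0 : ℝ), ∑' i, v x * ‖hK.apply (b i) x‖ ^ 2) =
      ∫ x in Ioi (0 : ℝ), v x * ∫ y in Ioi (0 : ℝ), K x y ^ 2 := by
    refine setIntegral_congr_fun measurableSet_Ioi fun x hx => ?_
    simp only [tsum_mul_left, (hpars x hx).tsum_eq, hK.norm_row_sq hx]
  rwa [e] at h

end IsDecayingKernel
end

section
variable {V : ℝ → ℝ} {κ : ℝ} {ψ dψ : ℝ → ℝ}

/-- The difference of the resolvents is an integral of rank one operators. -/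
theorem IsGreenPair.inner_resolvent_sub (hV : IsShortRange V)
    (h : IsGreenPair V κ (realSol V (-κ ^ 2)) (realSolD V (-κ ^ 2)) ψ dψ) (f : L2On (Ioi 0)) :
    inner ℂ f ((h.isDecayingKernel.toCLM - (isGreenPair_zero h.pos).isDecayingKernel.toCLM) f) =
      ((-∫ T in Ioi (0 : ℝ), V T *
        ‖(hV.truncatedGreen_isDecayingKernel h.pos).apply f T‖ ^ 2 : ℝ) : ℂ) := by
  have hκ := h.pos
  set h0 := isGreenPair_zero hκ
  set hK := hV.truncatedGreen_isDecayingKernel hκ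
  have hVK : ∀ x, 0 < x → Integrable (fun T => ((V T * truncatedGreen V κ T x : ℝ) : ℂ)) halfLine :=
    fun x hx => Integrable.ofReal (hV.integrable_mul_truncatedGreen hκ hx)
  have hVC : Integrable (fun T => (V T : ℂ)) halfLine := hV.integrable.integrableOn.ofReal
  have hD : (h.isDecayingKernel.toCLM - h0.isDecayingKernel.toCLM) f =ᵐ[halfLine] fun x =>
      -∫ T in Ioi (0 : ℝ), ((V T * truncatedGreen V κ T x : ℝ) : ℂ) * hK.apply f T := by
    rw [sub_apply]
    filter_upwards [Lp.coeFn_sub (h.isDecayingKernel.toCLM f) (h0.isDecayingKernel.toCLM f),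
      h.isDecayingKernel.coeFn_toCLM f, h0.isDecayingKernel.coeFn_toCLM f,
      ae_restrict_mem measurableSet_Ioi] with x h1 h2 h3 hx
    rw [h1, Pi.sub_apply, h2, h3, hK.integral_mul_apply (hVK x hx) f, IsDecayingKernel.apply,
      IsDecayingKernel.apply, ← integral_sub (h.isDecayingKernel.integrable_mul f hx)
        (h0.isDecayingKernel.integrable_mul f hx), ← integral_neg]
    refine setIntegral_congr_fun measurableSet_Ioi fun y hy => ?_
    have e : (∫ T in Ioi (0 : ℝ), ((V T * truncatedGreen V κ T x : ℝ) : ℂ) *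
        (truncatedGreen V κ T y : ℂ)) = ((greenKernel (fun x => Real.sinh (κ * x) / κ)
          (fun x => Real.exp (-(κ * x))) x y - greenKernel (realSol V (-κ ^ 2)) ψ x y : ℝ) : ℂ) := by
      rw [← h.integral_truncatedGreen hV hx hy, ← integral_complex_ofReal]
      push_cast
      rfl
    simp only [e]
    push_cast
    ring
  have hH := hK.integrable_mul_apply hVC f
  have hF := hK.integral_mul_apply hH (star f)
  rw [L2.inner_def]
  have e1 : (∫ x in Ioi (0 : ℝ), inner ℂ (f x)
      ((h.isDecayingKernel.toCLM - h0.isDecayingKernel.toCLM) f x)) =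
      -∫ x in Ioi (0 : ℝ), (∫ T in Ioi (0 : ℝ), (V T : ℂ) * hK.apply f T *
        (truncatedGreen V κ T x : ℂ)) * (star f : L2On (Ioi 0)) x := by
    rw [← integral_neg]
    refine integral_congr_ae ?_
    filter_upwards [hD, Lp.coeFn_star f] with x hx hs
    rw [hx, hs, RCLike.inner_apply, neg_mul, Pi.star_apply]
    congr 2
    refine integral_congr_ae (Eventually.of_forall fun T => ?_)
    push_cast
    ring
  rw [e1, ← hF]
  push_cast
  rw [← integral_complex_ofReal]
  congr 1
  refine integral_congr_ae (Eventually.of_forall fun T => ?_)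
  simp only [hK.apply_star, mul_assoc, Complex.mul_conj, Complex.normSq_eq_norm_sq]
  push_cast
  rfl

/-- The squared norm of a row of the truncated Green's function. -/
theorem IsShortRange.integral_truncatedGreen_sq (hV : IsShortRange V) (hκ : 0 < κ) {T : ℝ}
    (hT : 0 < T) : ∫ x in Ioi (0 : ℝ), truncatedGreen V κ T x ^ 2 =
      2 / Real.pi * ∫ x in Ioi (0 : ℝ), sineSq V T x / (x ^ 2 + κ ^ 2) ^ 2 := by
  have hK := hV.truncatedGreen_isDecayingKernel hκ
  have hw := zero_lt_one.trans_le (hV.one_le_expForm hκ hT.le)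
  rw [← solution_norm_eq_integral hT.le (hV.intervalIntegrable 0 T) hV.nonneg hκ]
  have hint : IntegrableOn (fun x => truncatedGreen V κ T x ^ 2) (Ioi 0) := by
    have h1 := (memLp_two_iff_integrable_sq_norm (hK.memLp_row hT).1).1 (hK.memLp_row hT)
    simp only [Complex.norm_real, Real.norm_eq_abs, sq_abs] at h1
    exact h1
  rw [setIntegral_Ioi_eq_add hT.le hint, add_div, ← intervalIntegral.integral_div]
  congr 1
  · refine intervalIntegral.integral_congr fun x hx => ?_
    rw [uIcc_of_le hT.le] at hx
    simp only [truncatedGreen, min_eq_left hx.2, max_eq_right hx.2, expForm]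
    rw [← Real.exp_add, add_neg_cancel, Real.exp_zero, mul_one, div_pow]
  · have e : ∀ x ∈ Ioi T, truncatedGreen V κ T x ^ 2 =
        realSol V (-κ ^ 2) T ^ 2 * Real.exp (2 * κ * T) / expForm V κ T ^ 2 *
          Real.exp (-(2 * κ) * x) := by
      intro x hx
      have hx' : T ≤ x := (mem_Ioi.1 hx).le
      simp only [truncatedGreen, min_eq_right hx', max_eq_left hx']
      rw [show 2 * κ * T = κ * T + κ * T by ring, show -(2 * κ) * x = -(κ * x) + -(κ * x) by ring,
        Real.exp_add, Real.exp_add]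
      ring
    rw [setIntegral_congr_fun measurableSet_Ioi e, integral_const_mul,
      integral_exp_mul_Ioi (by linarith)]
    have h1 : Real.exp (2 * κ * T) * Real.exp (-(2 * κ) * T) = 1 := by
      rw [← Real.exp_add]; simp
    have h2 : Real.exp (-(2 * κ) * T) = (Real.exp (2 * κ * T))⁻¹ := by
      rw [← Real.exp_neg]; congr 1; ring
    have h3 := (Real.exp_pos (2 * κ * T)).ne'
    rw [h2, ← expForm]
    field_simp

end

section
variable {V : ℝ → ℝ} {κ : ℝ}

theorem integrable_inv_sq_add_sq_sq (hκ : 0 < κ) :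
    Integrable fun x : ℝ => ((x ^ 2 + κ ^ 2) ^ 2)⁻¹ := by
  have h := (integrable_and_integral_inv_sq_add_sq hκ).1
  refine (h.const_mul (κ ^ 2)⁻¹).mono' (by fun_prop) (Eventually.of_forall fun x => ?_)
  rw [Real.norm_eq_abs, abs_of_nonneg (by positivity), ← mul_inv]
  gcongr
  nlinarith [sq_nonneg x, sq_nonneg κ]

/-- The representation of the trace by the phase shift. -/
theorem IsShortRange.integral_truncatedGreen_trace (hV : IsShortRange V) (hκ : 0 < κ) :
    ∫ T in Ioi (0 : ℝ), V T * ∫ x in Ioi (0 : ℝ), truncatedGreen V κ T x ^ 2 =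
      -(1 / Real.pi) * ∫ x in Ioi (0 : ℝ), phaseShift V (√x) / (x + κ ^ 2) ^ 2 := by
  have hT0 : ∀ T : ℝ, (0 : ℝ) ≤ max T 0 := fun T => le_max_right _ _
  have hm : StronglyMeasurable (Function.uncurry fun k T => sineSq V (max T 0) k) := by
    refine stronglyMeasurable_uncurry_of_continuous_of_stronglyMeasurable
      (fun T => sineSq_continuous (hT0 T) (hV.intervalIntegrable 0 _) hV.nonneg)
      fun k => Continuous.stronglyMeasurable ?_
    rcases eq_or_ne k 0 with rfl | hk
    · simp only [sineSq, zero_mul, zero_pow two_ne_zero, zero_div]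
      exact continuous_const
    · have h1 : ContinuousOn (fun T => sineSq V T k) (Ici 0) := by
        have hφ := HasACDeriv.continuousOn_Ici fun b hb =>
          realSol_hasACDeriv hb (hV.intervalIntegrable 0 b) (k ^ 2)
        have hdφ := HasACDeriv.continuousOn_Ici fun b hb =>
          realSolD_hasACDeriv hb (hV.intervalIntegrable 0 b) (k ^ 2)
        refine ((continuousOn_const.mul hφ).pow 2).div
          ((hdφ.pow 2).add ((continuousOn_const.mul hφ).pow 2)) fun T hT h0 => ?_
        refine realSol_ne_zero hT (hV.intervalIntegrable 0 T) (k ^ 2) ⟨?_, ?_⟩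
        · have h2 : (k * realSol V (k ^ 2) T) ^ 2 = 0 := by
            nlinarith [sq_nonneg (realSolD V (k ^ 2) T), sq_nonneg (k * realSol V (k ^ 2) T)]
          exact (mul_eq_zero.1 (pow_eq_zero_iff two_ne_zero |>.1 h2)).resolve_left hk
        · have h2 : (realSolD V (k ^ 2) T) ^ 2 = 0 := by
            nlinarith [sq_nonneg (realSolD V (k ^ 2) T), sq_nonneg (k * realSol V (k ^ 2) T)]
          exact pow_eq_zero_iff two_ne_zero |>.1 h2
      exact h1.comp_continuous (by fun_prop) fun T => hT0 T
  have hi := integrable_inv_sq_add_sq_sq hκ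
  have hint : Integrable (Function.uncurry fun T x => V T * sineSq V (max T 0) x *
      ((x ^ 2 + κ ^ 2) ^ 2)⁻¹) (halfLine.prod halfLine) := by
    refine (hV.integrable.integrableOn.mul_prod hi.integrableOn).mono' ?_
      (Eventually.of_forall fun p => ?_)
    · refine (((hV.measurable.comp measurable_fst).aestronglyMeasurable).mul
        (hm.measurable.comp measurable_swap).aestronglyMeasurable).mul ?_
      exact Measurable.aestronglyMeasurable (by fun_prop)
    · have h1 := hV.nonneg p.1
      have h2 := sineSq_nonneg (V := V) (T := max p.1 0) p.2
      simp only [Function.uncurry]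
      rw [Real.norm_eq_abs, abs_of_nonneg (by positivity)]
      gcongr
      exact mul_le_of_le_one_right h1 (sineSq_le_one _)
  have hswap := integral_integral_swap hint
  have e1 : ∫ T in Ioi (0 : ℝ), V T * ∫ x in Ioi (0 : ℝ), truncatedGreen V κ T x ^ 2 =
      2 / Real.pi * ∫ T in Ioi (0 : ℝ), ∫ x in Ioi (0 : ℝ), V T * sineSq V (max T 0) x *
        ((x ^ 2 + κ ^ 2) ^ 2)⁻¹ := by
    rw [← integral_const_mul]
    refine setIntegral_congr_fun measurableSet_Ioi fun T hT => ?_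
    simp only [hV.integral_truncatedGreen_sq hκ hT, max_eq_left (mem_Ioi.1 hT).le, mul_assoc,
      integral_const_mul, div_eq_mul_inv]
    ring
  have e2 : ∀ x ∈ Ioi (0 : ℝ), (∫ T in Ioi (0 : ℝ), V T * sineSq V (max T 0) x *
      ((x ^ 2 + κ ^ 2) ^ 2)⁻¹) = -(1 / 2) * (2 * x * (phaseShift V x / (x ^ 2 + κ ^ 2) ^ 2)) := by
    intro x hx
    have hx0 : 0 < x := hx
    have : ∫ T in Ioi (0 : ℝ), V T * sineSq V (max T 0) x = -x * phaseShift V x := by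
      rw [phaseShift]
      have e : (∫ T in Ioi (0 : ℝ), V T * sineSq V (max T 0) x) =
          ∫ t in Ioi (0 : ℝ), V t * Real.sin (pruferAngle V x t) ^ 2 := by
        refine setIntegral_congr_fun measurableSet_Ioi fun T hT => ?_
        have hT' := (mem_Ioi.1 hT).le
        simp only [max_eq_left hT', prufer_sin_sq hT' (hV.intervalIntegrable 0 T) hV.nonneg hx0,
          sineSq]
      rw [e]
      field_simp
    rw [integral_mul_const, this]
    ring
  rw [e1, hswap, setIntegral_congr_fun measurableSet_Ioi e2, integral_const_mul,
    ← integral_comp_rpow_Ioi_of_pos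
      (g := fun x => phaseShift V (√x) / (x + κ ^ 2) ^ 2) (p := 2) (by norm_num)]
  have e3 : ∫ x in Ioi (0 : ℝ), ((2 : ℝ) * x ^ ((2 : ℝ) - 1)) •
      (phaseShift V (√(x ^ (2 : ℝ))) / (x ^ (2 : ℝ) + κ ^ 2) ^ 2) =
      ∫ x in Ioi (0 : ℝ), 2 * x * (phaseShift V x / (x ^ 2 + κ ^ 2) ^ 2) := by
    refine setIntegral_congr_fun measurableSet_Ioi fun x hx => ?_
    have hx0 := (mem_Ioi.1 hx).le
    have h2 : x ^ (2 : ℝ) = x ^ 2 := by exact_mod_cast Real.rpow_natCast x 2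
    have h1 : x ^ ((2 : ℝ) - 1) = x := by norm_num
    simp only [h1, h2, Real.sqrt_sq hx0, smul_eq_mul]
  rw [e3]
  ring

/-- The spectral shift function. -/
noncomputable def spectralShift (V : ℝ → ℝ) (x : ℝ) : ℝ :=
  if 0 < x then -(1 / Real.pi) * phaseShift V (√x) else 0

theorem spectralShift_of_pos {x : ℝ} (hx : 0 < x) :
    spectralShift V x = -(1 / Real.pi) * phaseShift V (√x) := if_pos hx

theorem IsShortRange.continuousOn_spectralShift (hV : IsShortRange V) :
    ContinuousOn (spectralShift V) (Ioi 0) :=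
  (continuous_const.mul hV.isTamePhase.comp_sqrt_continuousOn).continuousOn.congr
    fun _ hx => spectralShift_of_pos hx

theorem IsShortRange.integrable_spectralShift (hV : IsShortRange V) :
    Integrable fun x => spectralShift V x / (1 + x ^ 2) := by
  have hm : Measurable (spectralShift V) :=
    Measurable.ite measurableSet_Ioi
      (continuous_const.mul hV.isTamePhase.comp_sqrt_continuousOn).measurable measurable_const
  simp_rw [div_eq_mul_inv]
  refine integrable_inv_one_add_sq.bdd_mul (c := 1 / Real.pi * weightTail V 0)
    hm.aestronglyMeasurable (Eventually.of_forall fun x => ?_)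
  have hπ := Real.pi_pos
  rw [spectralShift]
  split_ifs with hx
  · rw [norm_mul, norm_neg, Real.norm_eq_abs, Real.norm_eq_abs, abs_of_pos (by positivity)]
    gcongr
    exact hV.abs_phaseShift_le_const (Real.sqrt_pos.2 hx)
  · rw [norm_zero]
    exact mul_nonneg (by positivity) (hV.weightTail_nonneg 0)

theorem IsShortRange.isSpectralShift (hV : IsShortRange V) :
    IsSpectralShift (dirichletSchrodinger (fun _ => 0) (Ioi 0)) (dirichletSchrodinger V (Ioi 0))
      (spectralShift V) := by
  refine ⟨fun x hx => if_neg (not_lt.2 hx.le), hV.integrable_spectralShift, fun s hs => ?_⟩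
  have hκ : 0 < √s := Real.sqrt_pos.2 hs
  have hs2 : s = √s ^ 2 := (Real.sq_sqrt hs.le).symm
  obtain ⟨ψ, dψ, h⟩ := hV.exists_isGreenPair hκ
  have h0 := isGreenPair_zero hκ
  refine ⟨h0.isDecayingKernel.toCLM, h.isDecayingKernel.toCLM,
    h0.isResolventAt isShortRange_zero hs2, h.isResolventAt hV hs2, fun ι b => ?_⟩
  have h1 := ((hV.truncatedGreen_isDecayingKernel hκ).hasSum_integral_norm_apply_sq hV.integrable
    hV.nonneg b).neg
  rw [hV.integral_truncatedGreen_trace hκ, ← hs2, ← Complex.hasSum_ofReal] at h1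
  simp only [h.inner_resolvent_sub hV]
  convert h1 using 2
  rw [← integral_const_mul]
  congr 1
  refine setIntegral_congr_fun measurableSet_Ioi fun x hx => ?_
  simp only [spectralShift_of_pos (mem_Ioi.1 hx)]
  ring

end

section
variable {g : ℝ → ℝ}

theorem integrableOn_div_add_pow (hg : IntegrableOn (fun x => g x / (1 + x ^ 2)) (Ioi 0)) {s : ℝ}
    (hs : 0 < s) (n : ℕ) : IntegrableOn (fun x => g x / (x + s) ^ (n + 2)) (Ioi 0) := by
  have h : IntegrableOn (fun x => g x / (1 + x ^ 2) * ((1 + x ^ 2) / (x + s) ^ (n + 2))) (Ioi 0) := by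
    refine Integrable.mul_bdd (c := (1 + (s⁻¹) ^ 2) * (s⁻¹) ^ n) hg
      (Measurable.aestronglyMeasurable (by fun_prop)) ?_
    filter_upwards [ae_restrict_mem measurableSet_Ioi] with x hx
    have hx0 : 0 < x := hx
    have h1 : 1 + x ^ 2 ≤ (1 + (s⁻¹) ^ 2) * (x + s) ^ 2 := by
      have h2 : 1 ≤ s⁻¹ * (x + s) := by
        rw [mul_add, inv_mul_cancel₀ hs.ne']
        have : 0 < s⁻¹ * x := by positivity
        linarith
      nlinarith [mul_pos hx0 hs, sq_nonneg s]
    have h3 : s ^ n ≤ (x + s) ^ n := by gcongr; linarith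
    rw [Real.norm_eq_abs, abs_of_nonneg (by positivity), div_le_iff₀ (by positivity)]
    calc 1 + x ^ 2 ≤ (1 + (s⁻¹) ^ 2) * (x + s) ^ 2 * ((s⁻¹) ^ n * s ^ n) := by
          rw [← mul_pow, inv_mul_cancel₀ hs.ne', one_pow, mul_one]
          exact h1
      _ ≤ (1 + (s⁻¹) ^ 2) * (x + s) ^ 2 * ((s⁻¹) ^ n * (x + s) ^ n) := by gcongr
      _ = _ := by ring
  refine IntegrableOn.congr_fun h (fun x _ => ?_) measurableSet_Ioi
  have : 1 + x ^ 2 ≠ 0 := by positivity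
  rw [div_mul_div_comm, mul_comm (g x), mul_div_mul_left _ _ this]

theorem integral_div_add_pow_eq_zero (hg : IntegrableOn (fun x => g x / (1 + x ^ 2)) (Ioi 0))
    (h : ∀ s : ℝ, 0 < s → ∫ x in Ioi (0 : ℝ), g x / (x + s) ^ 2 = 0) (n : ℕ) :
    ∀ s : ℝ, 0 < s → ∫ x in Ioi (0 : ℝ), g x / (x + s) ^ (n + 2) = 0 := by
  induction n with
  | zero => exact h
  | succ n ih =>
    intro s hs
    have hs2 : 0 < s / 2 := by positivity
    have hgm : ∀ m : ℕ, ∀ t : ℝ, 0 < t → AEStronglyMeasurable (fun x => g x / (x + t) ^ (m + 2))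
        halfLine := fun m t ht => (integrableOn_div_add_pow hg ht m).1
    have hder := hasDerivAt_integral_of_dominated_loc_of_deriv_le (μ := halfLine) (x₀ := s)
      (s := Ioi (s / 2)) (F := fun t x => g x / (x + t) ^ (n + 2))
      (F' := fun t x => -((n + 2 : ℕ) : ℝ) * (g x / (x + t) ^ (n + 1 + 2)))
      (bound := fun x => ((n + 2 : ℕ) : ℝ) * ‖g x / (x + s / 2) ^ (n + 1 + 2)‖)
      (Ioi_mem_nhds (by linarith)) ?_ (integrableOn_div_add_pow hg hs n)
      ((hgm (n + 1) s hs).const_mul _) ?_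
      ((integrableOn_div_add_pow hg hs2 (n + 1)).norm.const_mul _) ?_
    · have hz : HasDerivAt (fun t => ∫ x in Ioi (0 : ℝ), g x / (x + t) ^ (n + 2)) 0 s := by
        refine (hasDerivAt_const s (0 : ℝ)).congr_of_eventuallyEq ?_
        filter_upwards [lt_mem_nhds hs] with t ht using ih t ht
      have h1 := hder.2.unique hz
      rw [integral_const_mul] at h1
      exact (mul_eq_zero.1 h1).resolve_left
        (neg_ne_zero.2 (Nat.cast_ne_zero.2 (by omega)))
    · filter_upwards [lt_mem_nhds hs] with t ht using hgm n t ht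
    · filter_upwards [ae_restrict_mem measurableSet_Ioi] with x hx t ht
      have hx0 : 0 < x := hx
      have ht0 : s / 2 < t := ht
      rw [norm_mul, norm_neg, norm_div, norm_div, Real.norm_natCast, norm_pow, norm_pow,
        Real.norm_eq_abs (x + t), Real.norm_eq_abs (x + s / 2), abs_of_pos (by linarith),
        abs_of_pos (by linarith)]
      gcongr
    · filter_upwards [ae_restrict_mem measurableSet_Ioi] with x hx t ht
      have hx0 : 0 < x := hx
      have ht0 : s / 2 < t := ht
      have hxt : x + t ≠ 0 := by linarith
      have hd := ((hasDerivAt_id t).const_add x).pow (n + 2)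
      have h1 := (hd.inv (pow_ne_zero _ hxt)).const_mul (g x)
      simp only [id] at h1
      refine h1.congr_deriv ?_
      simp only [Pi.pow_apply]
      push_cast
      field_simp
      ring

theorem integral_polynomial_mul_eq_zero (hg : IntegrableOn (fun x => g x / (1 + x ^ 2)) (Ioi 0))
    (h : ∀ s : ℝ, 0 < s → ∫ x in Ioi (0 : ℝ), g x / (x + s) ^ 2 = 0) (p : Polynomial ℝ) :
    IntegrableOn (fun x => p.eval (x + 1)⁻¹ * (g x / (x + 1) ^ 2)) (Ioi 0) ∧
      ∫ x in Ioi (0 : ℝ), p.eval (x + 1)⁻¹ * (g x / (x + 1) ^ 2) = 0 := by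
  induction p using Polynomial.induction_on' with
  | add p q hp hq =>
    simp only [Polynomial.eval_add, add_mul]
    exact ⟨hp.1.add hq.1, by rw [integral_add hp.1 hq.1, hp.2, hq.2, add_zero]⟩
  | monomial n a =>
    have e : (fun x => (Polynomial.monomial n a).eval (x + 1)⁻¹ * (g x / (x + 1) ^ 2)) =
        fun x => a * (g x / (x + 1) ^ (n + 2)) := by
      ext x
      rw [Polynomial.eval_monomial, inv_pow, pow_add, div_eq_mul_inv, div_eq_mul_inv, mul_inv]
      ring
    rw [e]
    exact ⟨(integrableOn_div_add_pow hg one_pos n).const_mul a, by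
      rw [integral_const_mul, integral_div_add_pow_eq_zero hg h n 1 one_pos, mul_zero]⟩

/-- Uniqueness for the Stieltjes type transform `s ↦ ∫ g(x) / (x + s)² dx`. -/
theorem ae_eq_zero_of_integral_div_add_sq_eq_zero
    (hg : IntegrableOn (fun x => g x / (1 + x ^ 2)) (Ioi 0))
    (h : ∀ s : ℝ, 0 < s → ∫ x in Ioi (0 : ℝ), g x / (x + s) ^ 2 = 0) :
    ∀ᵐ x, x ∈ Ioi (0 : ℝ) → g x / (x + 1) ^ 2 = 0 := by
  have h1 := integrableOn_div_add_pow hg one_pos 0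
  refine isOpen_Ioi.ae_eq_zero_of_integral_contDiff_smul_eq_zero h1.locallyIntegrableOn
    fun η hη hc hs => ?_
  have hη0 : ∀ x, x ≤ 0 → η x = 0 := fun x hx =>
    image_eq_zero_of_notMem_tsupport fun hx' => absurd (mem_Ioi.1 (hs hx')) (not_lt.2 hx)
  have e0 : (∫ x, η x • (g x / (x + 1) ^ 2)) = ∫ x in Ioi (0 : ℝ), η x * (g x / (x + 1) ^ 2) := by
    rw [← setIntegral_eq_integral_of_forall_compl_eq_zero (s := Ioi 0) fun x hx => ?_]
    · rfl
    · rw [hη0 x (not_lt.1 hx), zero_smul]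
  rw [show (fun x => η x • (g x / (x + 1) ^ (0 + 2))) = fun x => η x • (g x / (x + 1) ^ 2) from rfl,
    e0]
  obtain ⟨B, hB⟩ := hc.isCompact.isBounded.subset_closedBall (0 : ℝ)
  have hηB : ∀ x, B < x → η x = 0 := fun x hx =>
    image_eq_zero_of_notMem_tsupport fun hx' => by
      have := hB hx'
      rw [Metric.mem_closedBall, dist_zero_right, Real.norm_eq_abs] at this
      linarith [le_abs_self x]
  have hcont : ContinuousOn (fun y : ℝ => η (y⁻¹ - 1)) (Icc 0 1) := by
    intro y hy
    rcases hy.1.eq_or_lt with rfl | hy0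
    · have hz : ∀ᶠ y in 𝓝[Icc (0 : ℝ) 1] 0, η (y⁻¹ - 1) = 0 := by
        have hlt : ∀ᶠ y in 𝓝[Icc (0 : ℝ) 1] 0, y < (|B| + 1)⁻¹ :=
          nhdsWithin_le_nhds (gt_mem_nhds (by positivity))
        filter_upwards [hlt, self_mem_nhdsWithin] with y h1 h2
        rcases h2.1.eq_or_lt with rfl | h3
        · exact hη0 _ (by norm_num)
        · refine hηB _ ?_
          have := (lt_inv_comm₀ h3 (by positivity)).1 h1
          linarith [le_abs_self B]
      refine ContinuousWithinAt.congr_of_eventuallyEq (f := fun _ => (0 : ℝ))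
        continuousWithinAt_const hz ?_
      exact hη0 _ (by norm_num)
    · refine ContinuousAt.continuousWithinAt ?_
      exact hη.continuous.continuousAt.comp ((continuousAt_inv₀ hy0.ne').sub continuousAt_const)
  set M := ∫ x in Ioi (0 : ℝ), ‖g x / (x + 1) ^ 2‖ with hM
  have hM0 : 0 ≤ M := integral_nonneg fun x => norm_nonneg _
  have hsmall : ∀ ε : ℝ, 0 < ε → |∫ x in Ioi (0 : ℝ), η x * (g x / (x + 1) ^ 2)| ≤ ε * M := by
    intro ε hε
    obtain ⟨p, hp⟩ := exists_polynomial_near_of_continuousOn 0 1 _ hcont ε hε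
    obtain ⟨hpi, hp0⟩ := integral_polynomial_mul_eq_zero hg h p
    have hηi : IntegrableOn (fun x => η x * (g x / (x + 1) ^ 2)) (Ioi 0) := by
      obtain ⟨D, hD⟩ := hc.exists_bound_of_continuous hη.continuous
      exact Integrable.bdd_mul (c := D) h1 hη.continuous.aestronglyMeasurable
        (Eventually.of_forall hD)
    have e : ∫ x in Ioi (0 : ℝ), η x * (g x / (x + 1) ^ 2) = ∫ x in Ioi (0 : ℝ),
        (η x * (g x / (x + 1) ^ 2) - p.eval (x + 1)⁻¹ * (g x / (x + 1) ^ 2)) := by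
      rw [integral_sub hηi hpi, hp0, sub_zero]
    rw [e, ← Real.norm_eq_abs, hM, ← integral_const_mul]
    refine norm_integral_le_of_norm_le (h1.norm.const_mul ε) ?_
    filter_upwards [ae_restrict_mem measurableSet_Ioi] with x hx
    have hx0 : 0 < x := hx
    rw [← sub_mul, norm_mul]
    refine mul_le_mul_of_nonneg_right ?_ (norm_nonneg _)
    have := hp (x + 1)⁻¹ ⟨by positivity, inv_le_one_of_one_le₀ (by linarith)⟩
    rw [inv_inv, add_sub_cancel_right] at this
    rw [Real.norm_eq_abs, abs_sub_comm]
    exact this.le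
  by_contra hne
  have hpos := abs_pos.2 hne
  have := hsmall (|∫ x in Ioi (0 : ℝ), η x * (g x / (x + 1) ^ 2)| / (2 * (M + 1))) (by positivity)
  rw [div_mul_eq_mul_div, le_div_iff₀ (by positivity)] at this
  nlinarith

end

section
variable {H : Type} [NormedAddCommGroup H] [InnerProductSpace ℂ H]

theorem IsResolventAt.unique {A : H →ₗ.[ℂ] H} {z : ℂ} {R R' : H →L[ℂ] H} (h : IsResolventAt A z R)
    (h' : IsResolventAt A z R') : R = R' := by
  ext f
  obtain ⟨hd, hf⟩ := h.1 f
  have := h'.2 ⟨R f, hd⟩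
  rw [hf] at this
  exact this.symm

theorem HasTraceEq.unique [CompleteSpace H] {T : H →L[ℂ] H} {t t' : ℂ} (h : HasTraceEq T t)
    (h' : HasTraceEq T t') : t = t' := by
  obtain ⟨w, b, _⟩ := exists_hilbertBasis ℂ H
  exact (h w b).unique (h' w b)

/-- Continuous spectral shift functions are unique. -/
theorem IsSpectralShift.eqOn [CompleteSpace H] {A A' : H →ₗ.[ℂ] H} {ξ ξ' : ℝ → ℝ}
    (h : IsSpectralShift A A' ξ) (h' : IsSpectralShift A A' ξ') (hc : ContinuousOn ξ (Ioi 0))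
    (hc' : ContinuousOn ξ' (Ioi 0)) : EqOn ξ ξ' (Ioi 0) := by
  have hg : IntegrableOn (fun x => (ξ x - ξ' x) / (1 + x ^ 2)) (Ioi 0) := by
    simp_rw [sub_div]
    exact (h.integrable.sub h'.integrable).integrableOn
  have hz : ∀ s : ℝ, 0 < s → ∫ x in Ioi (0 : ℝ), (ξ x - ξ' x) / (x + s) ^ 2 = 0 := by
    intro s hs
    obtain ⟨R, S, h1, h2, h3⟩ := h.trace_formula s hs
    obtain ⟨R', S', h1', h2', h3'⟩ := h'.trace_formula s hs
    rw [← h1.unique h1', ← h2.unique h2'] at h3'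
    have h4 := Complex.ofReal_injective (h3.unique h3')
    simp_rw [sub_div]
    rw [integral_sub (integrableOn_div_add_pow h.integrable.integrableOn hs 0)
      (integrableOn_div_add_pow h'.integrable.integrableOn hs 0)]
    linarith
  refine Measure.eqOn_open_of_ae_eq (μ := (volume : Measure ℝ)) ?_ isOpen_Ioi hc hc'
  rw [EventuallyEq, ae_restrict_iff' measurableSet_Ioi]
  filter_upwards [ae_eq_zero_of_integral_div_add_sq_eq_zero hg hz] with x hx hx0
  have h5 : (x + 1) ^ 2 ≠ 0 := by
    have : 0 < x := hx0
    positivity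
  exact sub_eq_zero.1 ((div_eq_zero_iff.1 (hx hx0)).resolve_right h5)

end

section
variable {V V' : ℝ → ℝ} {I : Set ℝ}

theorem IsDirichletPair.congr_potential (hV : ∀ᵐ x ∂(volume : Measure ℝ).restrict I, V x = V' x)
    {u v g : ℝ → ℂ} (h : IsDirichletPair V I u v g) : IsDirichletPair V' I u v g :=
  ⟨h.ac_fst, h.ac_snd, h.boundary, h.deriv_fst, by
    filter_upwards [h.deriv_snd, hV] with x h1 h2
    rwa [← h2]⟩

theorem dirichletSchrodinger_congr (hV : ∀ᵐ x ∂(volume : Measure ℝ).restrict I, V x = V' x) :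
    dirichletSchrodinger V I = dirichletSchrodinger V' I := by
  have hV' : ∀ᵐ x ∂(volume : Measure ℝ).restrict I, V' x = V x := hV.mono fun _ => Eq.symm
  have : dirichletGraph V I = dirichletGraph V' I := by
    ext p
    exact ⟨fun ⟨u, v, h, hu⟩ => ⟨u, v, h.congr_potential hV, hu⟩,
      fun ⟨u, v, h, hu⟩ => ⟨u, v, h.congr_potential hV', hu⟩⟩
  rw [dirichletSchrodinger, this, dirichletSchrodinger]

theorem energyDifference_congr (hV : ∀ᵐ x ∂halfLine, V x = V' x) (N : ℕ) (L : ℝ) :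
    energyDifference V N L = energyDifference V' N L := by
  rw [energyDifference, energyDifference, dirichletSchrodinger_congr
    (ae_restrict_of_ae_restrict_of_subset Ioo_subset_Ioi_self hV)]

theorem IsPhaseShift.congr_potential (hV : ∀ᵐ x ∂halfLine, V x = V' x) {δ : ℝ → ℝ}
    (h : IsPhaseShift V δ) : IsPhaseShift V' δ := by
  intro k hk
  obtain ⟨θ, hθ, hlim⟩ := h k hk
  refine ⟨θ, ⟨hθ.zero, hθ.ac, ?_⟩, hlim⟩
  filter_upwards [hθ.ode, hV] with x h1 h2
  rwa [← h2]

/-- A potential on the half-line has a representative on the line which is measurable and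
everywhere nonnegative. -/
theorem exists_isShortRange_ae_eq (hV_nonneg : ∀ x : ℝ, 0 < x → 0 ≤ V x)
    (hV_int : IntegrableOn (fun x : ℝ => V x * (1 + x ^ 2)) (Ioi 0)) :
    ∃ W : ℝ → ℝ, IsShortRange W ∧ ∀ᵐ x ∂halfLine, V x = W x := by
  have hm : AEStronglyMeasurable V halfLine := by
    have h1 : AEStronglyMeasurable (fun x : ℝ => V x * (1 + x ^ 2) * (1 + x ^ 2)⁻¹) halfLine :=
      hV_int.1.mul (Measurable.aestronglyMeasurable (by fun_prop))
    refine h1.congr (Eventually.of_forall fun x => ?_)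
    have : 1 + x ^ 2 ≠ 0 := by positivity
    field_simp
  obtain ⟨U, hU, hVU⟩ := hm
  have hae : ∀ᵐ x ∂halfLine, V x = (Ioi (0 : ℝ)).indicator (fun x => max (U x) 0) x := by
    filter_upwards [hVU, ae_restrict_mem measurableSet_Ioi] with x h1 h2
    rw [indicator_of_mem h2, ← h1, max_eq_left (hV_nonneg x h2)]
  refine ⟨_, ⟨(hU.measurable.max measurable_const).indicator measurableSet_Ioi,
    fun x => indicator_nonneg (fun _ _ => le_max_right _ _) x, ?_⟩, hae⟩
  have h2 : IntegrableOn (fun x => max (U x) 0 * (1 + x ^ 2)) (Ioi 0) := by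
    refine hV_int.congr ?_
    filter_upwards [hae, ae_restrict_mem measurableSet_Ioi] with x h1 h2
    rw [h1, indicator_of_mem h2]
  refine ((integrable_indicator_iff measurableSet_Ioi).2 h2).congr (Eventually.of_forall fun x => ?_)
  simp only [indicator_mul_left]

end

theorem theorem1 (V : ℝ → ℝ) (hV_nonneg : ∀ x : ℝ, 0 < x → 0 ≤ V x)
    (hV_int : IntegrableOn (fun x : ℝ => V x * (1 + x ^ 2)) (Ioi 0)) :
    (∃ δ : ℝ → ℝ, IsPhaseShift V δ) ∧
    (∃ ξ : ℝ → ℝ, IsSpectralShift (dirichletSchrodinger (fun _ => 0) (Ioi 0))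
        (dirichletSchrodinger V (Ioi 0)) ξ ∧ ContinuousOn ξ (Ioi 0)) ∧
    ∀ δ ξ : ℝ → ℝ, IsPhaseShift V δ →
      IsSpectralShift (dirichletSchrodinger (fun _ => 0) (Ioi 0))
        (dirichletSchrodinger V (Ioi 0)) ξ →
      ContinuousOn ξ (Ioi 0) →
      (∀ M : ℝ, 0 < M → IntervalIntegrable (fun x => δ (√x)) volume 0 M) ∧
      ∀ E : ℝ, 0 < E →
        ((fun p : ℕ × ℝ => energyDifference V p.1 p.2 -
            (-(1 / Real.pi) * (∫ x in (0 : ℝ)..((p.1 : ℝ) * Real.pi / p.2) ^ 2, δ (√x)) +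
              √E / p.2 * (-δ (√E) + 1 / Real.pi * δ (√E) ^ 2)))
          =o[thermodynamicLimit E] fun p : ℕ × ℝ => 1 / p.2) ∧
        ((fun p : ℕ × ℝ => energyDifference V p.1 p.2 -
            ((∫ x in (0 : ℝ)..E, ξ x) +
              (∫ x in E..((p.1 : ℝ) * Real.pi / p.2) ^ 2, ξ x) +
              √E * Real.pi / p.2 * (ξ E + 1 / Real.pi ^ 2 * δ (√E) ^ 2)))
          =o[thermodynamicLimit E] fun p : ℕ × ℝ => 1 / p.2) := by
  obtain ⟨W, hW, hVW⟩ := exists_isShortRange_ae_eq hV_nonneg hV_int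
  have hWV : ∀ᵐ x ∂halfLine, W x = V x := hVW.mono fun _ => Eq.symm
  rw [dirichletSchrodinger_congr hVW]
  simp only [energyDifference_congr hVW]
  refine ⟨⟨_, hW.isPhaseShift.congr_potential hWV⟩,
    ⟨_, hW.isSpectralShift, hW.continuousOn_spectralShift⟩, fun δ ξ hδ hξ hξc => ?_⟩
  have hδW : ∀ k, 0 < k → δ k = phaseShift W k := fun k hk =>
    (hδ.congr_potential hVW).eq_phaseShift hW hk
  have hξW : ∀ x ∈ Ioi (0 : ℝ), ξ x = spectralShift W x :=
    hξ.eqOn hW.isSpectralShift hξc hW.continuousOn_spectralShift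
  have hcont := hW.isTamePhase.comp_sqrt_continuousOn
  have hpos : ∀ {M x : ℝ}, 0 ≤ M → x ∈ uIoc 0 M → 0 < x := fun hM hx => by
    rw [uIoc_of_le hM] at hx; exact hx.1
  have hδI : ∀ M : ℝ, 0 ≤ M → EqOn (fun x => δ (√x)) (fun x => phaseShift W (√x)) (uIoc 0 M) :=
    fun M hM x hx => hδW _ (Real.sqrt_pos.2 (hpos hM hx))
  have hξI : ∀ M : ℝ, 0 ≤ M → EqOn ξ (fun x => -(1 / Real.pi) * phaseShift W (√x)) (uIoc 0 M) :=
    fun M hM x hx => by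
      have h0 := hpos hM hx
      simp only [hξW x h0, spectralShift_of_pos h0]
  have hξii : ∀ M : ℝ, 0 ≤ M → IntervalIntegrable ξ volume 0 M := fun M hM =>
    ((continuous_const.mul hcont).intervalIntegrable 0 M).congr (hξI M hM).symm
  refine ⟨fun M hM => (hcont.intervalIntegrable 0 M).congr (hδI M hM.le).symm, fun E hE => ?_⟩
  have hE' := Real.sqrt_pos.2 hE
  have hmain := hW.energyDifference_isLittleO hE
  refine ⟨hmain.congr_left fun p => ?_, hmain.congr_left fun p => ?_⟩
  · rw [hδW _ hE', intervalIntegral.integral_congr_ae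
      (Eventually.of_forall (hδI _ (sq_nonneg _)))]
  · have hK : 0 ≤ ((p.1 : ℝ) * Real.pi / p.2) ^ 2 := sq_nonneg _
    rw [intervalIntegral.integral_add_adjacent_intervals (hξii E hE.le)
      ((hξii E hE.le).symm.trans (hξii _ hK)), intervalIntegral.integral_congr_ae
        (Eventually.of_forall (hξI _ hK)),
      intervalIntegral.integral_const_mul, hδW _ hE', hξW E hE, spectralShift_of_pos hE]
    have hπ := Real.pi_ne_zero
    congr 2
    field_simp
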